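/- Let $1\le m_1\le m_2$ and $N=m_1+m_2$. Consider $N$ bosonic modes with Hilbert space $L^2(\mathbb R^N)$, quadratures $R=(q_1,\dots,q_N,p_1,\dots,p_N)$ with $[q_j,p_k]=i\delta_{jk}$, and Hamiltonian $H=\frac12\sum_{j=1}^N(q_j^2+p_j^2)$. Split the modes into $\mathcal A_1$ ($m_1$ modes) and $\mathcal A_2$ ($m_2$ modes). A pure (displacement-free) Gaussian state is a unit vector $\psi$ with $\langle\psi,e^{i\xi\cdot R}\psi\rangle=e^{-\frac14\xi^{T}\Sigma\xi}$ for all $\xi\in\mathbb R^{2N}$ and some real symmetric $\Sigma$; then $\Sigma_{kl}=\langle R_kR_l+R_lR_k\rangle$ is its covariance matrix. A Gaussian unitary is a unitary $U$ with $U^\dagger RU=SR+d$, $S$ real symplectic and $d$ a real vector. Write $E(\psi)=\langle\psi,H\psi\rangle$ and define the $2$-local ergotropic gap $$\delta(\psi)=\Big(E(\psi)-\min_{U}E(U\psi)\Big)-\Big(E(\psi)-\min_{U_1,U_2}E\big((U_1\otimes U_2)\psi\big)\Big),$$ where $U$ ranges over the Gaussian unitaries on all $N$ modes and $U_i$ over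 the Gaussian unitaries on $\mathcal A_i$. The Rényi-2 entanglement entropy is $S_2(\psi)=-\log\operatorname{Tr}\rho_{1}^2$, where $\rho_{1}$ is the reduced density operator of $\psi$ on $\mathcal A_1$. (1) For every pure Gaussian state $\psi$ the energy $E(\psi)$ is finite, both minima above are attained, and with $\nu_1,\dots,\nu_{m_1}\ge1$ the symplectic eigenvalues of the covariance matrix of $\rho_{1}$, $$S_2(\psi)=\sum_{j=1}^{m_1}\log\nu_j\;\le\;\sum_{j=1}^{m_1}(\nu_j-1)=\delta(\psi),$$ with equality $S_2(\psi)=\delta(\psi)$ if and only if $\psi$ is a product vector $\psi_1\otimes\psi_2$ across $\mathcal A_1|\mathcal A_2$. (2) If $m_1\ge2$, the two quantities are functionally independent: for every $C>1$ there are pure Gaussian states $\psi,\varphi$ with $S_2(\psi)=S_2(\varphi)=\log C$ but $\delta(\psi)=2(\sqrt C-1)\neq C-1=\delta(\varphi)$. Hence there is no function $F:\mathbb R\to\mathbb R$ with $\delta(\psi)=F(S_2(\psi))$ for all pure Gaussian states $\psi$; nor is there a function $G:\mathbb R\to\mathbb R$ with $S_2(\psi)=G(\delta(\psi))$ for all of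 them. -/

import Mathlib

open MeasureTheory Matrix
open scoped ENNReal

namespace GaussianErgotropy

noncomputable section

/-- The Hilbert space of a bosonic system with modes labelled by `ι`: `L²(ℝ^ι; ℂ)`. -/
abbrev L2 (ι : Type) [Fintype ι] : Type := Lp ℂ 2 (volume : Measure (ι → ℝ))

/-- Phase-space indices: `Sum.inl j` is the position `q_j`, `Sum.inr j` the momentum `p_j`. -/
abbrev Phase (ι : Type) : Type := ι ⊕ ι

/-- The function `x ↦ e^{i (u·x + u·v/2)} ψ(x + v)`, where `ξ = (u, v)`. -/
def weylFun {ι : Type} [Fintype ι] (ξ : Phase ι → ℝ) (ψ : (ι → ℝ) → ℂ) (x : ι → ℝ) : ℂ :=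
  Complex.exp (Complex.I *
      (((ξ ∘ Sum.inl) ⬝ᵥ x + (ξ ∘ Sum.inl) ⬝ᵥ (ξ ∘ Sum.inr) / 2 : ℝ) : ℂ)) *
    ψ (x + ξ ∘ Sum.inr)

theorem memLp_weylFun {ι : Type} [Fintype ι] (ξ : Phase ι → ℝ) (ψ : L2 ι) :
    MemLp (weylFun ξ ψ) 2 (volume : Measure (ι → ℝ)) := by
  have h : MemLp (fun x : ι → ℝ => (ψ : (ι → ℝ) → ℂ) (x + ξ ∘ Sum.inr)) 2 volume :=
    (Lp.memLp ψ).comp_measurePreserving (measurePreserving_add_right volume (ξ ∘ Sum.inr))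
  have hc : Continuous fun x : ι → ℝ => Complex.exp (Complex.I *
      (((ξ ∘ Sum.inl) ⬝ᵥ x + (ξ ∘ Sum.inl) ⬝ᵥ (ξ ∘ Sum.inr) / 2 : ℝ) : ℂ)) := by
    unfold dotProduct
    fun_prop
  refine MemLp.of_le h (hc.aestronglyMeasurable.mul h.1) (Filter.Eventually.of_forall fun x => ?_)
  rw [weylFun, norm_mul, mul_comm Complex.I, Complex.norm_exp_ofReal_mul_I, one_mul]

/-- The Weyl operator `exp(i (u·q + v·p))`, `ξ = (u, v)`, on `L²(ℝ^ι)`, with `[q_j, p_k] = i δ_jk`. -/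
def weyl {ι : Type} [Fintype ι] (ξ : Phase ι → ℝ) (ψ : L2 ι) : L2 ι :=
  (memLp_weylFun ξ ψ).toLp (weylFun ξ ψ)

/-- The orbit `t ↦ exp(i t R_k) ψ` of the one-parameter group of the quadrature `R_k`. -/
def orbit {ι : Type} [Fintype ι] [DecidableEq ι] (k : Phase ι) (ψ : L2 ι) (t : ℝ) : L2 ι :=
  weyl (t • Pi.single k 1) ψ

/-- `ψ` is in the domain of the self-adjoint operator `R_k`, which by Stone's theorem is the
generator of `t ↦ exp(i t R_k)`. -/
def InDomain {ι : Type} [Fintype ι] [DecidableEq ι] (k : Phase ι) (ψ : L2 ι) : Prop :=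
  DifferentiableAt ℝ (orbit k ψ) 0

/-- `R_k ψ`, where `R_(inl j) = q_j` and `R_(inr j) = p_j`; meaningful if `InDomain k ψ`. -/
def quad {ι : Type} [Fintype ι] [DecidableEq ι] (k : Phase ι) (ψ : L2 ι) : L2 ι :=
  (-Complex.I) • deriv (orbit k ψ) 0

/-- `⟨R_k²⟩ = ‖R_k ψ‖²`, which is `∞` outside the domain of `R_k`. -/
def secondMoment {ι : Type} [Fintype ι] [DecidableEq ι] (k : Phase ι) (ψ : L2 ι) : ℝ≥0∞ :=
  open Classical in
  if InDomain k ψ then ENNReal.ofReal (‖quad k ψ‖ ^ 2) else ⊤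

/-- The mean energy `⟨H⟩` of the vector state `ψ` for `H = ½ ∑_j (q_j² + p_j²)`. -/
def energy {ι : Type} [Fintype ι] [DecidableEq ι] (ψ : L2 ι) : ℝ≥0∞ :=
  (∑ k : Phase ι, secondMoment k ψ) / 2

/-- The covariance matrix `Σ_kl = ⟨R_k R_l + R_l R_k⟩ - 2 ⟨R_k⟩ ⟨R_l⟩`. -/
def covMatrix {ι : Type} [Fintype ι] [DecidableEq ι] (ψ : L2 ι) :
    Matrix (Phase ι) (Phase ι) ℝ :=
  Matrix.of fun k l => 2 * (inner ℂ (quad k ψ) (quad l ψ)).re -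
    2 * (inner ℂ ψ (quad k ψ)).re * (inner ℂ ψ (quad l ψ)).re

/-- A pure, displacement-free Gaussian state: a unit vector whose characteristic function is a
centred Gaussian. -/
def IsPureGaussian {ι : Type} [Fintype ι] (ψ : L2 ι) : Prop :=
  ‖ψ‖ = 1 ∧ ∃ V : Matrix (Phase ι) (Phase ι) ℝ, V.IsSymm ∧
    ∀ ξ : Phase ι → ℝ, inner ℂ ψ (weyl ξ ψ) = Complex.exp ((-(ξ ⬝ᵥ V *ᵥ ξ) / 4 : ℝ) : ℂ)

/-- A Gaussian unitary: `U† R U = S R + d` with `S` symplectic, written for the exponentials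
`exp(i ξ·R)`. -/
def IsGaussianUnitary {ι : Type} [Fintype ι] [DecidableEq ι] (U : L2 ι ≃ₗᵢ[ℂ] L2 ι) : Prop :=
  ∃ S ∈ Matrix.symplecticGroup ι ℝ, ∃ d : Phase ι → ℝ, ∀ (ξ : Phase ι → ℝ) (ψ : L2 ι),
    weyl ξ (U ψ) = Complex.exp (Complex.I * ((ξ ⬝ᵥ d : ℝ) : ℂ)) • U (weyl (Sᵀ *ᵥ ξ) ψ)

/-- `h = f ⊗ g`, i.e. `h(x, y) = f(x) g(y)` almost everywhere. -/
def IsTensor {ι κ : Type} [Fintype ι] [Fintype κ] (h : L2 (ι ⊕ κ)) (f : L2 ι) (g : L2 κ) : Prop :=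
  (h : (ι ⊕ κ → ℝ) → ℂ) =ᵐ[volume] fun z => f (z ∘ Sum.inl) * g (z ∘ Sum.inr)

/-- `ψ` is a product vector across the cut `ι | κ`. -/
def IsProduct {ι κ : Type} [Fintype ι] [Fintype κ] (ψ : L2 (ι ⊕ κ)) : Prop :=
  ∃ (f : L2 ι) (g : L2 κ), IsTensor ψ f g

/-- `U = U₁ ⊗ U₂` with Gaussian unitaries `U₁` on the modes `ι` and `U₂` on the modes `κ`. -/
def IsLocalGaussianUnitary {ι κ : Type} [Fintype ι] [DecidableEq ι] [Fintype κ] [DecidableEq κ]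
    (U : L2 (ι ⊕ κ) ≃ₗᵢ[ℂ] L2 (ι ⊕ κ)) : Prop :=
  ∃ (U₁ : L2 ι ≃ₗᵢ[ℂ] L2 ι) (U₂ : L2 κ ≃ₗᵢ[ℂ] L2 κ),
    IsGaussianUnitary U₁ ∧ IsGaussianUnitary U₂ ∧
    ∀ (f : L2 ι) (g : L2 κ) (h : L2 (ι ⊕ κ)), IsTensor h f g → IsTensor (U h) (U₁ f) (U₂ g)

/-- Least energy reachable by global Gaussian unitaries. -/
def globalMin {ι : Type} [Fintype ι] [DecidableEq ι] (ψ : L2 ι) : ℝ≥0∞ :=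
  ⨅ (U : L2 ι ≃ₗᵢ[ℂ] L2 ι) (_ : IsGaussianUnitary U), energy (U ψ)

/-- Least energy reachable by Gaussian unitaries that are local for the cut `ι | κ`. -/
def localMin {ι κ : Type} [Fintype ι] [DecidableEq ι] [Fintype κ] [DecidableEq κ]
    (ψ : L2 (ι ⊕ κ)) : ℝ≥0∞ :=
  ⨅ (U : L2 (ι ⊕ κ) ≃ₗᵢ[ℂ] L2 (ι ⊕ κ)) (_ : IsLocalGaussianUnitary U), energy (U ψ)

/-- Global Gaussian ergotropy. -/
def globalErgotropy {ι : Type} [Fintype ι] [DecidableEq ι] (ψ : L2 ι) : ℝ :=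
  (energy ψ).toReal - (globalMin ψ).toReal

/-- `2`-local Gaussian ergotropy. -/
def localErgotropy {ι κ : Type} [Fintype ι] [DecidableEq ι] [Fintype κ] [DecidableEq κ]
    (ψ : L2 (ι ⊕ κ)) : ℝ :=
  (energy ψ).toReal - (localMin ψ).toReal

/-- The `2`-local ergotropic gap. -/
def ergotropicGap {ι κ : Type} [Fintype ι] [DecidableEq ι] [Fintype κ] [DecidableEq κ]
    (ψ : L2 (ι ⊕ κ)) : ℝ :=
  globalErgotropy ψ - localErgotropy ψ

/-- Integral kernel `ρ(x, x') = ∫ ψ(x, y) conj ψ(x', y) dy` of the reduced density operator on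
the modes `ι`. -/
def reducedKernel {ι κ : Type} [Fintype ι] [Fintype κ] (ψ : L2 (ι ⊕ κ)) (x x' : ι → ℝ) : ℂ :=
  ∫ y : κ → ℝ, ψ (Sum.elim x y) * (starRingEnd ℂ) (ψ (Sum.elim x' y))

/-- The purity `Tr ρ² = ∫∫ |ρ(x, x')|² dx dx'` of the reduced density operator on the modes `ι`. -/
def reducedPurity {ι κ : Type} [Fintype ι] [Fintype κ] (ψ : L2 (ι ⊕ κ)) : ℝ :=
  ∫ x : ι → ℝ, ∫ x' : ι → ℝ, ‖reducedKernel ψ x x'‖ ^ 2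

/-- Rényi-2 entanglement entropy of a pure state across `ι | κ`: `-log Tr ρ²` of the reduced
density operator. -/
def renyiTwo {ι κ : Type} [Fintype ι] [Fintype κ] (ψ : L2 (ι ⊕ κ)) : ℝ :=
  -Real.log (reducedPurity ψ)

/-- Covariance matrix of the reduced state on the modes `ι`. -/
def reducedCov {ι κ : Type} [Fintype ι] [DecidableEq ι] [Fintype κ] [DecidableEq κ]
    (ψ : L2 (ι ⊕ κ)) : Matrix (Phase ι) (Phase ι) ℝ :=
  (covMatrix ψ).submatrix (Sum.map Sum.inl Sum.inl) (Sum.map Sum.inl Sum.inl)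

/-- `ν` lists the symplectic eigenvalues of `σ`, with multiplicity (Williamson normal form). -/
def IsSymplecticSpectrum {ι : Type} [Fintype ι] [DecidableEq ι]
    (σ : Matrix (Phase ι) (Phase ι) ℝ) (ν : ι → ℝ) : Prop :=
  (∀ j, 0 < ν j) ∧ ∃ S ∈ Matrix.symplecticGroup ι ℝ,
    S * σ * Sᵀ = Matrix.fromBlocks (Matrix.diagonal ν) 0 0 (Matrix.diagonal ν)

end

end GaussianErgotropy

open GaussianErgotropy

set_option linter.unusedSectionVars false

namespace GaussianErgotropy

variable {ι κ : Type} [Fintype ι] [DecidableEq ι] [Fintype κ] [DecidableEq κ]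

/-! Everything is read off the covariance matrix V. For a vector with Gaussian characteristic
function the Weyl relations give all inner products along the orbits exp(itR_k), hence the domains,
the second moments and the energy tr V / 4 + |d|² / 2 (`HasGaussianChar.energy_eq`). A Gaussian
unitary replaces V by S V Sᵀ and a displacement only adds energy, so both minima become minima of a
trace over symplectic matrices.

The minimum of tr(S σ Sᵀ) is twice the sum of the symplectic eigenvalues of σ. The lower bound is an
uncertainty relation between conjugate rows (`two_le_gram_of_symplectic_rows`). Attaining it needs
genuine unitaries, but not the whole metaplectic representation: a symplectic matrix is an
orthogonal one times a triangular one (`exists_triMat_gram_eq`), the orthogonal factor does not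
change the trace, and triangular matrices are implemented explicitly by a linear substitution and a
quadratic phase (`triUnitary`).

Purity enters through V = S Sᵀ. A triangular unitary normalizes the position block and makes the
correlation block antisymmetric; the kernel φ(y) conj φ(x), found by Fourier inversion, is then an
explicit Gaussian, and being of rank one it must be that of the vacuum
(`HasGaussianChar.eq_vac_of_reduced`). So the global minimum is N/2. A local unitary acts by a
direct sum, so the local minimum is (∑ ν + ∑ μ)/2 with ν and μ the spectra of the two parts. As V is
symmetric and symplectic, the matrices −(Jσ)² − 1 of the two parts are products AB and BA, so the
spectra agree up to ones (`sum_spectrum_sub_one_eq`) and the gap is ∑ (ν_j − 1).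

Fourier inversion also gives the reduced kernel, whose Gaussian integral yields the purity 1/√det σ
= 1/∏ ν_j. The inequality is log ν ≤ ν − 1, with equality only at ν = 1. If all ν_j are 1, the local
minimizer has covariance matrix 1, hence is a multiple of the vacuum, and undoing a local unitary
leaves a product. For independence, two-mode squeezers applied to the vacuum realize every spectrum
ν ≥ 1, and the product and the sum of the ν_j are independent as soon as there are two of them. -/

/-! ### Skew-symmetric normal forms and Williamson's theorem. -/

open Module RealInnerProductSpace in
/-- Normal form of an injective skew-adjoint operator on a Euclidean space. -/
theorem exists_skew_normal_form (n : ℕ) : ∀ {E : Type} [NormedAddCommGroup E]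
    [InnerProductSpace ℝ E] [FiniteDimensional ℝ E] (A : E →ₗ[ℝ] E),
    (∀ x y, ⟪A x, y⟫ = -⟪x, A y⟫) → Function.Injective A → finrank ℝ E = 2 * n →
    ∃ (e f : Fin n → E) (ν : Fin n → ℝ), (∀ j, 0 < ν j) ∧
      (∀ i j, ⟪e i, e j⟫ = if i = j then 1 else 0) ∧
      (∀ i j, ⟪f i, f j⟫ = if i = j then 1 else 0) ∧
      (∀ i j, ⟪e i, f j⟫ = 0) ∧
      ∀ j, A (e j) = ν j • f j ∧ A (f j) = -(ν j • e j) := by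
  induction n with
  | zero =>
    intro E _ _ _ A _ _ _
    exact ⟨Fin.elim0, Fin.elim0, Fin.elim0, fun j => j.elim0, fun j => j.elim0, fun j => j.elim0,
      fun j => j.elim0, fun j => j.elim0⟩
  | succ n ih =>
    intro E _ _ _ A hA hinj hdim
    -- The square of a skew operator is symmetric. An eigenvector x of A² spans together with A x an
    -- A-invariant plane, which is split off.
    have hsymm : (A ∘ₗ A).IsSymmetric := fun x y => by
      simp [hA]
    let b := hsymm.eigenvectorBasis hdim
    let i₀ : Fin (2 * (n + 1)) := ⟨0, by omega⟩
    set x := b i₀ with hx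
    have hx1 : ‖x‖ = 1 := b.orthonormal.1 i₀
    obtain ⟨μ, hμ⟩ : ∃ μ : ℝ, A (A x) = μ • x :=
      ⟨_, hsymm.apply_eigenvectorBasis hdim i₀⟩
    have hxx : ⟪x, x⟫ = 1 := by rw [real_inner_self_eq_norm_sq, hx1]; norm_num
    have hAx : A x ≠ 0 := fun h => by
      have : x = 0 := hinj (by rw [h, map_zero])
      rw [this, norm_zero] at hx1
      exact zero_ne_one hx1
    set ν := ‖A x‖ with hν
    have hν0 : 0 < ν := norm_pos_iff.mpr hAx
    have hμν : μ = -ν ^ 2 := by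
      have h := hA (A x) x
      rw [hμ, inner_smul_left, hxx, real_inner_self_eq_norm_sq] at h
      simpa using h
    set f := ν⁻¹ • A x with hf
    have hAxf : A x = ν • f := by rw [hf, smul_smul, mul_inv_cancel₀ hν0.ne', one_smul]
    have hAf : A f = -(ν • x) := by
      rw [hf, map_smul, hμ, hμν, smul_smul, ← neg_smul]
      congr 1
      field_simp
    have hff : ⟪f, f⟫ = 1 := by
      rw [hf, inner_smul_left, inner_smul_right, real_inner_self_eq_norm_sq]
      simp only [conj_trivial]
      field_simp
      rw [← hν]
    have hxf : ⟪x, f⟫ = 0 := by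
      have h := hA x x
      rw [real_inner_comm] at h
      have : ⟪x, A x⟫ = 0 := by linarith
      rw [hf, inner_smul_right, this, mul_zero]
    have hfx : ⟪f, x⟫ = 0 := by rw [real_inner_comm]; exact hxf
    set K : Submodule ℝ E := Submodule.span ℝ (Set.range ![x, f])
    have hf1 : ‖f‖ = 1 := by
      rw [real_inner_self_eq_norm_sq] at hff
      exact (pow_eq_one_iff_of_nonneg (norm_nonneg f) two_ne_zero).1 hff
    have hon : Orthonormal ℝ ![x, f] := by
      rw [orthonormal_iff_ite]
      intro i j
      fin_cases i <;> fin_cases j <;> simp [hx1, hf1, hxf, hfx]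
    have hK : finrank ℝ K = 2 := by
      simpa using finrank_span_eq_card hon.linearIndependent
    have hKo : finrank ℝ Kᗮ = 2 * n := by
      have := K.finrank_add_finrank_orthogonal
      omega
    have hmem : ∀ y, y ∈ Kᗮ ↔ ⟪x, y⟫ = 0 ∧ ⟪f, y⟫ = 0 := by
      intro y
      rw [Submodule.mem_orthogonal]
      constructor
      · intro h
        exact ⟨h x (Submodule.subset_span ⟨0, rfl⟩), h f (Submodule.subset_span ⟨1, rfl⟩)⟩
      · rintro ⟨h1, h2⟩ u hu
        induction hu using Submodule.span_induction with
        | mem u hu =>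
          obtain ⟨i, rfl⟩ := hu
          fin_cases i
          · exact h1
          · exact h2
        | zero => simp
        | add u v _ _ hu hv => rw [inner_add_left, hu, hv, add_zero]
        | smul c u _ hu => rw [inner_smul_left, hu, mul_zero]
    -- Skewness carries invariance of the plane over to its orthogonal complement, where the
    -- induction hypothesis applies.
    have hmaps : ∀ y ∈ Kᗮ, A y ∈ Kᗮ := by
      intro y hy
      rw [hmem] at hy ⊢
      have h1 := hA x y
      have h2 := hA f y
      rw [hAxf, inner_smul_left, hy.2, mul_zero] at h1
      rw [hAf, inner_neg_left, inner_smul_left, hy.1, mul_zero, neg_zero] at h2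
      constructor <;> linarith
    obtain ⟨e', f', ν', hν', hee, hff', hef, hA'⟩ := ih (A.restrict hmaps)
      (fun u v => hA u v)
      (fun u v huv => Subtype.ext (hinj (congrArg Subtype.val huv))) hKo
    have he'x : ∀ j, ⟪x, (e' j : E)⟫ = 0 ∧ ⟪f, (e' j : E)⟫ = 0 := fun j => (hmem _).1 (e' j).2
    have hf'x : ∀ j, ⟪x, (f' j : E)⟫ = 0 ∧ ⟪f, (f' j : E)⟫ = 0 := fun j => (hmem _).1 (f' j).2
    refine ⟨Fin.cons x fun j => (e' j : E), Fin.cons f fun j => (f' j : E), Fin.cons ν ν',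
      ?_, ?_, ?_, ?_, ?_⟩
    · intro j
      refine Fin.cases ?_ (fun j => ?_) j
      · exact hν0
      · exact hν' j
    · intro i j
      refine Fin.cases ?_ (fun i => ?_) i <;> refine Fin.cases ?_ (fun j => ?_) j
      · simpa using hxx
      · simpa [(Fin.succ_ne_zero j).symm] using (he'x j).1
      · simpa [real_inner_comm] using (he'x i).1
      · simpa using hee i j
    · intro i j
      refine Fin.cases ?_ (fun i => ?_) i <;> refine Fin.cases ?_ (fun j => ?_) j
      · simpa using hff
      · simpa [(Fin.succ_ne_zero j).symm] using (hf'x j).2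
      · simpa [real_inner_comm] using (hf'x i).2
      · simpa using hff' i j
    · intro i j
      refine Fin.cases ?_ (fun i => ?_) i <;> refine Fin.cases ?_ (fun j => ?_) j
      · simpa using hxf
      · simpa using (hf'x j).1
      · simpa [real_inner_comm] using (he'x i).2
      · simpa using hef i j
    · intro j
      refine Fin.cases ?_ (fun j => ?_) j
      · exact ⟨hAxf, hAf⟩
      · exact ⟨congrArg Subtype.val (hA' j).1, congrArg Subtype.val (hA' j).2⟩

/-- A positive definite real matrix is `Bᵀ B` with `B` invertible. -/
theorem exists_eq_transpose_mul_self {ι : Type} [Fintype ι] [DecidableEq ι] {M : Matrix ι ι ℝ}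
    (hM : M.PosDef) : ∃ B : Matrix ι ι ℝ, IsUnit B.det ∧ M = Bᵀ * B := by
  open scoped MatrixOrder in
  obtain ⟨B, hB, h⟩ := CStarAlgebra.isStrictlyPositive_iff_eq_star_mul_self.mp
    hM.isStrictlyPositive
  exact ⟨B, (Matrix.isUnit_iff_isUnit_det _).1 hB, by rw [h, star_eq_conjTranspose, conjTranspose_eq_transpose_of_trivial]⟩

/-- Orthogonal normal form of an invertible real antisymmetric matrix. -/
theorem exists_antisymm_normal_form {n : ℕ} (A : Matrix (Phase (Fin n)) (Phase (Fin n)) ℝ)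
    (hA : Aᵀ = -A) (hu : IsUnit A.det) :
    ∃ (O : Matrix (Phase (Fin n)) (Phase (Fin n)) ℝ) (ν : Fin n → ℝ), (∀ j, 0 < ν j) ∧
      O * Oᵀ = 1 ∧ O * A * Oᵀ = fromBlocks 0 (-diagonal ν) (diagonal ν) 0 := by
  let E := EuclideanSpace ℝ (Phase (Fin n))
  have hinner : ∀ x y : E, inner ℝ x y = x.ofLp ⬝ᵥ y.ofLp := fun x y => by
    rw [EuclideanSpace.inner_eq_star_dotProduct, dotProduct_comm]; rfl
  have happ : ∀ x : E, (Matrix.toLpLin 2 2 A x).ofLp = A *ᵥ x.ofLp := fun x => rfl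
  obtain ⟨e, f, ν, hν, hee, hff, hef, hAe⟩ := exists_skew_normal_form n (E := E)
    (Matrix.toLpLin 2 2 A)
    (fun x y => by
      rw [hinner, hinner, happ, happ, dotProduct_comm, dotProduct_mulVec, ← mulVec_transpose, hA,
        neg_mulVec, neg_dotProduct, dotProduct_comm])
    (fun x y hxy => by
      have h : A *ᵥ x.ofLp = A *ᵥ y.ofLp := by rw [← happ, ← happ, hxy]
      exact WithLp.ofLp_injective 2 (mulVec_injective_of_isUnit ((Matrix.isUnit_iff_isUnit_det _).2 hu) h))
    (by simp [E, two_mul])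
  have hfe : ∀ i j, inner ℝ (f i) (e j) = 0 := fun i j => by rw [real_inner_comm]; exact hef j i
  refine ⟨Matrix.of (Sum.elim (fun j => (e j).ofLp) (fun j => (f j).ofLp)), ν, hν, ?_, ?_⟩
  · ext k l
    have : ∀ u v : Phase (Fin n) → Phase (Fin n) → ℝ, (Matrix.of u * (Matrix.of v)ᵀ) k l = u k ⬝ᵥ v l :=
      fun u v => rfl
    rw [this]
    rcases k with i | i <;> rcases l with j | j <;>
      simp only [Sum.elim_inl, Sum.elim_inr, ← hinner, hee, hff, hef, hfe, Matrix.one_apply] <;> simp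
  · ext k l
    have : ∀ u v : Phase (Fin n) → Phase (Fin n) → ℝ,
        (Matrix.of u * A * (Matrix.of v)ᵀ) k l = u k ⬝ᵥ A *ᵥ v l := fun u v => by
      rw [Matrix.mul_assoc]; rfl
    rw [this]
    have he : ∀ j, A *ᵥ (e j).ofLp = ν j • (f j).ofLp := fun j => congrArg WithLp.ofLp (hAe j).1
    have hf : ∀ j, A *ᵥ (f j).ofLp = -(ν j • (e j).ofLp) := fun j => congrArg WithLp.ofLp (hAe j).2
    rcases k with i | i <;> rcases l with j | j <;>
      simp only [Sum.elim_inl, Sum.elim_inr, he, hf, dotProduct_neg, dotProduct_smul,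
        ← hinner, hee, hff, hef, hfe] <;>
      simp [diagonal_apply] <;> split_ifs with h <;> simp [h]

/-- Williamson's theorem. -/
theorem exists_isSymplecticSpectrum {n : ℕ} {σ : Matrix (Phase (Fin n)) (Phase (Fin n)) ℝ}
    (hσ : σ.PosDef) : ∃ ν, IsSymplecticSpectrum σ ν := by
  obtain ⟨B, hB, rfl⟩ := exists_eq_transpose_mul_self hσ
  have hBT : IsUnit Bᵀ.det := by rwa [det_transpose]
  -- With σ = BᵀB, a matrix X B⁻ᵀ with X Xᵀ diagonal diagonalizes σ, and it is symplectic when X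
  -- brings B⁻ᵀ J B⁻¹ to J. Hence the normal form of this antisymmetric matrix is needed.
  have hAT : (Bᵀ⁻¹ * J (Fin n) ℝ * B⁻¹)ᵀ = -(Bᵀ⁻¹ * J (Fin n) ℝ * B⁻¹) := by
    rw [transpose_mul, transpose_mul, J_transpose, transpose_nonsing_inv, transpose_nonsing_inv,
      transpose_transpose]
    simp [Matrix.mul_assoc]
  obtain ⟨O, l, hl, hO, hOA⟩ := exists_antisymm_normal_form (Bᵀ⁻¹ * J (Fin n) ℝ * B⁻¹) hAT (by
    rw [det_mul, det_mul]
    exact ((isUnit_nonsing_inv_det _ hBT).mul (isUnit_det_J _ _)).mul (isUnit_nonsing_inv_det _ hB))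
  -- Rescaling by l^(-1/2) turns the blocks l_j of the normal form into those of J; the symplectic
  -- eigenvalues come out as 1/l_j.
  let D : Matrix (Phase (Fin n)) (Phase (Fin n)) ℝ :=
    diagonal (Sum.elim (fun j => (√(l j))⁻¹) (fun j => (√(l j))⁻¹))
  have hs : ∀ j, (√(l j))⁻¹ * (√(l j))⁻¹ = (l j)⁻¹ := fun j => by
    rw [← mul_inv, Real.mul_self_sqrt (hl j).le]
  refine ⟨fun j => (l j)⁻¹, fun j => inv_pos.mpr (hl j), D * O * Bᵀ⁻¹, ?_, ?_⟩
  · rw [SymplecticGroup.mem_iff]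
    have : D * O * Bᵀ⁻¹ * J (Fin n) ℝ * (D * O * Bᵀ⁻¹)ᵀ
        = D * (O * (Bᵀ⁻¹ * J (Fin n) ℝ * B⁻¹) * Oᵀ) * D := by
      rw [transpose_mul, transpose_mul, transpose_nonsing_inv, transpose_transpose,
        diagonal_transpose]
      simp only [Matrix.mul_assoc, D]
    rw [this, hOA, J]
    ext k q
    rcases k with i | i <;> rcases q with j | j <;>
      simp [D, Matrix.mul_apply, diagonal_apply, Matrix.one_apply]
    all_goals
      split_ifs with h
      swap
      · simp
      subst h
      have h1 := hs i
      have h2 := (hl i).ne'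
      have : (√(l i))⁻¹ * l i * (√(l i))⁻¹ = 1 := by
        rw [mul_right_comm, h1, inv_mul_cancel₀ h2]
      linarith
  · have : D * O * Bᵀ⁻¹ * (Bᵀ * B) * (D * O * Bᵀ⁻¹)ᵀ = D * (O * Oᵀ) * D := by
      rw [transpose_mul, transpose_mul, transpose_nonsing_inv, transpose_transpose,
        diagonal_transpose]
      have h1 : Bᵀ⁻¹ * (Bᵀ * B) = B := nonsing_inv_mul_cancel_left _ _ hBT
      calc _ = D * O * (Bᵀ⁻¹ * (Bᵀ * B)) * (B⁻¹ * (Oᵀ * D)) := by simp only [Matrix.mul_assoc, D]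
        _ = D * O * (B * (B⁻¹ * (Oᵀ * D))) := by rw [h1]; simp only [Matrix.mul_assoc]
        _ = _ := by rw [mul_nonsing_inv_cancel_left _ _ hB]; simp only [Matrix.mul_assoc]
    rw [this, hO, Matrix.mul_one, diagonal_mul_diagonal]
    ext k q
    rcases k with i | i <;> rcases q with j | j <;> simp [diagonal_apply, hs]

/-! ### Trace bounds and invariants of the symplectic spectrum. -/

/-- If the rows of `R` are symplectically normalized, then `‖R_j‖² + ‖R_j'‖² ≥ 2` for each
conjugate pair of rows. -/
theorem two_le_gram_of_symplectic_rows (R : Matrix (Phase ι) (Phase κ) ℝ)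
    (hR : R * J κ ℝ * Rᵀ = J ι ℝ) (j : ι) :
    2 ≤ (R * Rᵀ) (Sum.inl j) (Sum.inl j) + (R * Rᵀ) (Sum.inr j) (Sum.inr j) := by
  set r := R (Sum.inl j)
  set s := R (Sum.inr j)
  have h1 : r ⬝ᵥ J κ ℝ *ᵥ s = -1 := by
    have : (R * J κ ℝ * Rᵀ) (Sum.inl j) (Sum.inr j) = r ⬝ᵥ J κ ℝ *ᵥ s := by
      rw [Matrix.mul_assoc]; rfl
    rw [← this, hR]
    simp [J]
  have h2 : (J κ ℝ *ᵥ s) ⬝ᵥ (J κ ℝ *ᵥ s) = s ⬝ᵥ s := by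
    rw [dotProduct_mulVec, ← mulVec_transpose, mulVec_mulVec, J_transpose, neg_mul, J_squared,
      neg_neg, one_mulVec]
  -- J is an isometry and r · Js = −1, so expanding |r + Js|² ≥ 0 gives |r|² + |s|² ≥ 2.
  have h3 : 0 ≤ (r + J κ ℝ *ᵥ s) ⬝ᵥ (r + J κ ℝ *ᵥ s) := by
    simpa using dotProduct_star_self_nonneg (r + J κ ℝ *ᵥ s)
  rw [add_dotProduct, dotProduct_add, dotProduct_add, h1, h2, dotProduct_comm (J κ ℝ *ᵥ s) r, h1] at h3
  change 2 ≤ r ⬝ᵥ r + s ⬝ᵥ s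
  linarith

/-- By cyclicity the trace is the sum of ν_j times the squared norms of the j-th conjugate pair of
columns of S, that is, of rows of the symplectic matrix Sᵀ; each pair contributes at least 2. -/
theorem trace_doubled_diagonal_ge {S : Matrix (Phase ι) (Phase ι) ℝ}
    (hS : S ∈ symplecticGroup ι ℝ) {ν : ι → ℝ} (hν : ∀ j, 0 ≤ ν j) :
    2 * ∑ j, ν j ≤ (S * fromBlocks (diagonal ν) 0 0 (diagonal ν) * Sᵀ).trace := by
  have hS' : Sᵀ * J ι ℝ * Sᵀᵀ = J ι ℝ := by
    rw [transpose_transpose]; exact SymplecticGroup.mem_iff'.1 hS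
  rw [trace_mul_comm, ← Matrix.mul_assoc, fromBlocks_diagonal, trace]
  simp only [diag_apply, mul_diagonal]
  rw [Fintype.sum_sum_type, ← Finset.sum_add_distrib, Finset.mul_sum]
  refine Finset.sum_le_sum fun j _ => ?_
  have := two_le_gram_of_symplectic_rows Sᵀ hS' j
  rw [transpose_transpose] at this
  simp only [Sum.elim_inl, Sum.elim_inr]
  nlinarith [hν j]

theorem isUnit_det_of_mem_symplecticGroup {S : Matrix (Phase ι) (Phase ι) ℝ}
    (hS : S ∈ symplecticGroup ι ℝ) : IsUnit S.det := SymplecticGroup.symplectic_det hS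

theorem inv_mem_symplecticGroup {S : Matrix (Phase ι) (Phase ι) ℝ}
    (hS : S ∈ symplecticGroup ι ℝ) : S⁻¹ ∈ symplecticGroup ι ℝ := by
  have := (⟨S, hS⟩⁻¹ : symplecticGroup ι ℝ).2
  rwa [SymplecticGroup.coe_inv'] at this

theorem IsSymplecticSpectrum.eq_conj {σ : Matrix (Phase ι) (Phase ι) ℝ} {ν : ι → ℝ}
    (h : IsSymplecticSpectrum σ ν) : ∃ S ∈ symplecticGroup ι ℝ,
      σ = S * fromBlocks (diagonal ν) 0 0 (diagonal ν) * Sᵀ := by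
  obtain ⟨_, S, hS, h⟩ := h
  have hu := isUnit_det_of_mem_symplecticGroup hS
  refine ⟨S⁻¹, inv_mem_symplecticGroup hS, ?_⟩
  have huT : IsUnit Sᵀ.det := by rwa [det_transpose]
  rw [← h, transpose_nonsing_inv, Matrix.mul_assoc S, nonsing_inv_mul_cancel_left _ _ hu,
    mul_nonsing_inv_cancel_right _ _ huT]

theorem IsSymplecticSpectrum.trace_ge {σ : Matrix (Phase ι) (Phase ι) ℝ} {ν : ι → ℝ}
    (h : IsSymplecticSpectrum σ ν) {S : Matrix (Phase ι) (Phase ι) ℝ}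
    (hS : S ∈ symplecticGroup ι ℝ) : 2 * ∑ j, ν j ≤ (S * σ * Sᵀ).trace := by
  obtain ⟨T, hT, rfl⟩ := h.eq_conj
  have := trace_doubled_diagonal_ge (mul_mem hS hT) fun j => (h.1 j).le
  rwa [transpose_mul, Matrix.mul_assoc, ← Matrix.mul_assoc _ Tᵀ, Matrix.mul_assoc S,
    ← Matrix.mul_assoc T, ← Matrix.mul_assoc S, ← Matrix.mul_assoc T] at this

theorem IsSymplecticSpectrum.det_eq {σ : Matrix (Phase ι) (Phase ι) ℝ} {ν : ι → ℝ}
    (h : IsSymplecticSpectrum σ ν) : σ.det = (∏ j, ν j) ^ 2 := by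
  obtain ⟨T, hT, rfl⟩ := h.eq_conj
  rw [det_mul, det_mul, det_transpose, SymplecticGroup.det_eq_one hT, fromBlocks_diagonal,
    det_diagonal, Fintype.prod_sum_type]
  simp [sq]

/-- A symplectic matrix of minimal Frobenius norm is orthogonal. -/
theorem mul_transpose_eq_one_of_trace_eq {S : Matrix (Phase ι) (Phase ι) ℝ}
    (hS : S ∈ symplecticGroup ι ℝ) (h : (S * Sᵀ).trace = 2 * Fintype.card ι) : S * Sᵀ = 1 := by
  have hJJ : J ι ℝ * J ι ℝ = -1 := J_squared _ _
  have h1 : Sᵀ * (J ι ℝ * S) = J ι ℝ := by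
    rw [← Matrix.mul_assoc]; exact SymplecticGroup.mem_iff'.1 hS
  -- The trace of this Gram matrix is 2 tr(S Sᵀ) − 4n, with n the number of modes, and vanishes
  -- under the hypothesis. Hence S commutes with J, and S J Sᵀ = J becomes J S Sᵀ = J.
  have hexp : (S * J ι ℝ - J ι ℝ * S)ᵀ * (S * J ι ℝ - J ι ℝ * S) =
      Sᵀ * S - J ι ℝ * (Sᵀ * S * J ι ℝ) - 1 - 1 := by
    have h2 : J ι ℝ * (Sᵀ * (J ι ℝ * S)) = -1 := by rw [h1, hJJ]
    have h3 : Sᵀ * (J ι ℝ * (S * J ι ℝ)) = -1 := by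
      rw [← Matrix.mul_assoc (J ι ℝ), ← Matrix.mul_assoc, h1, hJJ]
    have h4 : Sᵀ * (J ι ℝ * (J ι ℝ * S)) = -(Sᵀ * S) := by
      rw [← Matrix.mul_assoc (J ι ℝ), hJJ, neg_mul, Matrix.one_mul, mul_neg]
    rw [transpose_sub, transpose_mul, transpose_mul, J_transpose]
    simp only [Matrix.sub_mul, Matrix.mul_sub, Matrix.neg_mul, Matrix.mul_neg, Matrix.mul_assoc,
      h2, h3, h4]
    abel
  have hcomm : S * J ι ℝ - J ι ℝ * S = 0 := by
    rw [← trace_conjTranspose_mul_self_eq_zero_iff, conjTranspose_eq_transpose_of_trivial, hexp]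
    rw [trace_sub, trace_sub, trace_sub, trace_mul_comm (J ι ℝ), Matrix.mul_assoc, hJJ,
      Matrix.mul_neg, Matrix.mul_one, trace_neg, trace_mul_comm, h, trace_one]
    simp
    ring
  have h5 : S * J ι ℝ * Sᵀ = J ι ℝ := SymplecticGroup.mem_iff.1 hS
  rw [sub_eq_zero.1 hcomm, Matrix.mul_assoc] at h5
  have h6 := congrArg (fun M => -(J ι ℝ * M)) h5
  simpa only [← Matrix.mul_assoc, hJJ, neg_mul, neg_neg, Matrix.one_mul] using h6

/-- A symplectic congruence of σ is a similarity of Jσ, and (Jσ)² is diagonal in Williamson form.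
Subtracting 1 sends the trivial symplectic eigenvalue 1 to 0, which is what the comparison of
matrices AB and BA of different sizes requires. -/
theorem IsSymplecticSpectrum.charpoly_eq {σ : Matrix (Phase ι) (Phase ι) ℝ} {ν : ι → ℝ}
    (h : IsSymplecticSpectrum σ ν) : (-(J ι ℝ * σ * (J ι ℝ * σ)) - 1).charpoly =
      (diagonal (Sum.elim (fun j => ν j ^ 2 - 1) (fun j => ν j ^ 2 - 1))).charpoly := by
  obtain ⟨T, hT, rfl⟩ := h.eq_conj
  set D : Matrix (Phase ι) (Phase ι) ℝ := fromBlocks (diagonal ν) 0 0 (diagonal ν) with hD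
  have h1 : Tᵀ * (J ι ℝ * T) = J ι ℝ := by
    rw [← Matrix.mul_assoc]; exact SymplecticGroup.mem_iff'.1 hT
  have huT : IsUnit Tᵀ.det := by
    rw [det_transpose]; exact isUnit_det_of_mem_symplecticGroup hT
  have hJD : J ι ℝ * (D * (J ι ℝ * D)) =
      -diagonal (Sum.elim (fun j => ν j ^ 2) (fun j => ν j ^ 2)) := by
    rw [hD, J, fromBlocks_multiply, fromBlocks_multiply, fromBlocks_multiply]
    simp only [Matrix.zero_mul, Matrix.mul_zero, Matrix.neg_mul, Matrix.one_mul, add_zero, zero_add,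
      Matrix.mul_neg, diagonal_mul_diagonal, neg_zero]
    rw [← fromBlocks_diagonal, fromBlocks_neg]
    simp [sq]
  have hJ : J ι ℝ * T = Tᵀ⁻¹ * J ι ℝ := by
    conv_rhs => rw [← h1]
    rw [nonsing_inv_mul_cancel_left _ _ huT]
  have key : -(J ι ℝ * (T * D * Tᵀ) * (J ι ℝ * (T * D * Tᵀ))) - 1 =
      Tᵀ⁻¹ * (diagonal (Sum.elim (fun j => ν j ^ 2 - 1) (fun j => ν j ^ 2 - 1)) * Tᵀ) := by
    have e1 : J ι ℝ * (T * D * Tᵀ) = Tᵀ⁻¹ * (J ι ℝ * (D * Tᵀ)) := by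
      rw [Matrix.mul_assoc T, ← Matrix.mul_assoc (J ι ℝ), hJ, Matrix.mul_assoc]
    have e2 : J ι ℝ * (D * Tᵀ) * (Tᵀ⁻¹ * (J ι ℝ * (D * Tᵀ))) =
        J ι ℝ * (D * (J ι ℝ * D)) * Tᵀ := by
      simp only [Matrix.mul_assoc, mul_nonsing_inv_cancel_left _ _ huT]
    rw [e1, Matrix.mul_assoc, e2, hJD]
    have e3 : (diagonal (Sum.elim (fun j => ν j ^ 2 - 1) (fun j => ν j ^ 2 - 1)) :
        Matrix (Phase ι) (Phase ι) ℝ) =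
        diagonal (Sum.elim (fun j => ν j ^ 2) (fun j => ν j ^ 2)) - 1 := by
      rw [← diagonal_one, diagonal_sub]
      congr 1
      ext k
      rcases k with k | k <;> rfl
    rw [e3, Matrix.sub_mul, Matrix.mul_sub, Matrix.one_mul, nonsing_inv_mul _ huT, Matrix.neg_mul,
      Matrix.mul_neg, neg_neg]
  rw [key, charpoly_mul_comm, Matrix.mul_assoc, mul_nonsing_inv _ huT, Matrix.mul_one]

/-! ### The two local spectra of a pure state. -/

/-- The symplectic form of a composite system is the direct sum of those of the parts. -/
theorem J_submatrix_sum : (J (ι ⊕ κ) ℝ).submatrix (Equiv.sumSumSumComm ι κ ι κ).symm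
    (Equiv.sumSumSumComm ι κ ι κ).symm = fromBlocks (J ι ℝ) 0 0 (J κ ℝ) := by
  ext a b
  rcases a with (a | a) | (a | a) <;> rcases b with (b | b) | (b | b) <;>
    simp [J, Matrix.one_apply]

theorem submatrix_sum_eq_fromBlocks (V : Matrix (Phase (ι ⊕ κ)) (Phase (ι ⊕ κ)) ℝ)
    (hV : Vᵀ = V) : V.submatrix (Equiv.sumSumSumComm ι κ ι κ).symm
      (Equiv.sumSumSumComm ι κ ι κ).symm =
    fromBlocks (V.submatrix (Sum.map Sum.inl Sum.inl) (Sum.map Sum.inl Sum.inl))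
      (V.submatrix (Sum.map Sum.inl Sum.inl) (Sum.map Sum.inr Sum.inr))
      (V.submatrix (Sum.map Sum.inl Sum.inl) (Sum.map Sum.inr Sum.inr))ᵀ
      (V.submatrix (Sum.map Sum.inr Sum.inr) (Sum.map Sum.inr Sum.inr)) := by
  have h : ∀ i j, V i j = V j i := fun i j => congrFun (congrFun hV j) i
  ext a b
  rcases a with (a | a) | (a | a) <;> rcases b with (b | b) | (b | b) <;> simp <;> apply h

/-- For a symmetric symplectic matrix, i.e. the covariance matrix of a pure state, the symplectic
spectra of the two parts coincide up to ones. -/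
theorem sum_spectrum_sub_one_eq {V : Matrix (Phase (ι ⊕ κ)) (Phase (ι ⊕ κ)) ℝ} (hV : Vᵀ = V)
    (hVJ : V ∈ symplecticGroup (ι ⊕ κ) ℝ) {ν : ι → ℝ} {μ : κ → ℝ}
    (hν : IsSymplecticSpectrum
      (V.submatrix (Sum.map Sum.inl Sum.inl) (Sum.map Sum.inl Sum.inl)) ν)
    (hμ : IsSymplecticSpectrum
      (V.submatrix (Sum.map Sum.inr Sum.inr) (Sum.map Sum.inr Sum.inr)) μ) :
    ∑ j, (μ j - 1) = ∑ j, (ν j - 1) := by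
  rw [SymplecticGroup.mem_iff, hV] at hVJ
  have hb := congrArg (fun M => M.submatrix (Equiv.sumSumSumComm ι κ ι κ).symm
    (Equiv.sumSumSumComm ι κ ι κ).symm) hVJ
  simp only [← submatrix_mul_equiv _ _ _ (Equiv.sumSumSumComm ι κ ι κ).symm, J_submatrix_sum,
    submatrix_sum_eq_fromBlocks V hV, fromBlocks_multiply] at hb
  set σ := V.submatrix (Sum.map Sum.inl Sum.inl) (Sum.map Sum.inl Sum.inl)
  set τ := V.submatrix (Sum.map Sum.inr Sum.inr) (Sum.map Sum.inr Sum.inr)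
  set γ := V.submatrix (Sum.map Sum.inl Sum.inl) (Sum.map Sum.inr Sum.inr)
  simp only [Matrix.mul_zero, zero_add, add_zero] at hb
  obtain ⟨h11, -, -, h22⟩ := fromBlocks_inj.1 hb
  -- The upper diagonal block of V J V = J reads σJσ + γJγᵀ = J; multiply by J. The lower block
  -- gives the same two factors in the opposite order.
  have e1 : -(J ι ℝ * σ * (J ι ℝ * σ)) - 1 = J ι ℝ * γ * (J κ ℝ * γᵀ) := by
    have := congrArg (fun M => J ι ℝ * M) h11
    simp only [Matrix.mul_add, J_squared] at this
    simp only [Matrix.mul_assoc] at this ⊢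
    rw [sub_eq_add_neg, ← this]
    abel
  have e2 : -(J κ ℝ * τ * (J κ ℝ * τ)) - 1 = J κ ℝ * γᵀ * (J ι ℝ * γ) := by
    have := congrArg (fun M => J κ ℝ * M) h22
    simp only [Matrix.mul_add, J_squared] at this
    simp only [Matrix.mul_assoc] at this ⊢
    rw [sub_eq_add_neg, ← this]
    abel
  have hc := charpoly_mul_comm' (J ι ℝ * γ) (J κ ℝ * γᵀ)
  rw [← e1, ← e2, hν.charpoly_eq, hμ.charpoly_eq, charpoly_diagonal, charpoly_diagonal] at hc
  have hr := congrArg Polynomial.roots hc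
  have hne : ∀ {α : Type} [Fintype α] (d : α → ℝ),
      ∏ i, (Polynomial.X - Polynomial.C (d i)) ≠ 0 := fun d =>
    (Polynomial.monic_prod_of_monic _ _ fun i _ => Polynomial.monic_X_sub_C _).ne_zero
  have hroots : ∀ {α : Type} [Fintype α] (d : α → ℝ),
      (∏ i, (Polynomial.X - Polynomial.C (d i))).roots = Finset.univ.val.map d := fun d => by
    rw [← Polynomial.roots_multiset_prod_X_sub_C (Finset.univ.val.map d), Multiset.map_map]
    rfl
  rw [Polynomial.roots_mul (mul_ne_zero (pow_ne_zero _ Polynomial.X_ne_zero) (hne _)),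
    Polynomial.roots_mul (mul_ne_zero (pow_ne_zero _ Polynomial.X_ne_zero) (hne _)),
    Polynomial.roots_X_pow, Polynomial.roots_X_pow, hroots, hroots] at hr
  -- The function √(1 + t) − 1 maps ν² − 1 to ν − 1 and kills the zero roots padding the two
  -- characteristic polynomials.
  have hs := congrArg (fun m : Multiset ℝ => (m.map fun t => √(1 + t) - 1).sum) hr
  have hsq : ∀ x : ℝ, 0 < x → √(1 + (x ^ 2 - 1)) - 1 = x - 1 := fun x hx => by
    rw [add_sub_cancel, Real.sqrt_sq hx.le]
  have hsum : ∀ {α : Type} [Fintype α] (d : α → ℝ), (∀ j, 0 < d j) →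
      ((Finset.univ.val.map (Sum.elim (fun j => d j ^ 2 - 1) (fun j => d j ^ 2 - 1))).map
        fun t => √(1 + t) - 1).sum = 2 * ∑ j, (d j - 1) := fun d hd => by
    rw [Multiset.map_map]
    change ∑ k, _ = _
    rw [Fintype.sum_sum_type]
    simp only [Function.comp_apply, Sum.elim_inl, Sum.elim_inr, hsq _ (hd _)]
    ring
  simp only [Multiset.map_add, Multiset.sum_add, Multiset.map_nsmul, Multiset.sum_nsmul,
    Multiset.map_singleton, Multiset.sum_singleton, add_zero, Real.sqrt_one, sub_self, smul_zero,
    zero_add, hsum ν hν.1, hsum μ hμ.1] at hs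
  linarith

/-! ### Direct sums and triangular symplectic matrices. -/

/-- The direct sum of phase-space matrices of two subsystems. -/
noncomputable def dirSum (S : Matrix (Phase ι) (Phase ι) ℝ) (T : Matrix (Phase κ) (Phase κ) ℝ) :
    Matrix (Phase (ι ⊕ κ)) (Phase (ι ⊕ κ)) ℝ :=
  (fromBlocks S 0 0 T).submatrix (Equiv.sumSumSumComm ι κ ι κ) (Equiv.sumSumSumComm ι κ ι κ)

theorem dirSum_transpose (S : Matrix (Phase ι) (Phase ι) ℝ) (T : Matrix (Phase κ) (Phase κ) ℝ) :
    (dirSum S T)ᵀ = dirSum Sᵀ Tᵀ := by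
  rw [dirSum, transpose_submatrix, fromBlocks_transpose, dirSum]
  simp

/-- The correlations between the parts sit in the off-diagonal blocks, which a direct sum does not
mix into the diagonal ones; the local problem therefore splits into two independent ones. -/
theorem trace_dirSum_conj (S : Matrix (Phase ι) (Phase ι) ℝ) (T : Matrix (Phase κ) (Phase κ) ℝ)
    {V : Matrix (Phase (ι ⊕ κ)) (Phase (ι ⊕ κ)) ℝ} (hV : Vᵀ = V) :
    (dirSum S T * V * (dirSum S T)ᵀ).trace =
      (S * V.submatrix (Sum.map Sum.inl Sum.inl) (Sum.map Sum.inl Sum.inl) * Sᵀ).trace +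
      (T * V.submatrix (Sum.map Sum.inr Sum.inr) (Sum.map Sum.inr Sum.inr) * Tᵀ).trace := by
  have hV' : V = (V.submatrix (Equiv.sumSumSumComm ι κ ι κ).symm
      (Equiv.sumSumSumComm ι κ ι κ).symm).submatrix (Equiv.sumSumSumComm ι κ ι κ)
      (Equiv.sumSumSumComm ι κ ι κ) := by
    rw [submatrix_submatrix, Equiv.symm_comp_self, submatrix_id_id]
  conv_lhs => rw [hV', submatrix_sum_eq_fromBlocks V hV]
  rw [dirSum_transpose, dirSum, dirSum, submatrix_mul_equiv, submatrix_mul_equiv,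
    fromBlocks_multiply, fromBlocks_multiply, trace, trace, trace,
    ← (Equiv.sumSumSumComm ι κ ι κ).symm.sum_comp, Fintype.sum_sum_type]
  simp [diag_apply]

/-- The phase-space matrix `[[L⁻¹, 0], [C L⁻¹, Lᵀ]]` of a linear change of variables followed by a
quadratic phase. -/
noncomputable def triMat (L C : Matrix ι ι ℝ) : Matrix (Phase ι) (Phase ι) ℝ :=
  fromBlocks L⁻¹ 0 (C * L⁻¹) Lᵀ

theorem triMat_mem_symplecticGroup {L C : Matrix ι ι ℝ} (hL : IsUnit L.det) (hC : Cᵀ = C) :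
    triMat L C ∈ symplecticGroup ι ℝ := by
  rw [triMat, SymplecticGroup.fromBlocks_mem_iff]
  refine ⟨?_, ?_, ?_⟩
  · rw [transpose_mul, hC, Matrix.mul_assoc]
  · simp
  · rw [← transpose_mul, mul_nonsing_inv _ hL]
    simp

/-- This identifies the action of a local triangular unitary, whose wave-function parameters are
block diagonal, with a direct sum on phase space. -/
theorem triMat_fromBlocks {L C : Matrix ι ι ℝ} {L' C' : Matrix κ κ ℝ} (hL : IsUnit L.det)
    (hL' : IsUnit L'.det) :
    triMat (fromBlocks L 0 0 L') (fromBlocks C 0 0 C') = dirSum (triMat L C) (triMat L' C') := by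
  have hinv : (fromBlocks L 0 0 L')⁻¹ = fromBlocks L⁻¹ 0 0 L'⁻¹ := by
    apply inv_eq_right_inv
    rw [fromBlocks_multiply, mul_nonsing_inv _ hL, mul_nonsing_inv _ hL']
    simp
  rw [triMat, hinv, fromBlocks_multiply, fromBlocks_transpose, dirSum, triMat, triMat]
  ext a b
  rcases a with (a | a) | (a | a) <;> rcases b with (b | b) | (b | b) <;> simp

/-- Reduction of a symmetric matrix with positive definite position block by a triangular
symplectic matrix. -/
theorem exists_triMat_reduction {V : Matrix (Phase ι) (Phase ι) ℝ} (hV : Vᵀ = V)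
    (hpos : V.toBlocks₁₁.PosDef) : ∃ L C K P : Matrix ι ι ℝ, IsUnit L.det ∧ Cᵀ = C ∧ Kᵀ = -K ∧
      triMat L C * V * (triMat L C)ᵀ = fromBlocks 1 K (-K) P := by
  obtain ⟨B, hB, hVB⟩ := exists_eq_transpose_mul_self hpos
  have hBT : IsUnit Bᵀ.det := by rwa [det_transpose]
  set X := V.toBlocks₁₂ with hX
  set Y := V.toBlocks₂₂
  have hVb : V = fromBlocks (Bᵀ * B) X Xᵀ Y := by
    have h21 : V.toBlocks₂₁ = Xᵀ := by
      ext i j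
      exact (congrFun (congrFun hV (Sum.inr i)) (Sum.inl j)).symm
    rw [← hVB, ← h21, fromBlocks_toBlocks]
  set Z := B * Xᵀ * B⁻¹ with hZ
  -- After the substitution L = Bᵀ the position block is 1 and the lower left block is Z; a phase C
  -- adds C to it. This choice cancels the symmetric part of Z.
  set C : Matrix ι ι ℝ := -((1 / 2 : ℝ) • (Z + Zᵀ)) with hC
  have hCT : Cᵀ = C := by
    rw [hC, transpose_neg, transpose_smul, transpose_add, transpose_transpose, add_comm]
  refine ⟨Bᵀ, C, (1 / 2 : ℝ) • (Zᵀ - Z),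
    (C * Bᵀ⁻¹ * (Bᵀ * B) + B * Xᵀ) * (C * Bᵀ⁻¹)ᵀ + (C * Bᵀ⁻¹ * X + B * Y) * Bᵀ,
    hBT, hCT, ?_, ?_⟩
  · rw [transpose_smul, transpose_sub, transpose_transpose, ← smul_neg, neg_sub]
  · have hi : (Bᵀ⁻¹)ᵀ = B⁻¹ := by rw [transpose_nonsing_inv, transpose_transpose]
    have h11 : Bᵀ⁻¹ * (Bᵀ * B) * (Bᵀ⁻¹)ᵀ = 1 := by
      rw [nonsing_inv_mul_cancel_left _ _ hBT, hi, mul_nonsing_inv _ hB]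
    have h21 : C * Bᵀ⁻¹ * (Bᵀ * B) * (Bᵀ⁻¹)ᵀ + B * Xᵀ * (Bᵀ⁻¹)ᵀ =
        -((1 / 2 : ℝ) • (Zᵀ - Z)) := by
      rw [Matrix.mul_assoc C, Matrix.mul_assoc C, h11, Matrix.mul_one, hi, ← hZ, hC]
      ext i j
      simp
      ring
    have h12 : Bᵀ⁻¹ * (Bᵀ * B) * (C * Bᵀ⁻¹)ᵀ + Bᵀ⁻¹ * X * Bᵀᵀᵀ = (1 / 2 : ℝ) • (Zᵀ - Z) := by
      have := congrArg transpose h21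
      simp only [transpose_add, transpose_mul, transpose_neg, transpose_smul, transpose_sub,
        transpose_transpose, Matrix.mul_assoc] at this ⊢
      rw [this, ← smul_neg, neg_sub]
    rw [triMat, hVb, fromBlocks_transpose, fromBlocks_multiply, fromBlocks_multiply]
    simp only [transpose_zero, Matrix.zero_mul, Matrix.mul_zero, add_zero]
    rw [fromBlocks_inj]
    refine ⟨h11, h12, ?_, ?_⟩
    · rw [Matrix.add_mul, transpose_transpose, h21]
    · rw [transpose_transpose]

/-- Every symplectic matrix is the product of an orthogonal and a triangular one. -/
theorem exists_triMat_gram_eq {S : Matrix (Phase ι) (Phase ι) ℝ} (hS : S ∈ symplecticGroup ι ℝ) :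
    ∃ L C : Matrix ι ι ℝ, IsUnit L.det ∧ Cᵀ = C ∧ (triMat L C)ᵀ * triMat L C = Sᵀ * S := by
  have hinv := inv_mem_symplecticGroup hS
  have hu := isUnit_det_of_mem_symplecticGroup hS
  set W := S⁻¹ * S⁻¹ᵀ with hW
  have hWsp : W ∈ symplecticGroup ι ℝ := mul_mem hinv (SymplecticGroup.transpose_mem hinv)
  have hWT : Wᵀ = W := by rw [hW, transpose_mul, transpose_transpose]
  have hWpos : W.PosDef := by
    rw [hW, ← conjTranspose_eq_transpose_of_trivial]
    exact PosDef.mul_conjTranspose_self _ (vecMul_injective_of_isUnit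
      ((Matrix.isUnit_iff_isUnit_det _).2 (isUnit_nonsing_inv_det _ hu)))
  obtain ⟨L, C, K, P, hL, hC, hK, hT⟩ := exists_triMat_reduction hWT
    (hWpos.submatrix Sum.inl_injective)
  have hTm := triMat_mem_symplecticGroup hL hC
  have hTu := isUnit_det_of_mem_symplecticGroup hTm
  refine ⟨L, C, hL, hC, ?_⟩
  set T := triMat L C
  have hN : T * W * Tᵀ ∈ symplecticGroup ι ℝ :=
    mul_mem (mul_mem hTm hWsp) (SymplecticGroup.transpose_mem hTm)
  -- The reduced form of W is itself symplectic: its K is then both symmetric and antisymmetric,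
  -- hence 0, and P = 1. So T W Tᵀ = 1, which says that T S⁻¹ is orthogonal.
  rw [hT, SymplecticGroup.fromBlocks_mem_iff] at hN
  obtain ⟨h1, -, h3⟩ := hN
  rw [transpose_neg, hK, neg_neg, transpose_one, Matrix.one_mul, Matrix.mul_one] at h1
  have hK0 : K = 0 := by
    have h2 : (2 : ℝ) • K = 0 := by
      rw [two_smul]; nth_rewrite 1 [← h1]; simp
    exact (smul_eq_zero.1 h2).resolve_left two_ne_zero
  subst hK0
  have hP : P = 1 := by simpa using h3
  rw [hP, neg_zero, fromBlocks_one] at hT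
  have h4 : T * S⁻¹ * (T * S⁻¹)ᵀ = 1 := by
    rw [← hT, transpose_mul, hW]; simp only [Matrix.mul_assoc]
  have h5 : (T * S⁻¹)ᵀ * (T * S⁻¹) = 1 := mul_eq_one_comm.1 h4
  calc Tᵀ * T = Sᵀ * ((T * S⁻¹)ᵀ * (T * S⁻¹)) * S := by
        rw [transpose_mul, transpose_nonsing_inv]
        have huT : IsUnit Sᵀ.det := by rwa [det_transpose]
        simp only [Matrix.mul_assoc]
        rw [nonsing_inv_mul _ hu, mul_nonsing_inv_cancel_left _ _ huT, Matrix.mul_one]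
    _ = Sᵀ * S := by rw [h5, Matrix.mul_one]

/-- The minimal trace `2 ∑ ν_j` is reached by a triangular symplectic matrix. -/
theorem IsSymplecticSpectrum.exists_triMat_trace_eq {σ : Matrix (Phase ι) (Phase ι) ℝ}
    {ν : ι → ℝ} (h : IsSymplecticSpectrum σ ν) : ∃ L C : Matrix ι ι ℝ, IsUnit L.det ∧ Cᵀ = C ∧
      (triMat L C * σ * (triMat L C)ᵀ).trace = 2 * ∑ j, ν j := by
  obtain ⟨-, S, hS, h⟩ := h
  obtain ⟨L, C, hL, hC, hT⟩ := exists_triMat_gram_eq hS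
  refine ⟨L, C, hL, hC, ?_⟩
  rw [trace_mul_comm, ← Matrix.mul_assoc, hT, Matrix.mul_assoc, trace_mul_comm, h,
    fromBlocks_diagonal, trace_diagonal, Fintype.sum_sum_type, two_mul]
  rfl

/-! ### Uniqueness of the Fourier transform. -/

theorem continuous_dotProduct_right (u : ι → ℝ) : Continuous fun x : ι → ℝ => u ⬝ᵥ x := by
  unfold dotProduct; fun_prop

theorem norm_exp_I_mul_ofReal (t : ℝ) : ‖Complex.exp (Complex.I * (t : ℂ))‖ = 1 := by
  rw [mul_comm, Complex.norm_exp_ofReal_mul_I]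

theorem integrable_exp_mul {f : (ι → ℝ) → ℂ} (hf : Integrable f) (u : ι → ℝ) :
    Integrable fun x => Complex.exp (Complex.I * ((u ⬝ᵥ x : ℝ) : ℂ)) * f x := by
  have hc := continuous_dotProduct_right u
  refine hf.bdd_mul (c := 1) ?_ (Filter.Eventually.of_forall fun x => ?_)
  · exact (by fun_prop : Continuous fun x : ι → ℝ =>
      Complex.exp (Complex.I * ((u ⬝ᵥ x : ℝ) : ℂ))).aestronglyMeasurable
  · rw [norm_exp_I_mul_ofReal]

/-- A real integrable function is determined by its Fourier transform. -/
theorem ae_eq_zero_of_real_fourier_eq_zero {g : (ι → ℝ) → ℝ} (hg : Integrable g)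
    (h : ∀ u : ι → ℝ, ∫ x, Complex.exp (Complex.I * ((u ⬝ᵥ x : ℝ) : ℂ)) * (g x : ℂ) = 0) :
    g =ᵐ[volume] 0 := by
  have hp : ∫⁻ x, ENNReal.ofReal (g x) ≠ ⊤ := hg.lintegral_lt_top.ne
  have hn : ∫⁻ x, ENNReal.ofReal (-g x) ≠ ⊤ := hg.neg.lintegral_lt_top.ne
  have hpm : AEMeasurable (fun x => ENNReal.ofReal (g x)) volume :=
    hg.aestronglyMeasurable.aemeasurable.ennreal_ofReal
  have hnm : AEMeasurable (fun x => ENNReal.ofReal (-g x)) volume :=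
    hg.neg.aestronglyMeasurable.aemeasurable.ennreal_ofReal
  have := isFiniteMeasure_withDensity hp
  have := isFiniteMeasure_withDensity hn
  have hLc : Continuous fun p : (ι → ℝ) × (ι → ℝ) => (dotProductBilin ℝ ℝ) p.1 p.2 := by
    simp only [dotProductBilin_apply_apply]
    unfold dotProduct
    fun_prop
  -- The positive and negative parts of g are densities of finite measures with the same
  -- characteristic function, so the measures coincide.
  have key : (volume : Measure (ι → ℝ)).withDensity (fun x => ENNReal.ofReal (g x)) =
      volume.withDensity (fun x => ENNReal.ofReal (-g x)) := by
    refine ext_of_integral_char_eq (L := dotProductBilin ℝ ℝ) Real.continuous_probChar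
      Real.probChar_ne_one (fun v hv hL => hv ?_) hLc fun w => ?_
    · have : v ⬝ᵥ v = 0 := by
        rw [← dotProductBilin_apply_apply (R := ℝ) (S := ℝ), hL]; rfl
      exact dotProduct_self_eq_zero.1 this
    · rw [integral_withDensity_eq_integral_toReal_smul₀ hpm (by simp),
        integral_withDensity_eq_integral_toReal_smul₀ hnm (by simp), ← sub_eq_zero]
      rw [← integral_sub]
      · rw [← h w]
        refine integral_congr_ae (Filter.Eventually.of_forall fun x => ?_)
        simp only [BoundedContinuousFunction.char_apply, Real.probChar_apply,
          dotProductBilin_apply_apply]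
        rw [← sub_smul, dotProduct_comm, mul_comm Complex.I, Complex.real_smul, mul_comm]
        congr 1
        congr 1
        rcases le_total (g x) 0 with h0 | h0
        · rw [ENNReal.ofReal_of_nonpos h0, ENNReal.toReal_ofReal (neg_nonneg.2 h0)]
          simp
        · rw [ENNReal.ofReal_of_nonpos (neg_nonpos.2 h0), ENNReal.toReal_ofReal h0]
          simp
      · exact (integrable_withDensity_iff_integrable_smul₀' hpm (by simp)).1
          ((BoundedContinuousFunction.char _ hLc w).integrable _)
      · exact (integrable_withDensity_iff_integrable_smul₀' hnm (by simp)).1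
          ((BoundedContinuousFunction.char _ hLc w).integrable _)
  rw [withDensity_eq_iff hpm hnm hp] at key
  filter_upwards [key] with x hx
  rcases le_total (g x) 0 with h0 | h0
  · rw [ENNReal.ofReal_of_nonpos h0, eq_comm, ENNReal.ofReal_eq_zero] at hx
    exact le_antisymm h0 (neg_nonpos.1 hx)
  · rw [ENNReal.ofReal_of_nonpos (neg_nonpos.2 h0), ENNReal.ofReal_eq_zero] at hx
    exact le_antisymm hx h0

/-- An integrable function is determined by its Fourier transform. -/
theorem ae_eq_zero_of_fourier_eq_zero {f : (ι → ℝ) → ℂ} (hf : Integrable f)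
    (h : ∀ u : ι → ℝ, ∫ x, Complex.exp (Complex.I * ((u ⬝ᵥ x : ℝ) : ℂ)) * f x = 0) :
    f =ᵐ[volume] 0 := by
  -- Conjugating the hypothesis at −u shows that the conjugate of f also has zero transform, hence
  -- so do the real and imaginary parts.
  have hconj : ∀ u : ι → ℝ, ∫ x, Complex.exp (Complex.I * ((u ⬝ᵥ x : ℝ) : ℂ)) *
      (starRingEnd ℂ) (f x) = 0 := fun u => by
    rw [← map_zero (starRingEnd ℂ), ← h (-u), ← integral_conj]
    refine integral_congr_ae (Filter.Eventually.of_forall fun x => ?_)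
    simp [← Complex.exp_conj]
  have hcf : Integrable fun x => (starRingEnd ℂ) (f x) :=
    (LinearIsometryEquiv.integrable_comp_iff Complex.conjLIE).2 hf
  have hre := ae_eq_zero_of_real_fourier_eq_zero hf.re fun u => by
    have : ∀ x, Complex.exp (Complex.I * ((u ⬝ᵥ x : ℝ) : ℂ)) * ((RCLike.re (f x) : ℝ) : ℂ) =
        (1 / 2) * (Complex.exp (Complex.I * ((u ⬝ᵥ x : ℝ) : ℂ)) * f x) +
        (1 / 2) * (Complex.exp (Complex.I * ((u ⬝ᵥ x : ℝ) : ℂ)) * (starRingEnd ℂ) (f x)) :=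
      fun x => by
        rw [RCLike.re_to_complex, Complex.re_eq_add_conj]; ring
    simp only [this]
    rw [integral_add ((integrable_exp_mul hf u).const_mul _)
      ((integrable_exp_mul hcf u).const_mul _), integral_const_mul, integral_const_mul, h, hconj]
    simp
  have him := ae_eq_zero_of_real_fourier_eq_zero hf.im fun u => by
    have : ∀ x, Complex.exp (Complex.I * ((u ⬝ᵥ x : ℝ) : ℂ)) * ((RCLike.im (f x) : ℝ) : ℂ) =
        (1 / (2 * Complex.I)) * (Complex.exp (Complex.I * ((u ⬝ᵥ x : ℝ) : ℂ)) * f x) +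
        (-1 / (2 * Complex.I)) *
          (Complex.exp (Complex.I * ((u ⬝ᵥ x : ℝ) : ℂ)) * (starRingEnd ℂ) (f x)) :=
      fun x => by
        rw [RCLike.im_to_complex, Complex.im_eq_sub_conj]; ring
    simp only [this]
    rw [integral_add ((integrable_exp_mul hf u).const_mul _)
      ((integrable_exp_mul hcf u).const_mul _), integral_const_mul, integral_const_mul, h, hconj]
    simp
  filter_upwards [hre, him] with x h1 h2
  exact Complex.ext h1 h2

/-! ### Linear substitutions and real Gaussian integrals. -/

/-- The linear change of variables `x ↦ L x`. -/
noncomputable def mulVecEquiv (L : Matrix ι ι ℝ) (hL : IsUnit L.det) : (ι → ℝ) ≃ᵐ (ι → ℝ) where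
  toFun x := L *ᵥ x
  invFun x := L⁻¹ *ᵥ x
  left_inv x := by
    change L⁻¹ *ᵥ L *ᵥ x = x
    rw [mulVec_mulVec, nonsing_inv_mul _ hL, one_mulVec]
  right_inv x := by
    change L *ᵥ L⁻¹ *ᵥ x = x
    rw [mulVec_mulVec, mul_nonsing_inv _ hL, one_mulVec]
  measurable_toFun := (Continuous.matrix_mulVec continuous_const continuous_id).measurable
  measurable_invFun := (Continuous.matrix_mulVec continuous_const continuous_id).measurable

theorem map_mulVecEquiv (L : Matrix ι ι ℝ) (hL : IsUnit L.det) :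
    Measure.map (mulVecEquiv L hL) volume = ENNReal.ofReal |L.det|⁻¹ • volume := by
  rw [← abs_inv]
  exact Real.map_matrix_volume_pi_eq_smul_volume_pi hL.ne_zero

theorem integral_comp_mulVec {E : Type*} [NormedAddCommGroup E] [NormedSpace ℝ E]
    (L : Matrix ι ι ℝ) (hL : IsUnit L.det) (f : (ι → ℝ) → E) :
    ∫ x, f (L *ᵥ x) = |L.det|⁻¹ • ∫ x, f x := by
  have := integral_map_equiv (μ := volume) (mulVecEquiv L hL) f
  rw [map_mulVecEquiv, integral_smul_measure, ENNReal.toReal_ofReal (by positivity)] at this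
  exact this.symm

theorem integrable_comp_mulVec {E : Type*} [NormedAddCommGroup E]
    (L : Matrix ι ι ℝ) (hL : IsUnit L.det) {f : (ι → ℝ) → E} (hf : Integrable f) :
    Integrable fun x => f (L *ᵥ x) := by
  refine (integrable_map_equiv (mulVecEquiv L hL) f).1 ?_
  rw [map_mulVecEquiv]
  exact hf.smul_measure ENNReal.ofReal_ne_top

theorem quasiMeasurePreserving_mulVec (L : Matrix ι ι ℝ) (hL : IsUnit L.det) :
    Measure.QuasiMeasurePreserving (fun x : ι → ℝ => L *ᵥ x) volume volume := by
  refine ⟨(mulVecEquiv L hL).measurable, ?_⟩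
  change Measure.map (mulVecEquiv L hL) volume ≪ _
  rw [map_mulVecEquiv]
  exact Measure.smul_absolutelyContinuous

theorem integral_exp_neg_mul_dotProduct_self {c : ℝ} :
    ∫ x : ι → ℝ, Real.exp (-c * (x ⬝ᵥ x)) = √(Real.pi / c) ^ Fintype.card ι := by
  rw [← integral_gaussian, ← integral_fintype_prod_volume_eq_pow]
  simp only [← Real.exp_sum, ← Finset.mul_sum, dotProduct, sq]

theorem integrable_exp_neg_mul_dotProduct_self {c : ℝ} (hc : 0 < c) :
    Integrable fun x : ι → ℝ => Real.exp (-c * (x ⬝ᵥ x)) := by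
  have := Integrable.fintype_prod (ι := ι) (f := fun _ x => Real.exp (-c * x ^ 2))
    (μ := fun _ => volume) fun _ => integrable_exp_neg_mul_sq hc
  simp only [← Real.exp_sum, ← Finset.mul_sum, sq] at this
  exact this

theorem integral_exp_neg_mul_quadratic {c : ℝ} {N : Matrix ι ι ℝ} (hN : N.PosDef) :
    ∫ x : ι → ℝ, Real.exp (-c * (x ⬝ᵥ N *ᵥ x)) = √(Real.pi / c) ^ Fintype.card ι / √N.det := by
  obtain ⟨B, hB, rfl⟩ := exists_eq_transpose_mul_self hN
  have : ∀ x : ι → ℝ, x ⬝ᵥ (Bᵀ * B) *ᵥ x = (B *ᵥ x) ⬝ᵥ (B *ᵥ x) := fun x => by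
    rw [← mulVec_mulVec, dotProduct_mulVec, vecMul_transpose]
  simp only [this]
  rw [integral_comp_mulVec B hB (fun y => Real.exp (-c * (y ⬝ᵥ y))),
    integral_exp_neg_mul_dotProduct_self, det_mul, det_transpose, ← sq, Real.sqrt_sq_eq_abs,
    smul_eq_mul, mul_comm, div_eq_mul_inv (_ ^ _)]

theorem integrable_exp_neg_mul_quadratic {c : ℝ} (hc : 0 < c) {N : Matrix ι ι ℝ} (hN : N.PosDef) :
    Integrable fun x : ι → ℝ => Real.exp (-c * (x ⬝ᵥ N *ᵥ x)) := by
  obtain ⟨B, hB, rfl⟩ := exists_eq_transpose_mul_self hN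
  have : ∀ x : ι → ℝ, x ⬝ᵥ (Bᵀ * B) *ᵥ x = (B *ᵥ x) ⬝ᵥ (B *ᵥ x) := fun x => by
    rw [← mulVec_mulVec, dotProduct_mulVec, vecMul_transpose]
  simp only [this]
  exact integrable_comp_mulVec B hB (integrable_exp_neg_mul_dotProduct_self hc)

/-! ### Complex Gaussian kernels and Fourier inversion. -/

/-- The normalized Gaussian `|det M| π^{-n/2} exp(-∑_j ((M z)_j + i b_j)²)`. -/
noncomputable def gaussKer (M : Matrix ι ι ℝ) (b z : ι → ℝ) : ℂ :=
  (|M.det| * (√Real.pi ^ Fintype.card ι)⁻¹ : ℝ) *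
    Complex.exp (-∑ j, (((M *ᵥ z) j : ℂ) + Complex.I * b j) ^ 2)

/-- Expanding the square brings the exponent to the shape of
`GaussianFourier.integral_cexp_neg_sum_mul_add`, with the constant ∑ b_j² left over. -/
theorem gauss_exponent (b y z : ι → ℝ) :
    Complex.I * ((y ⬝ᵥ z : ℝ) : ℂ) + -∑ j, ((z j : ℂ) + Complex.I * b j) ^ 2 =
      (-∑ j, (1 : ℂ) * (z j : ℂ) ^ 2 + ∑ j, (Complex.I * y j - 2 * Complex.I * b j) * (z j : ℂ)) +
        ∑ j, (b j : ℂ) ^ 2 := by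
  simp only [dotProduct, Complex.ofReal_sum, Finset.mul_sum, ← Finset.sum_neg_distrib,
    ← Finset.sum_add_distrib]
  refine Finset.sum_congr rfl fun j _ => ?_
  push_cast
  linear_combination (-(b j : ℂ) ^ 2) * Complex.I_sq

theorem integrable_gaussKer {M : Matrix ι ι ℝ} (hM : IsUnit M.det) (b : ι → ℝ) :
    Integrable (gaussKer M b) := by
  have h := GaussianFourier.integrable_cexp_neg_sum_mul_add (ι := ι) (b := fun _ => (1 : ℂ))
    (by simp) (fun j => Complex.I * ((0 : ι → ℝ) j : ℂ) - 2 * Complex.I * b j)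
  have h2 := (integrable_comp_mulVec M hM (h.mul_const (Complex.exp (∑ j, (b j : ℂ) ^ 2)))).const_mul
    (((|M.det| * (√Real.pi ^ Fintype.card ι)⁻¹ : ℝ)) : ℂ)
  refine h2.congr (Filter.Eventually.of_forall fun z => ?_)
  simp only [gaussKer]
  rw [← Complex.exp_add, ← gauss_exponent]
  simp

/-- Fourier transform of a Gaussian. -/
theorem fourier_gaussKer {M : Matrix ι ι ℝ} (hM : IsUnit M.det) (b y : ι → ℝ) :
    ∫ z, Complex.exp (Complex.I * (((Mᵀ *ᵥ y) ⬝ᵥ z : ℝ) : ℂ)) * gaussKer M b z =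
      Complex.exp ((-(y ⬝ᵥ y) / 4 + y ⬝ᵥ b : ℝ) : ℂ) := by
  let F : (ι → ℝ) → ℂ := fun w => ((|M.det| * (√Real.pi ^ Fintype.card ι)⁻¹ : ℝ) : ℂ) *
    (Complex.exp (-∑ j, (1 : ℂ) * (w j : ℂ) ^ 2 +
      ∑ j, (Complex.I * y j - 2 * Complex.I * b j) * (w j : ℂ)) *
        Complex.exp (∑ j, (b j : ℂ) ^ 2))
  have h1 : ∀ z, Complex.exp (Complex.I * (((Mᵀ *ᵥ y) ⬝ᵥ z : ℝ) : ℂ)) * gaussKer M b z =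
      F (M *ᵥ z) := fun z => by
    simp only [F]
    rw [← Complex.exp_add, ← gauss_exponent, Complex.exp_add, gaussKer, mulVec_transpose,
      ← dotProduct_mulVec]
    ring
  simp only [h1]
  rw [integral_comp_mulVec M hM F, integral_const_mul, integral_mul_const,
    GaussianFourier.integral_cexp_neg_sum_mul_add (by simp), Finset.prod_mul_distrib,
    Finset.prod_const, ← Complex.exp_sum, mul_assoc, ← Complex.exp_add]
  have hpi : ((Real.pi : ℂ) / 1) ^ (1 / 2 : ℂ) = ((√Real.pi : ℝ) : ℂ) := by
    rw [div_one, Real.sqrt_eq_rpow, Complex.ofReal_cpow Real.pi_pos.le]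
    norm_num
  have hM0 : |M.det| ≠ 0 := abs_ne_zero.2 hM.ne_zero
  have hp0 : √Real.pi ^ Fintype.card ι ≠ 0 := pow_ne_zero _ (Real.sqrt_ne_zero'.2 Real.pi_pos)
  rw [hpi, Finset.card_univ, Complex.real_smul, ← mul_assoc, ← mul_assoc]
  have hone : ((|M.det|⁻¹ : ℝ) : ℂ) * ((|M.det| * (√Real.pi ^ Fintype.card ι)⁻¹ : ℝ) : ℂ) *
      ((√Real.pi : ℝ) : ℂ) ^ Fintype.card ι = 1 := by
    norm_cast
    field_simp
  rw [hone, one_mul]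
  congr 1
  simp only [dotProduct]
  push_cast
  rw [neg_div, Finset.sum_div, ← Finset.sum_neg_distrib, ← Finset.sum_add_distrib,
    ← Finset.sum_add_distrib]
  refine Finset.sum_congr rfl fun j _ => ?_
  linear_combination ((y j : ℂ) - 2 * b j) ^ 2 / 4 * Complex.I_sq

/-- A function whose Fourier transform is a Gaussian is a Gaussian. -/
theorem ae_eq_gaussKer {r : (ι → ℝ) → ℂ} (hr : Integrable r) {a k p M : Matrix ι ι ℝ}
    (hM : IsUnit M.det) (ha : M * a * Mᵀ = 1) (v : ι → ℝ)
    (h : ∀ u : ι → ℝ, ∫ x, Complex.exp (Complex.I * ((u ⬝ᵥ x + u ⬝ᵥ v / 2 : ℝ) : ℂ)) * r x =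
      Complex.exp ((-(u ⬝ᵥ a *ᵥ u + 2 * (u ⬝ᵥ k *ᵥ v) + v ⬝ᵥ p *ᵥ v) / 4 : ℝ) : ℂ)) :
    r =ᵐ[volume] fun x => Complex.exp ((-(v ⬝ᵥ p *ᵥ v) / 4 : ℝ) : ℂ) *
      gaussKer M (-(1 / 2 : ℝ) • (M *ᵥ k *ᵥ v)) (x + (1 / 2 : ℝ) • v) := by
  set G : (ι → ℝ) → ℂ := fun x => Complex.exp ((-(v ⬝ᵥ p *ᵥ v) / 4 : ℝ) : ℂ) *
      gaussKer M (-(1 / 2 : ℝ) • (M *ᵥ k *ᵥ v)) (x + (1 / 2 : ℝ) • v) with hG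
  have hGi : Integrable G :=
    ((integrable_gaussKer hM _).comp_add_right _).const_mul _
  have hsub : (fun x => r x - G x) =ᵐ[volume] 0 := by
    refine ae_eq_zero_of_fourier_eq_zero (hr.sub hGi) fun u => ?_
    -- In the frequency variable y the quadratic form of a becomes y · y, the form computed in
    -- `fourier_gaussKer`.
    obtain ⟨y, rfl⟩ : ∃ y, u = Mᵀ *ᵥ y := by
      refine ⟨Mᵀ⁻¹ *ᵥ u, ?_⟩
      rw [mulVec_mulVec, mul_nonsing_inv _ (by rwa [det_transpose]), one_mulVec]
    have hGF : ∫ x, Complex.exp (Complex.I * (((Mᵀ *ᵥ y) ⬝ᵥ x + (Mᵀ *ᵥ y) ⬝ᵥ v / 2 : ℝ) : ℂ)) *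
        G x = Complex.exp ((-((Mᵀ *ᵥ y) ⬝ᵥ a *ᵥ (Mᵀ *ᵥ y) + 2 * ((Mᵀ *ᵥ y) ⬝ᵥ k *ᵥ v) +
          v ⬝ᵥ p *ᵥ v) / 4 : ℝ) : ℂ) := by
      -- Centring at the midpoint x + v/2 absorbs the phase u · v/2 of the Weyl operator.
      have e1 : ∀ x, Complex.exp (Complex.I *
          (((Mᵀ *ᵥ y) ⬝ᵥ x + (Mᵀ *ᵥ y) ⬝ᵥ v / 2 : ℝ) : ℂ)) * G x =
          (fun z => Complex.exp ((-(v ⬝ᵥ p *ᵥ v) / 4 : ℝ) : ℂ) *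
            (Complex.exp (Complex.I * (((Mᵀ *ᵥ y) ⬝ᵥ z : ℝ) : ℂ)) *
              gaussKer M (-(1 / 2 : ℝ) • (M *ᵥ k *ᵥ v)) z)) (x + (1 / 2 : ℝ) • v) := fun x => by
        simp only [hG, dotProduct_add, dotProduct_smul, smul_eq_mul]
        rw [show (Mᵀ *ᵥ y) ⬝ᵥ v / 2 = 1 / 2 * ((Mᵀ *ᵥ y) ⬝ᵥ v) by ring]
        ring
      simp only [e1]
      rw [integral_add_right_eq_self (fun z => Complex.exp ((-(v ⬝ᵥ p *ᵥ v) / 4 : ℝ) : ℂ) *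
            (Complex.exp (Complex.I * (((Mᵀ *ᵥ y) ⬝ᵥ z : ℝ) : ℂ)) *
              gaussKer M (-(1 / 2 : ℝ) • (M *ᵥ k *ᵥ v)) z)), integral_const_mul,
        fourier_gaussKer hM, ← Complex.exp_add, ← Complex.ofReal_add]
      congr 2
      have e2 : (Mᵀ *ᵥ y) ⬝ᵥ a *ᵥ (Mᵀ *ᵥ y) = y ⬝ᵥ y := by
        rw [mulVec_transpose, ← dotProduct_mulVec, ← mulVec_transpose, mulVec_mulVec, mulVec_mulVec,
          ha, one_mulVec]
      have e3 : (Mᵀ *ᵥ y) ⬝ᵥ k *ᵥ v = y ⬝ᵥ M *ᵥ k *ᵥ v := by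
        rw [mulVec_transpose, ← dotProduct_mulVec]
      rw [e2, e3, dotProduct_smul, smul_eq_mul]
      ring
    have hsplit : ∀ x, Complex.exp (Complex.I * (((Mᵀ *ᵥ y) ⬝ᵥ x : ℝ) : ℂ)) * (r x - G x) =
        Complex.exp (-(Complex.I * (((Mᵀ *ᵥ y) ⬝ᵥ v / 2 : ℝ) : ℂ))) *
        (Complex.exp (Complex.I * (((Mᵀ *ᵥ y) ⬝ᵥ x + (Mᵀ *ᵥ y) ⬝ᵥ v / 2 : ℝ) : ℂ)) * r x -
        Complex.exp (Complex.I * (((Mᵀ *ᵥ y) ⬝ᵥ x + (Mᵀ *ᵥ y) ⬝ᵥ v / 2 : ℝ) : ℂ)) * G x) :=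
      fun x => by
        rw [← mul_sub, ← mul_assoc, ← Complex.exp_add]
        congr 2
        push_cast
        ring
    have hint : ∀ {f : (ι → ℝ) → ℂ}, Integrable f → Integrable fun x =>
        Complex.exp (Complex.I * (((Mᵀ *ᵥ y) ⬝ᵥ x + (Mᵀ *ᵥ y) ⬝ᵥ v / 2 : ℝ) : ℂ)) * f x := by
      intro f hf
      refine ((integrable_exp_mul hf (Mᵀ *ᵥ y)).const_mul
        (Complex.exp (Complex.I * (((Mᵀ *ᵥ y) ⬝ᵥ v / 2 : ℝ) : ℂ)))).congr
        (Filter.Eventually.of_forall fun x => ?_)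
      simp only []
      rw [← mul_assoc, ← Complex.exp_add]
      congr 2
      push_cast
      ring
    simp only [hsplit]
    rw [integral_const_mul, integral_sub (hint hr) (hint hGi), h, hGF, sub_self, mul_zero]
  filter_upwards [hsub] with x hx
  exact sub_eq_zero.1 hx

theorem norm_gaussKer (M : Matrix ι ι ℝ) (b z : ι → ℝ) :
    ‖gaussKer M b z‖ = |M.det| * (√Real.pi ^ Fintype.card ι)⁻¹ *
      Real.exp (-((M *ᵥ z) ⬝ᵥ (M *ᵥ z)) + b ⬝ᵥ b) := by
  rw [gaussKer, norm_mul, Complex.norm_exp, Complex.norm_real, Real.norm_of_nonneg (by positivity)]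
  congr 2
  simp only [Complex.neg_re, Complex.re_sum, dotProduct, ← Finset.sum_neg_distrib,
    ← Finset.sum_add_distrib]
  refine Finset.sum_congr rfl fun j _ => ?_
  simp [sq]
  ring

/-! ### Weyl operators. -/

section

theorem coeFn_weyl (ξ : Phase ι → ℝ) (ψ : L2 ι) : weyl ξ ψ =ᵐ[volume] weylFun ξ ψ :=
  MemLp.coeFn_toLp _

theorem ae_comp_add_right {p : (ι → ℝ) → Prop} (h : ∀ᵐ x, p x) (v : ι → ℝ) :
    ∀ᵐ x : ι → ℝ, p (x + v) :=
  (measurePreserving_add_right volume v).quasiMeasurePreserving.ae h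

theorem weyl_eq_of_ae {ξ : Phase ι → ℝ} {ψ φ : L2 ι} (h : φ =ᵐ[volume] weylFun ξ ψ) :
    weyl ξ ψ = φ :=
  Lp.ext ((coeFn_weyl ξ ψ).trans h.symm)

theorem weyl_add_vec (ξ : Phase ι → ℝ) (ψ φ : L2 ι) : weyl ξ (ψ + φ) = weyl ξ ψ + weyl ξ φ := by
  refine weyl_eq_of_ae ?_
  filter_upwards [Lp.coeFn_add (weyl ξ ψ) (weyl ξ φ), coeFn_weyl ξ ψ, coeFn_weyl ξ φ,
    ae_comp_add_right (Lp.coeFn_add ψ φ) (ξ ∘ Sum.inr)] with x h1 h2 h3 h4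
  rw [h1, Pi.add_apply, h2, h3, weylFun, weylFun, weylFun, h4, Pi.add_apply, mul_add]

theorem weyl_smul_vec (ξ : Phase ι → ℝ) (c : ℂ) (ψ : L2 ι) : weyl ξ (c • ψ) = c • weyl ξ ψ := by
  refine weyl_eq_of_ae ?_
  filter_upwards [Lp.coeFn_smul c (weyl ξ ψ), coeFn_weyl ξ ψ,
    ae_comp_add_right (Lp.coeFn_smul c ψ) (ξ ∘ Sum.inr)] with x h1 h2 h4
  rw [h1, Pi.smul_apply, h2, weylFun, weylFun, h4, Pi.smul_apply, smul_eq_mul, smul_eq_mul]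
  ring

theorem norm_weyl (ξ : Phase ι → ℝ) (ψ : L2 ι) : ‖weyl ξ ψ‖ = ‖ψ‖ := by
  rw [weyl, Lp.norm_toLp, Lp.norm_def]
  congr 1
  rw [← eLpNorm_comp_measurePreserving (Lp.aestronglyMeasurable ψ)
    (measurePreserving_add_right volume (ξ ∘ Sum.inr))]
  refine eLpNorm_congr_norm_ae (Filter.Eventually.of_forall fun x => ?_)
  rw [weylFun, norm_mul, norm_exp_I_mul_ofReal, one_mul]
  rfl

/-- The Weyl operator as a linear isometry. -/
noncomputable def weylIsometry (ξ : Phase ι → ℝ) : L2 ι →ₗᵢ[ℂ] L2 ι where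
  toFun := weyl ξ
  map_add' := weyl_add_vec ξ
  map_smul' := weyl_smul_vec ξ
  norm_map' := norm_weyl ξ

theorem inner_weyl_weyl (ξ : Phase ι → ℝ) (ψ φ : L2 ι) :
    inner ℂ (weyl ξ ψ) (weyl ξ φ) = inner ℂ ψ φ :=
  (weylIsometry ξ).inner_map_map ψ φ

/-- The standard symplectic form on phase space. -/
def sympForm (ξ η : Phase ι → ℝ) : ℝ :=
  (ξ ∘ Sum.inl) ⬝ᵥ (η ∘ Sum.inr) - (η ∘ Sum.inl) ⬝ᵥ (ξ ∘ Sum.inr)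

/-- Translating by the first vector shifts the phase of the second factor; with the symmetric
half-phases only half the symplectic form is left over. -/
theorem weyl_weyl (ξ η : Phase ι → ℝ) (ψ : L2 ι) :
    weyl ξ (weyl η ψ) =
      Complex.exp (Complex.I * ((-sympForm ξ η / 2 : ℝ) : ℂ)) • weyl (ξ + η) ψ := by
  refine weyl_eq_of_ae ?_
  filter_upwards [Lp.coeFn_smul (Complex.exp (Complex.I * ((-sympForm ξ η / 2 : ℝ) : ℂ)))
    (weyl (ξ + η) ψ), coeFn_weyl (ξ + η) ψ,
    ae_comp_add_right (coeFn_weyl η ψ) (ξ ∘ Sum.inr)] with x h1 h2 h3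
  rw [h1, Pi.smul_apply, h2, weylFun, weylFun, h3, weylFun, smul_eq_mul, ← mul_assoc, ← mul_assoc,
    ← Complex.exp_add, ← Complex.exp_add]
  have e1 : (ξ + η) ∘ Sum.inl = ξ ∘ Sum.inl + η ∘ Sum.inl := rfl
  have e2 : (ξ + η) ∘ Sum.inr = ξ ∘ Sum.inr + η ∘ Sum.inr := rfl
  rw [e1, e2, add_assoc x]
  congr 2
  simp only [sympForm, dotProduct_add, add_dotProduct]
  push_cast
  ring

theorem weyl_zero (ψ : L2 ι) : weyl 0 ψ = ψ := by
  refine weyl_eq_of_ae (Filter.Eventually.of_forall fun x => ?_)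
  have e : (0 : Phase ι → ℝ) ∘ Sum.inr = 0 := rfl
  have e' : (0 : Phase ι → ℝ) ∘ Sum.inl = 0 := rfl
  simp [weylFun, e, e']

theorem sympForm_neg_left (ξ η : Phase ι → ℝ) : sympForm (-ξ) η = -sympForm ξ η := by
  have e1 : (-ξ) ∘ Sum.inl = -(ξ ∘ Sum.inl) := rfl
  have e2 : (-ξ) ∘ Sum.inr = -(ξ ∘ Sum.inr) := rfl
  simp only [sympForm, e1, e2, neg_dotProduct, dotProduct_neg]
  ring

theorem sympForm_self (ξ : Phase ι → ℝ) : sympForm ξ ξ = 0 := sub_self _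

theorem sympForm_smul_smul (s t : ℝ) (ξ η : Phase ι → ℝ) :
    sympForm (s • ξ) (t • η) = s * t * sympForm ξ η := by
  have e1 : ∀ (s : ℝ) (ξ : Phase ι → ℝ), (s • ξ) ∘ Sum.inl = s • (ξ ∘ Sum.inl) := fun _ _ => rfl
  have e2 : ∀ (s : ℝ) (ξ : Phase ι → ℝ), (s • ξ) ∘ Sum.inr = s • (ξ ∘ Sum.inr) := fun _ _ => rfl
  simp only [sympForm, e1, e2, smul_dotProduct, dotProduct_smul, smul_eq_mul]
  ring

theorem weyl_neg_weyl (ξ : Phase ι → ℝ) (ψ : L2 ι) : weyl (-ξ) (weyl ξ ψ) = ψ := by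
  rw [weyl_weyl, sympForm_neg_left, sympForm_self, neg_add_cancel, weyl_zero]
  simp

/-- Overlaps of displaced vectors are values of the characteristic function up to a phase; all
moments are obtained from this. -/
theorem inner_weyl_weyl' (ξ η : Phase ι → ℝ) (ψ φ : L2 ι) :
    inner ℂ (weyl ξ ψ) (weyl η φ) =
      Complex.exp (Complex.I * ((sympForm ξ η / 2 : ℝ) : ℂ)) * inner ℂ ψ (weyl (η - ξ) φ) := by
  rw [← inner_weyl_weyl (-ξ), weyl_neg_weyl, weyl_weyl, inner_smul_right, sympForm_neg_left, neg_neg,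
    neg_add_eq_sub]

/-- The characteristic function of `φ` is Gaussian with covariance matrix `M` and mean `d`. -/
def HasGaussianChar (φ : L2 ι) (M : Matrix (Phase ι) (Phase ι) ℝ) (d : Phase ι → ℝ) : Prop :=
  Mᵀ = M ∧ ∀ ξ : Phase ι → ℝ, inner ℂ φ (weyl ξ φ) =
    Complex.exp (Complex.I * ((ξ ⬝ᵥ d : ℝ) : ℂ) + ((-(ξ ⬝ᵥ M *ᵥ ξ) / 4 : ℝ) : ℂ))

/-! ### Moments and energy of Gaussian vectors. -/

open Filter Topology

/-- Expanding ‖D s − D t‖² gives the limit c − 2c + c = 0 in real parts, so D is Cauchy along the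
filter. This yields differentiability without knowing the derivative. -/
theorem exists_tendsto_of_tendsto_inner {H : Type*} [NormedAddCommGroup H] [InnerProductSpace ℂ H]
    [CompleteSpace H] {l : Filter ℝ} [l.NeBot] {D : ℝ → H} {c : ℂ}
    (h : Tendsto (fun p : ℝ × ℝ => inner ℂ (D p.1) (D p.2)) (l ×ˢ l) (𝓝 c)) :
    ∃ y, Tendsto D l (𝓝 y) := by
  have hd : Tendsto (fun s => inner ℂ (D s) (D s)) l (𝓝 c) :=
    h.comp (tendsto_id.prodMk tendsto_id)
  have hre : ∀ {α : Type} {f : Filter α} {g : α → ℂ}, Tendsto g f (𝓝 c) →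
      Tendsto (fun a => (g a).re) f (𝓝 c.re) := fun hg =>
    (Complex.continuous_re.tendsto _).comp hg
  have hsq : Tendsto (fun p : ℝ × ℝ => ‖D p.1 - D p.2‖ ^ 2) (l ×ˢ l) (𝓝 0) := by
    have h3 := ((hre (hd.comp tendsto_fst)).sub ((hre h).const_mul 2)).add
      (hre (hd.comp (tendsto_snd (f := l) (g := l))))
    rw [show c.re - 2 * c.re + c.re = 0 by ring] at h3
    refine h3.congr fun p => ?_
    rw [@norm_sub_sq ℂ]
    simp only [Function.comp_apply, inner_self_eq_norm_sq_to_K]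
    norm_cast
  have hC : Cauchy (map D l) := by
    rw [cauchy_map_iff']
    rw [tendsto_uniformity_iff_dist_tendsto_zero]
    have := hsq.sqrt
    simp only [Real.sqrt_sq (norm_nonneg _), Real.sqrt_zero] at this
    simpa only [dist_eq_norm] using this
  exact CompleteSpace.complete hC

theorem tendsto_exp_sub_one_div {b c : ℂ} :
    Tendsto (fun t : ℝ => (t : ℂ)⁻¹ * (Complex.exp (c * t + b * t ^ 2) - 1)) (𝓝[≠] 0) (𝓝 c) := by
  have h : HasDerivAt (fun t : ℝ => Complex.exp (c * t + b * t ^ 2)) c 0 := by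
    have h1 : HasDerivAt (fun z : ℂ => Complex.exp (c * z + b * z ^ 2)) c ((0 : ℝ) : ℂ) := by
      have h2 : HasDerivAt (fun z : ℂ => c * z + b * z ^ 2) c ((0 : ℝ) : ℂ) := by
        have := ((hasDerivAt_id ((0 : ℝ) : ℂ)).const_mul c).fun_add
          (((hasDerivAt_id ((0 : ℝ) : ℂ)).pow 2).const_mul b)
        simpa using this
      simpa using h2.cexp
    exact h1.comp_ofReal
  have := hasDerivAt_iff_tendsto_slope.1 h
  refine this.congr fun t => ?_
  simp [slope_def_module]

variable {φ : L2 ι} {M : Matrix (Phase ι) (Phase ι) ℝ} {d : Phase ι → ℝ}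

/-- The difference quotient of the orbit of `φ` under `exp(i t R_k)`. -/
noncomputable def orbitSlope (k : Phase ι) (φ : L2 ι) (t : ℝ) : L2 ι :=
  (t : ℂ)⁻¹ • (orbit k φ t - φ)

theorem slope_orbit (k : Phase ι) (φ : L2 ι) (t : ℝ) :
    slope (orbit k φ) 0 t = orbitSlope k φ t := by
  rw [slope_def_module, orbitSlope, sub_zero]
  have : orbit k φ 0 = φ := by rw [orbit, zero_smul, weyl_zero]
  rw [this, ← Complex.ofReal_inv, Complex.coe_smul]
  rfl

theorem HasGaussianChar.inner_self (h : HasGaussianChar φ M d) : inner ℂ φ φ = (1 : ℂ) := by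
  have := h.2 0
  rw [weyl_zero] at this
  simpa using this

theorem HasGaussianChar.inner_orbit (h : HasGaussianChar φ M d) (k : Phase ι) (t : ℝ) :
    inner ℂ φ (orbit k φ t) =
      Complex.exp (Complex.I * d k * t + (-(M k k : ℂ) / 4) * t ^ 2) := by
  rw [orbit, h.2]
  congr 1
  simp only [mulVec_smul, smul_dotProduct, dotProduct_smul, single_one_dotProduct,
    mulVec_single_one, smul_eq_mul, col_apply]
  push_cast
  ring

/-- The overlap factors into a function of s, a function of t and a function of the product st,
which is the form needed for the double difference quotient. -/
theorem HasGaussianChar.inner_orbit_orbit (h : HasGaussianChar φ M d) (k l : Phase ι) (s t : ℝ) :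
    inner ℂ (orbit k φ s) (orbit l φ t) =
      Complex.exp (-Complex.I * d k * s + (-(M k k : ℂ) / 4) * s ^ 2) *
      Complex.exp (Complex.I * d l * t + (-(M l l : ℂ) / 4) * t ^ 2) *
      Complex.exp ((M k l / 2 + Complex.I * sympForm (Pi.single k 1) (Pi.single l 1) / 2) *
        ((s * t : ℝ) : ℂ) + 0 * ((s * t : ℝ) : ℂ) ^ 2) := by
  have hkl : M l k = M k l := congrFun (congrFun h.1 k) l
  rw [orbit, orbit, inner_weyl_weyl', h.2, ← Complex.exp_add, ← Complex.exp_add, ← Complex.exp_add,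
    sympForm_smul_smul]
  congr 1
  simp only [mulVec_smul, smul_dotProduct, dotProduct_smul, single_one_dotProduct, mulVec_sub,
    sub_dotProduct, dotProduct_sub, mulVec_single_one, smul_eq_mul, col_apply, hkl]
  push_cast
  ring

theorem HasGaussianChar.tendsto_inner_slope (h : HasGaussianChar φ M d) (k l : Phase ι) :
    Tendsto (fun p : ℝ × ℝ => inner ℂ (orbitSlope k φ p.1) (orbitSlope l φ p.2))
      (𝓝[≠] 0 ×ˢ 𝓝[≠] 0) (𝓝 ((d k * d l : ℝ) +
        (M k l / 2 + Complex.I * sympForm (Pi.single k 1) (Pi.single l 1) / 2))) := by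
  set c : ℂ := M k l / 2 + Complex.I * sympForm (Pi.single k 1) (Pi.single l 1) / 2
  let α : ℝ → ℂ := fun s => Complex.exp (-Complex.I * d k * s + (-(M k k : ℂ) / 4) * s ^ 2)
  let β : ℝ → ℂ := fun t => Complex.exp (Complex.I * d l * t + (-(M l l : ℂ) / 4) * t ^ 2)
  have hα : Tendsto α (𝓝[≠] 0) (𝓝 1) := by
    have : Continuous α := by fun_prop
    have h := (this.tendsto 0).mono_left (nhdsWithin_le_nhds (s := {0}ᶜ))
    simpa [α] using h
  have hβ : Tendsto β (𝓝[≠] 0) (𝓝 1) := by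
    have : Continuous β := by fun_prop
    have h := (this.tendsto 0).mono_left (nhdsWithin_le_nhds (s := {0}ᶜ))
    simpa [β] using h
  have hmul : Tendsto (fun p : ℝ × ℝ => p.1 * p.2) (𝓝[≠] 0 ×ˢ 𝓝[≠] 0) (𝓝[≠] 0) := by
    refine tendsto_nhdsWithin_iff.2 ⟨?_, ?_⟩
    · have h1 : Tendsto (fun p : ℝ × ℝ => p.1) (𝓝[≠] 0 ×ˢ 𝓝[≠] 0) (𝓝 0) :=
        tendsto_fst.mono_right nhdsWithin_le_nhds
      have h2 : Tendsto (fun p : ℝ × ℝ => p.2) (𝓝[≠] 0 ×ˢ 𝓝[≠] 0) (𝓝 0) :=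
        tendsto_snd.mono_right nhdsWithin_le_nhds
      simpa using h1.mul h2
    · filter_upwards [tendsto_fst.eventually (eventually_mem_nhdsWithin),
        tendsto_snd.eventually (eventually_mem_nhdsWithin)] with p h1 h2
      exact mul_ne_zero h1 h2
  have h1 := (tendsto_exp_sub_one_div (b := -(M k k : ℂ) / 4) (c := -Complex.I * d k)).comp
    (tendsto_fst (f := 𝓝[≠] (0 : ℝ)) (g := 𝓝[≠] (0 : ℝ)))
  have h2 := (tendsto_exp_sub_one_div (b := -(M l l : ℂ) / 4) (c := Complex.I * d l)).comp
    (tendsto_snd (f := 𝓝[≠] (0 : ℝ)) (g := 𝓝[≠] (0 : ℝ)))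
  have h3 := (tendsto_exp_sub_one_div (b := 0) (c := c)).comp hmul
  -- This rests on αβγ − α − β + 1 = (α − 1)(β − 1) + αβ(γ − 1), divided by st: the first term gives
  -- the product of the means and the second the covariance.
  have h4 := (h1.mul h2).add (((hα.comp (tendsto_fst (g := 𝓝[≠] (0 : ℝ)))).mul
    (hβ.comp (tendsto_snd (f := 𝓝[≠] (0 : ℝ))))).mul h3)
  have hc : -Complex.I * d k * (Complex.I * d l) + 1 * 1 * c = (d k * d l : ℝ) + c := by
    push_cast
    linear_combination -(d k : ℂ) * d l * Complex.I_sq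
  rw [hc] at h4
  refine h4.congr fun p => ?_
  obtain ⟨s, t⟩ := p
  have hconj : inner ℂ (orbit k φ s) φ =
      Complex.exp (-Complex.I * d k * s + (-(M k k : ℂ) / 4) * s ^ 2) := by
    rw [← inner_conj_symm, h.inner_orbit, ← Complex.exp_conj]
    simp [map_ofNat (starRingEnd ℂ) 4]
  simp only [orbitSlope, inner_smul_left, inner_smul_right, inner_sub_left, inner_sub_right,
    h.inner_orbit, h.inner_self, h.inner_orbit_orbit, hconj, Function.comp_apply, α, β, c]
  simp only [map_inv₀, Complex.conj_ofReal]
  push_cast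
  rw [mul_inv]
  ring

theorem HasGaussianChar.exists_hasDerivAt (h : HasGaussianChar φ M d) (k : Phase ι) :
    ∃ y, HasDerivAt (orbit k φ) y 0 := by
  obtain ⟨y, hy⟩ := exists_tendsto_of_tendsto_inner (h.tendsto_inner_slope k k)
  exact ⟨y, hasDerivAt_iff_tendsto_slope.2 (hy.congr fun t => (slope_orbit k φ t).symm)⟩

theorem HasGaussianChar.inDomain (h : HasGaussianChar φ M d) (k : Phase ι) : InDomain k φ :=
  (h.exists_hasDerivAt k).choose_spec.differentiableAt

theorem HasGaussianChar.tendsto_slope (h : HasGaussianChar φ M d) (k : Phase ι) :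
    Tendsto (orbitSlope k φ) (𝓝[≠] 0) (𝓝 (deriv (orbit k φ) 0)) :=
  (hasDerivAt_iff_tendsto_slope.1 (h.inDomain k).hasDerivAt).congr fun t => slope_orbit k φ t

theorem HasGaussianChar.inner_quad_quad (h : HasGaussianChar φ M d) (k l : Phase ι) :
    inner ℂ (quad k φ) (quad l φ) = (d k * d l : ℝ) +
      (M k l / 2 + Complex.I * sympForm (Pi.single k 1) (Pi.single l 1) / 2 : ℂ) := by
  have h2 : Tendsto (fun p : ℝ × ℝ => inner ℂ (orbitSlope k φ p.1) (orbitSlope l φ p.2))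
      (𝓝[≠] 0 ×ˢ 𝓝[≠] 0) (𝓝 (inner ℂ (deriv (orbit k φ) 0) (deriv (orbit l φ) 0))) :=
    Filter.Tendsto.inner ((h.tendsto_slope k).comp tendsto_fst)
      ((h.tendsto_slope l).comp tendsto_snd)
  rw [← tendsto_nhds_unique h2 (h.tendsto_inner_slope k l), quad, quad, inner_smul_left,
    inner_smul_right]
  simp [← mul_assoc]

theorem HasGaussianChar.inner_quad (h : HasGaussianChar φ M d) (k : Phase ι) :
    inner ℂ φ (quad k φ) = (d k : ℂ) := by
  have h2 : Tendsto (fun t => inner ℂ φ (orbitSlope k φ t)) (𝓝[≠] 0)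
      (𝓝 (inner ℂ φ (deriv (orbit k φ) 0))) := tendsto_const_nhds.inner (h.tendsto_slope k)
  have h3 : Tendsto (fun t => inner ℂ φ (orbitSlope k φ t)) (𝓝[≠] 0) (𝓝 (Complex.I * d k)) := by
    refine tendsto_exp_sub_one_div.congr (f₁ := fun t : ℝ => (t : ℂ)⁻¹ *
      (Complex.exp (Complex.I * d k * t + (-(M k k : ℂ) / 4) * t ^ 2) - 1)) fun t => ?_
    rw [orbitSlope, inner_smul_right, inner_sub_right, h.inner_orbit, h.inner_self]
  rw [quad, inner_smul_right, tendsto_nhds_unique h2 h3]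
  linear_combination -(d k : ℂ) * Complex.I_sq

theorem HasGaussianChar.covMatrix_eq (h : HasGaussianChar φ M d) : covMatrix φ = M := by
  ext k l
  simp only [covMatrix, of_apply, h.inner_quad_quad, h.inner_quad]
  simp
  ring

theorem HasGaussianChar.secondMoment_eq (h : HasGaussianChar φ M d) (k : Phase ι) :
    secondMoment k φ = ENNReal.ofReal (M k k / 2 + d k ^ 2) := by
  rw [secondMoment, if_pos (h.inDomain k)]
  congr 1
  have := h.inner_quad_quad k k
  rw [inner_self_eq_norm_sq_to_K, sympForm_self] at this
  have h2 := congrArg Complex.re this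
  simp at h2
  norm_cast at h2
  rw [h2]
  ring

theorem HasGaussianChar.energy_eq (h : HasGaussianChar φ M d) :
    energy φ = ENNReal.ofReal (M.trace / 4 + (d ⬝ᵥ d) / 2) := by
  -- Each term is a squared norm; nonnegativity is what lets `ENNReal.ofReal` commute with the sum.
  have hpos : ∀ k, 0 ≤ M k k / 2 + d k ^ 2 := fun k => by
    have := h.inner_quad_quad k k
    rw [inner_self_eq_norm_sq_to_K, sympForm_self] at this
    have h2 := congrArg Complex.re this
    simp at h2
    norm_cast at h2
    rw [← sq] at h2
    rw [add_comm, ← h2]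
    positivity
  rw [energy]
  simp only [h.secondMoment_eq]
  rw [← ENNReal.ofReal_sum_of_nonneg fun k _ => hpos k,
    show (2 : ℝ≥0∞) = ENNReal.ofReal 2 by simp, ← ENNReal.ofReal_div_of_pos two_pos]
  congr 1
  rw [Finset.sum_add_distrib, trace, dotProduct, ← Finset.sum_div]
  simp only [diag_apply, sq]
  ring

end

/-! ### Unitaries implementing triangular symplectic matrices. -/

theorem norm_sq_eq_integral (f : L2 ι) : ‖f‖ ^ 2 = ∫ x, ‖f x‖ ^ 2 := by
  have h : ((‖f‖ ^ 2 : ℝ) : ℂ) = ((∫ x, ‖f x‖ ^ 2 : ℝ) : ℂ) := by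
    rw [Complex.ofReal_pow, ← integral_complex_ofReal]
    have := inner_self_eq_norm_sq_to_K (𝕜 := ℂ) f
    rw [L2.inner_def] at this
    refine this.symm.trans (integral_congr_ae (Filter.Eventually.of_forall fun x => ?_))
    simp only [inner_self_eq_norm_sq_to_K]
    norm_cast
  exact_mod_cast h

/-- `x ↦ |det L|^{1/2} e^{i x·Cx/2} ψ(L x)`. -/
noncomputable def triFun (L C : Matrix ι ι ℝ) (ψ : (ι → ℝ) → ℂ) (x : ι → ℝ) : ℂ :=
  ((√|L.det| : ℝ) : ℂ) * Complex.exp (Complex.I * ((x ⬝ᵥ C *ᵥ x / 2 : ℝ) : ℂ)) * ψ (L *ᵥ x)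

theorem norm_triFun (L C : Matrix ι ι ℝ) (ψ : (ι → ℝ) → ℂ) (x : ι → ℝ) :
    ‖triFun L C ψ x‖ = √|L.det| * ‖ψ (L *ᵥ x)‖ := by
  rw [triFun, norm_mul, norm_mul, norm_exp_I_mul_ofReal, mul_one, Complex.norm_real,
    Real.norm_of_nonneg (Real.sqrt_nonneg _)]

theorem continuous_quadratic (C : Matrix ι ι ℝ) : Continuous fun x : ι → ℝ => x ⬝ᵥ C *ᵥ x := by
  exact Continuous.dotProduct continuous_id (Continuous.matrix_mulVec continuous_const continuous_id)

theorem memLp_triFun {L : Matrix ι ι ℝ} (hL : IsUnit L.det) (C : Matrix ι ι ℝ) (ψ : L2 ι) :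
    MemLp (triFun L C ψ) 2 (volume : Measure (ι → ℝ)) := by
  have h : MemLp (fun x : ι → ℝ => (ψ : (ι → ℝ) → ℂ) (L *ᵥ x)) 2 volume := by
    have h1 : MemLp (ψ : (ι → ℝ) → ℂ) 2 (Measure.map (mulVecEquiv L hL) volume) := by
      rw [map_mulVecEquiv]
      exact (Lp.memLp ψ).smul_measure ENNReal.ofReal_ne_top
    exact (memLp_map_measure_iff h1.1 (mulVecEquiv L hL).measurable.aemeasurable).1 h1
  have hc : Continuous fun x : ι → ℝ =>
      Complex.exp (Complex.I * ((x ⬝ᵥ C *ᵥ x / 2 : ℝ) : ℂ)) := by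
    have := continuous_quadratic C
    fun_prop
  refine MemLp.of_le (h.const_mul ((√|L.det| : ℝ) : ℂ)) ?_ (Filter.Eventually.of_forall fun x => ?_)
  · exact ((continuous_const.mul hc).aestronglyMeasurable).mul h.1
  · rw [norm_triFun, norm_mul, Complex.norm_real, Real.norm_of_nonneg (Real.sqrt_nonneg _)]

noncomputable def triOp {L : Matrix ι ι ℝ} (hL : IsUnit L.det) (C : Matrix ι ι ℝ) (ψ : L2 ι) :
    L2 ι := (memLp_triFun hL C ψ).toLp _

theorem coeFn_triOp {L : Matrix ι ι ℝ} (hL : IsUnit L.det) (C : Matrix ι ι ℝ) (ψ : L2 ι) :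
    triOp hL C ψ =ᵐ[volume] triFun L C ψ := MemLp.coeFn_toLp _

theorem triOp_eq_of_ae {L : Matrix ι ι ℝ} (hL : IsUnit L.det) (C : Matrix ι ι ℝ) {ψ φ : L2 ι}
    (h : φ =ᵐ[volume] triFun L C ψ) : triOp hL C ψ = φ :=
  Lp.ext ((coeFn_triOp hL C ψ).trans h.symm)

theorem ae_comp_mulVec {L : Matrix ι ι ℝ} (hL : IsUnit L.det) {p : (ι → ℝ) → Prop}
    (h : ∀ᵐ x, p x) : ∀ᵐ x : ι → ℝ, p (L *ᵥ x) :=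
  (quasiMeasurePreserving_mulVec L hL).ae h

theorem norm_triOp {L : Matrix ι ι ℝ} (hL : IsUnit L.det) (C : Matrix ι ι ℝ) (ψ : L2 ι) :
    ‖triOp hL C ψ‖ = ‖ψ‖ := by
  have h : ‖triOp hL C ψ‖ ^ 2 = ‖ψ‖ ^ 2 := by
    rw [norm_sq_eq_integral, norm_sq_eq_integral]
    have e : ∫ x, ‖triOp hL C ψ x‖ ^ 2 = ∫ x, |L.det| * ‖ψ (L *ᵥ x)‖ ^ 2 := by
      refine integral_congr_ae ?_
      filter_upwards [coeFn_triOp hL C ψ] with x hx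
      rw [hx, norm_triFun, mul_pow, Real.sq_sqrt (abs_nonneg _)]
    rw [e, integral_const_mul, integral_comp_mulVec L hL (fun y => ‖ψ y‖ ^ 2), smul_eq_mul,
      mul_inv_cancel_left₀ (abs_ne_zero.2 hL.ne_zero)]
  exact (pow_left_inj₀ (norm_nonneg _) (norm_nonneg _) two_ne_zero).1 h

/-- The isometry `ψ ↦ |det L|^{1/2} e^{i x·Cx/2} ψ(L x)`. -/
noncomputable def triIsometry {L : Matrix ι ι ℝ} (hL : IsUnit L.det) (C : Matrix ι ι ℝ) :
    L2 ι →ₗᵢ[ℂ] L2 ι where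
  toFun := triOp hL C
  map_add' ψ φ := by
    refine triOp_eq_of_ae hL C ?_
    filter_upwards [Lp.coeFn_add (triOp hL C ψ) (triOp hL C φ), coeFn_triOp hL C ψ,
      coeFn_triOp hL C φ, ae_comp_mulVec hL (Lp.coeFn_add ψ φ)] with x h1 h2 h3 h4
    rw [h1, Pi.add_apply, h2, h3, triFun, triFun, triFun, h4, Pi.add_apply, mul_add]
  map_smul' c ψ := by
    refine triOp_eq_of_ae hL C ?_
    filter_upwards [Lp.coeFn_smul c (triOp hL C ψ), coeFn_triOp hL C ψ,
      ae_comp_mulVec hL (Lp.coeFn_smul c ψ)] with x h1 h2 h4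
    rw [RingHom.id_apply, h1, Pi.smul_apply, h2, triFun, triFun, h4, Pi.smul_apply, smul_eq_mul,
      smul_eq_mul]
    ring
  norm_map' := norm_triOp hL C

/-- The inverse has the same form, with L⁻¹ and the opposite phase pulled back along L⁻¹; this gives
surjectivity. -/
theorem triOp_triOp_inv {L : Matrix ι ι ℝ} (hL : IsUnit L.det) (C : Matrix ι ι ℝ) (ψ : L2 ι) :
    triOp hL C (triOp (isUnit_nonsing_inv_det L hL) (-(L⁻¹ᵀ * C * L⁻¹)) ψ) = ψ := by
  refine triOp_eq_of_ae hL C ?_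
  filter_upwards [ae_comp_mulVec hL (coeFn_triOp (isUnit_nonsing_inv_det L hL)
    (-(L⁻¹ᵀ * C * L⁻¹)) ψ)] with x hx
  have e1 : L⁻¹ *ᵥ L *ᵥ x = x := by rw [mulVec_mulVec, nonsing_inv_mul _ hL, one_mulVec]
  have e2 : (L *ᵥ x) ⬝ᵥ -(L⁻¹ᵀ * C * L⁻¹) *ᵥ L *ᵥ x = -(x ⬝ᵥ C *ᵥ x) := by
    rw [neg_mulVec, dotProduct_neg, ← mulVec_mulVec, e1, ← mulVec_mulVec, dotProduct_mulVec,
      vecMul_transpose, e1]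
  have e3 : √|L.det| * √|L⁻¹.det| = 1 := by
    rw [← Real.sqrt_mul (abs_nonneg _), ← abs_mul, ← det_mul, mul_nonsing_inv _ hL]
    simp
  rw [triFun, hx, triFun, e1, e2]
  calc ψ x = ((√|L.det| * √|L⁻¹.det| : ℝ) : ℂ) *
        Complex.exp (Complex.I * ((x ⬝ᵥ C *ᵥ x / 2 : ℝ) : ℂ) +
          Complex.I * ((-(x ⬝ᵥ C *ᵥ x) / 2 : ℝ) : ℂ)) * ψ x := by
        rw [e3, ← mul_add, ← Complex.ofReal_add]
        simp [neg_div]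
    _ = _ := by
        rw [Complex.exp_add]
        push_cast
        ring

/-- The unitary `ψ ↦ |det L|^{1/2} e^{i x·Cx/2} ψ(L x)`. -/
noncomputable def triUnitary {L : Matrix ι ι ℝ} (hL : IsUnit L.det) (C : Matrix ι ι ℝ) :
    L2 ι ≃ₗᵢ[ℂ] L2 ι :=
  LinearIsometryEquiv.ofSurjective (triIsometry hL C) fun ψ => ⟨_, triOp_triOp_inv hL C ψ⟩

theorem triUnitary_apply {L : Matrix ι ι ℝ} (hL : IsUnit L.det) (C : Matrix ι ι ℝ) (ψ : L2 ι) :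
    triUnitary hL C ψ = triOp hL C ψ := rfl

theorem triMat_transpose_mulVec {L C : Matrix ι ι ℝ} (hC : Cᵀ = C) (ξ : Phase ι → ℝ) :
    (triMat L C)ᵀ *ᵥ ξ = Sum.elim (L⁻¹ᵀ *ᵥ (ξ ∘ Sum.inl + C *ᵥ (ξ ∘ Sum.inr)))
      (L *ᵥ (ξ ∘ Sum.inr)) := by
  rw [triMat, fromBlocks_transpose, fromBlocks_mulVec, transpose_mul, hC, transpose_transpose,
    transpose_zero, zero_mulVec, zero_add, mulVec_add, mulVec_mulVec]

/-- A translation by v changes the quadratic phase by x · Cv + v · Cv/2, C being symmetric. This is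
affine in x and is absorbed by the phase of the Weyl operator. -/
theorem weyl_triUnitary {L C : Matrix ι ι ℝ} (hL : IsUnit L.det) (hC : Cᵀ = C) (ξ : Phase ι → ℝ)
    (ψ : L2 ι) : weyl ξ (triUnitary hL C ψ) = triUnitary hL C (weyl ((triMat L C)ᵀ *ᵥ ξ) ψ) := by
  rw [triUnitary_apply, triUnitary_apply]
  refine weyl_eq_of_ae ?_
  filter_upwards [coeFn_triOp hL C (weyl ((triMat L C)ᵀ *ᵥ ξ) ψ),
    ae_comp_mulVec hL (coeFn_weyl ((triMat L C)ᵀ *ᵥ ξ) ψ),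
    ae_comp_add_right (coeFn_triOp hL C ψ) (ξ ∘ Sum.inr)] with x h1 h2 h3
  rw [h1, triFun, h2, weylFun, weylFun, h3, triFun, triMat_transpose_mulVec hC, Sum.elim_comp_inl,
    Sum.elim_comp_inr]
  set u := ξ ∘ Sum.inl
  set v := ξ ∘ Sum.inr
  have e1 : ∀ y, (L⁻¹ᵀ *ᵥ (u + C *ᵥ v)) ⬝ᵥ (L *ᵥ y) = u ⬝ᵥ y + (C *ᵥ v) ⬝ᵥ y := fun y => by
    rw [mulVec_transpose, ← dotProduct_mulVec, mulVec_mulVec, nonsing_inv_mul _ hL, one_mulVec,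
      add_dotProduct]
  have e2 : ∀ y z, (C *ᵥ y) ⬝ᵥ z = z ⬝ᵥ C *ᵥ y := fun y z => dotProduct_comm _ _
  have e3 : v ⬝ᵥ C *ᵥ x = x ⬝ᵥ C *ᵥ v := by
    rw [dotProduct_mulVec, ← mulVec_transpose, hC, dotProduct_comm]
  have key : Complex.exp (Complex.I * ((x ⬝ᵥ C *ᵥ x / 2 : ℝ) : ℂ)) *
      Complex.exp (Complex.I * (((L⁻¹ᵀ *ᵥ (u + C *ᵥ v)) ⬝ᵥ (L *ᵥ x) +
        (L⁻¹ᵀ *ᵥ (u + C *ᵥ v)) ⬝ᵥ (L *ᵥ v) / 2 : ℝ) : ℂ)) =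
      Complex.exp (Complex.I * ((u ⬝ᵥ x + u ⬝ᵥ v / 2 : ℝ) : ℂ)) *
        Complex.exp (Complex.I * (((x + v) ⬝ᵥ C *ᵥ (x + v) / 2 : ℝ) : ℂ)) := by
    rw [← Complex.exp_add, ← Complex.exp_add, e1, e1]
    congr 1
    simp only [mulVec_add, dotProduct_add, add_dotProduct, e2, e3]
    push_cast
    ring
  rw [← mulVec_add]
  linear_combination ((√|L.det| : ℝ) : ℂ) * ψ (L *ᵥ (x + v)) * key

theorem isGaussianUnitary_triUnitary {L C : Matrix ι ι ℝ} (hL : IsUnit L.det) (hC : Cᵀ = C) :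
    IsGaussianUnitary (triUnitary hL C) :=
  ⟨triMat L C, triMat_mem_symplecticGroup hL hC, 0, fun ξ ψ => by
    rw [weyl_triUnitary hL hC]; simp⟩

theorem HasGaussianChar.map {φ : L2 ι} {M : Matrix (Phase ι) (Phase ι) ℝ}
    (h : HasGaussianChar φ M 0) {U : L2 ι ≃ₗᵢ[ℂ] L2 ι} {S : Matrix (Phase ι) (Phase ι) ℝ}
    {d : Phase ι → ℝ} (hU : ∀ (ξ : Phase ι → ℝ) (ψ : L2 ι),
      weyl ξ (U ψ) = Complex.exp (Complex.I * ((ξ ⬝ᵥ d : ℝ) : ℂ)) • U (weyl (Sᵀ *ᵥ ξ) ψ)) :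
    HasGaussianChar (U φ) (S * M * Sᵀ) d := by
  refine ⟨by rw [transpose_mul, transpose_mul, transpose_transpose, h.1, Matrix.mul_assoc],
    fun ξ => ?_⟩
  rw [hU, inner_smul_right, U.inner_map_map, h.2, ← Complex.exp_add]
  congr 1
  have : (Sᵀ *ᵥ ξ) ⬝ᵥ M *ᵥ Sᵀ *ᵥ ξ = ξ ⬝ᵥ (S * M * Sᵀ) *ᵥ ξ := by
    rw [mulVec_transpose, ← dotProduct_mulVec, ← mulVec_transpose, mulVec_mulVec, mulVec_mulVec,
      Matrix.mul_assoc]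
  rw [this]
  simp

theorem HasGaussianChar.map_triUnitary {φ : L2 ι} {M : Matrix (Phase ι) (Phase ι) ℝ}
    (h : HasGaussianChar φ M 0) {L C : Matrix ι ι ℝ} (hL : IsUnit L.det) (hC : Cᵀ = C) :
    HasGaussianChar (triUnitary hL C φ) (triMat L C * M * (triMat L C)ᵀ) 0 :=
  h.map fun ξ ψ => by rw [weyl_triUnitary hL hC]; simp

theorem isPureGaussian_iff {ψ : L2 ι} : IsPureGaussian ψ ↔ ∃ V, HasGaussianChar ψ V 0 := by
  constructor
  · rintro ⟨-, V, hV, h⟩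
    exact ⟨V, hV, fun ξ => by rw [h]; simp⟩
  · rintro ⟨V, h⟩
    refine ⟨?_, V, h.1, fun ξ => by rw [h.2]; simp⟩
    have h2 : ‖ψ‖ ^ 2 = 1 := by
      rw [← inner_self_eq_norm_sq (𝕜 := ℂ), h.inner_self]; simp
    exact (pow_eq_one_iff_of_nonneg (norm_nonneg _) two_ne_zero).1 h2

theorem inner_weyl_eq_integral (ψ : L2 ι) (ξ : Phase ι → ℝ) :
    inner ℂ ψ (weyl ξ ψ) = ∫ x, Complex.exp (Complex.I *
      (((ξ ∘ Sum.inl) ⬝ᵥ x + (ξ ∘ Sum.inl) ⬝ᵥ (ξ ∘ Sum.inr) / 2 : ℝ) : ℂ)) *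
        (ψ (x + ξ ∘ Sum.inr) * (starRingEnd ℂ) (ψ x)) := by
  rw [L2.inner_def]
  refine integral_congr_ae ?_
  filter_upwards [coeFn_weyl ξ ψ] with x hx
  rw [hx, RCLike.inner_apply, weylFun]
  ring

theorem integrable_shift_mul_conj (ψ : L2 ι) (v : ι → ℝ) :
    Integrable fun x => ψ (x + v) * (starRingEnd ℂ) (ψ x) := by
  have := L2.integrable_inner (𝕜 := ℂ) ψ (weyl (Sum.elim 0 v) ψ)
  refine this.congr ?_
  filter_upwards [coeFn_weyl (Sum.elim 0 v) ψ] with x hx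
  rw [hx, RCLike.inner_apply, weylFun]
  simp

/-! ### The vacuum and positivity of the position block. -/

/-- The wave function `π^{-n/4} e^{-x·x/2}` of the vacuum. -/
noncomputable def vacFun (ι : Type) [Fintype ι] (x : ι → ℝ) : ℂ :=
  ((√((√Real.pi ^ Fintype.card ι)⁻¹) * Real.exp (-(x ⬝ᵥ x) / 2) : ℝ) : ℂ)

theorem continuous_vacFun : Continuous (vacFun ι) := by
  have : Continuous fun x : ι → ℝ => x ⬝ᵥ x := Continuous.dotProduct continuous_id continuous_id
  unfold vacFun
  fun_prop

theorem memLp_vacFun : MemLp (vacFun ι) 2 (volume : Measure (ι → ℝ)) := by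
  rw [memLp_two_iff_integrable_sq_norm continuous_vacFun.aestronglyMeasurable]
  refine ((integrable_exp_neg_mul_dotProduct_self one_pos).const_mul
    ((√Real.pi ^ Fintype.card ι)⁻¹)).congr (Filter.Eventually.of_forall fun x => ?_)
  simp only [vacFun]
  rw [Complex.norm_real, Real.norm_of_nonneg (by positivity), mul_pow, Real.sq_sqrt (by positivity),
    ← Real.exp_nat_mul]
  congr 2
  push_cast
  ring

/-- The vacuum vector. -/
noncomputable def vac (ι : Type) [Fintype ι] [DecidableEq ι] : L2 ι := memLp_vacFun.toLp (vacFun ι)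

theorem coeFn_vac : vac ι =ᵐ[volume] vacFun ι := MemLp.coeFn_toLp _

/-- This is the parallelogram identity: |x|² + |y|² is twice the squared norm of the midpoint plus
half that of the difference. -/
theorem vacFun_mul_vacFun (x y : ι → ℝ) : vacFun ι x * vacFun ι y =
    Complex.exp ((-((y - x) ⬝ᵥ (y - x)) / 4 : ℝ) : ℂ) *
      gaussKer 1 0 (x + (1 / 2 : ℝ) • (y - x)) := by
  have e : (∑ j, (((((1 : Matrix ι ι ℝ) *ᵥ (x + (1 / 2 : ℝ) • (y - x))) j : ℝ) : ℂ) +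
      Complex.I * ((0 : ι → ℝ) j : ℂ)) ^ 2) =
      (((x + (1 / 2 : ℝ) • (y - x)) ⬝ᵥ (x + (1 / 2 : ℝ) • (y - x)) : ℝ) : ℂ) := by
    simp only [one_mulVec, Pi.zero_apply, Complex.ofReal_zero, mul_zero, add_zero, dotProduct]
    push_cast
    simp only [sq]
  rw [vacFun, vacFun, gaussKer, e, ← Complex.ofReal_neg, ← Complex.ofReal_exp, ← Complex.ofReal_exp,
    ← Complex.ofReal_mul, ← Complex.ofReal_mul, ← Complex.ofReal_mul]
  congr 1
  have h1 : √((√Real.pi ^ Fintype.card ι)⁻¹) * √((√Real.pi ^ Fintype.card ι)⁻¹) =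
      (√Real.pi ^ Fintype.card ι)⁻¹ := Real.mul_self_sqrt (by positivity)
  have h2 : Real.exp (-(x ⬝ᵥ x) / 2) * Real.exp (-(y ⬝ᵥ y) / 2) =
      Real.exp (-((y - x) ⬝ᵥ (y - x)) / 4) *
        Real.exp (-((x + (1 / 2 : ℝ) • (y - x)) ⬝ᵥ (x + (1 / 2 : ℝ) • (y - x)))) := by
    rw [← Real.exp_add, ← Real.exp_add]
    congr 1
    simp only [dotProduct_add, add_dotProduct, dotProduct_sub, sub_dotProduct, dotProduct_smul,
      smul_dotProduct, smul_eq_mul, dotProduct_comm y x]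
    ring
  rw [det_one, abs_one, one_mul]
  linear_combination Real.exp (-(x ⬝ᵥ x) / 2) * Real.exp (-(y ⬝ᵥ y) / 2) * h1 +
    (√Real.pi ^ Fintype.card ι)⁻¹ * h2

theorem conj_vacFun (x : ι → ℝ) : (starRingEnd ℂ) (vacFun ι x) = vacFun ι x :=
  Complex.conj_ofReal _

theorem hasGaussianChar_vac : HasGaussianChar (vac ι) 1 0 := by
  refine ⟨transpose_one, fun ξ => ?_⟩
  rw [inner_weyl_eq_integral]
  set u := ξ ∘ Sum.inl with hu
  set v := ξ ∘ Sum.inr with hv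
  let F : (ι → ℝ) → ℂ := fun z => Complex.exp ((-(v ⬝ᵥ v) / 4 : ℝ) : ℂ) *
    (Complex.exp (Complex.I * ((((1 : Matrix ι ι ℝ)ᵀ *ᵥ u) ⬝ᵥ z : ℝ) : ℂ)) * gaussKer 1 0 z)
  have e : ∫ x, Complex.exp (Complex.I * ((u ⬝ᵥ x + u ⬝ᵥ v / 2 : ℝ) : ℂ)) *
      (vac ι (x + v) * (starRingEnd ℂ) (vac ι x)) = ∫ x, F (x + (1 / 2 : ℝ) • v) := by
    refine integral_congr_ae ?_
    filter_upwards [coeFn_vac (ι := ι), ae_comp_add_right (coeFn_vac (ι := ι)) v] with x h1 h2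
    rw [h1, h2, conj_vacFun, mul_comm (vacFun ι (x + v)), vacFun_mul_vacFun, add_sub_cancel_left]
    simp only [F, transpose_one, one_mulVec, dotProduct_add, dotProduct_smul, smul_eq_mul]
    rw [show u ⬝ᵥ v / 2 = 1 / 2 * (u ⬝ᵥ v) by ring]
    ring
  rw [e, integral_add_right_eq_self F, integral_const_mul, fourier_gaussKer (by simp),
    ← Complex.exp_add]
  congr 1
  have h3 : ξ ⬝ᵥ ξ = u ⬝ᵥ u + v ⬝ᵥ v := by
    simp only [dotProduct, Fintype.sum_sum_type]; rfl
  rw [one_mulVec, h3]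
  simp
  ring

theorem sympForm_single_inl_inr (j k : ι) :
    sympForm (Pi.single (Sum.inl j) 1) (Pi.single (Sum.inr k) 1) = if j = k then 1 else 0 := by
  simp only [sympForm, dotProduct, Function.comp_apply, Pi.single_apply]
  simp [eq_comm]

/-- The position block of the covariance matrix of a state is positive definite. -/
theorem HasGaussianChar.posDef_toBlocks₁₁ {φ : L2 ι} {M : Matrix (Phase ι) (Phase ι) ℝ}
    (h : HasGaussianChar φ M 0) : M.toBlocks₁₁.PosDef := by
  refine PosDef.of_dotProduct_mulVec_pos ?_ fun u hu => ?_
  · ext i j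
    exact congrFun (congrFun h.1 (Sum.inl i)) (Sum.inl j)
  rw [star_trivial]
  by_contra hneg
  refine hu ?_
  -- The squared norm of (u · q)φ is half the quadratic form at u, so failure of positivity forces
  -- this vector to vanish. The canonical commutation relation makes Im ⟨y, p_j φ⟩ = u_j/2, whence u
  -- = 0.
  set y : L2 ι := ∑ k, (u k : ℂ) • quad (Sum.inl k) φ with hy
  have hinner : ∀ l, inner ℂ y (quad l φ) = ∑ k, (u k : ℂ) * (M (Sum.inl k) l / 2 +
      Complex.I * sympForm (Pi.single (Sum.inl k) 1) (Pi.single l 1) / 2 : ℂ) := fun l => by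
    rw [hy, sum_inner]
    refine Finset.sum_congr rfl fun k _ => ?_
    rw [inner_smul_left, h.inner_quad_quad]
    simp
  have hyy : ‖y‖ ^ 2 = u ⬝ᵥ M.toBlocks₁₁ *ᵥ u / 2 := by
    rw [← inner_self_eq_norm_sq (𝕜 := ℂ)]
    conv_lhs => enter [2, 3]; rw [hy]
    rw [inner_sum]
    simp only [inner_smul_right, hinner]
    simp only [map_sum, RCLike.re_to_complex, Complex.re_ofReal_mul, Complex.re_sum]
    simp only [dotProduct, mulVec, Finset.mul_sum, Finset.sum_div]
    rw [Finset.sum_comm]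
    refine Finset.sum_congr rfl fun k _ => Finset.sum_congr rfl fun l _ => ?_
    simp [toBlocks₁₁]
    ring
  have hy0 : y = 0 := by
    rw [← norm_eq_zero, ← sq_eq_zero_iff]
    have := sq_nonneg ‖y‖
    linarith
  funext j
  have h1 := congrArg Complex.im (hinner (Sum.inr j))
  rw [hy0, inner_zero_left] at h1
  simp [sympForm_single_inl_inr, ite_div, eq_comm] at h1
  exact h1

/-! ### Rigidity of pure Gaussian states. -/

/-- Passing from the coordinates `(x, x + v)` to `(x, y)` in almost everywhere identities. -/
theorem ae_ae_eq_of_shift {F G : (ι → ℝ) → (ι → ℝ) → ℂ} (hF : Measurable (Function.uncurry F))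
    (hG : Measurable (Function.uncurry G)) (h : ∀ v, ∀ᵐ x, F x (x + v) = G x (x + v)) :
    ∀ᵐ x, ∀ᵐ y, F x y = G x y := by
  have hs : Measurable fun p : (ι → ℝ) × (ι → ℝ) => (p.2, p.2 + p.1) := by fun_prop
  have h1 : ∀ᵐ x : ι → ℝ, ∀ᵐ v : ι → ℝ, F x (x + v) = G x (x + v) := by
    refine (Measure.ae_ae_comm (p := fun v x => F x (x + v) = G x (x + v)) ?_).1
      (Filter.Eventually.of_forall h)
    exact measurableSet_eq_fun (hF.comp hs) (hG.comp hs)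
  filter_upwards [h1] with x hx
  have := ae_comp_add_right hx (-x)
  filter_upwards [this] with y hy
  rwa [show x + (y + -x) = y by abel] at hy

/-- Differentiation at t = 0 removes the ambiguity modulo 2πi. -/
theorem eq_zero_of_forall_exp_eq_one {c : ℂ} (h : ∀ t : ℝ, Complex.exp (t * c) = 1) : c = 0 := by
  have h1 : HasDerivAt (fun t : ℝ => Complex.exp (t * c)) c 0 := by
    have h2 : HasDerivAt (fun z : ℂ => Complex.exp (z * c)) c ((0 : ℝ) : ℂ) := by
      simpa using ((hasDerivAt_id ((0 : ℝ) : ℂ)).mul_const c).cexp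
    exact h2.comp_ofReal
  have h3 : (fun t : ℝ => Complex.exp (t * c)) = fun _ => 1 := funext h
  rw [h3] at h1
  exact h1.unique (hasDerivAt_const 0 1)

/-- The kernel of a Gaussian state with position block `M⁻¹ M⁻ᵀ`, correlation block `K` and momentum
block `P` of the covariance matrix. -/
noncomputable def stateKer (M K P : Matrix ι ι ℝ) (x y : ι → ℝ) : ℂ :=
  Complex.exp ((-((y - x) ⬝ᵥ P *ᵥ (y - x)) / 4 : ℝ) : ℂ) *
    gaussKer M (-(1 / 2 : ℝ) • (M *ᵥ K *ᵥ (y - x))) (x + (1 / 2 : ℝ) • (y - x))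

theorem continuous_stateKer (M K P : Matrix ι ι ℝ) :
    Continuous fun p : (ι → ℝ) × (ι → ℝ) => stateKer M K P p.1 p.2 := by
  have hsub : Continuous fun p : (ι → ℝ) × (ι → ℝ) => p.2 - p.1 := by fun_prop
  have h1 : ∀ (N : Matrix ι ι ℝ) {f : (ι → ℝ) × (ι → ℝ) → ι → ℝ}, Continuous f →
      Continuous fun p => N *ᵥ f p := fun N f hf => Continuous.matrix_mulVec continuous_const hf
  have h2 := (continuous_quadratic P).comp hsub
  have h3 := h1 M (h1 K hsub)
  have h4 := h1 M ((continuous_fst (X := ι → ℝ) (Y := ι → ℝ)).add (hsub.const_smul (1 / 2 : ℝ)))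
  unfold stateKer gaussKer
  simp only [Function.comp_def] at h2
  refine Continuous.mul (by fun_prop) (continuous_const.mul (Complex.continuous_exp.comp ?_))
  refine (continuous_finsetSum _ fun j _ => ?_).neg
  have h5 := (continuous_apply j).comp h4
  have h6 := (continuous_apply j).comp (h3.const_smul (-(1 / 2 : ℝ)))
  simp only [Function.comp_def] at h5 h6
  fun_prop

theorem stateKer_ne_zero (K P : Matrix ι ι ℝ) (x y : ι → ℝ) : stateKer 1 K P x y ≠ 0 := by
  have h : 0 < |(1 : Matrix ι ι ℝ).det| * (√Real.pi ^ Fintype.card ι)⁻¹ := by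
    rw [det_one, abs_one, one_mul]
    have := Real.sqrt_pos.2 Real.pi_pos
    positivity
  exact mul_ne_zero (Complex.exp_ne_zero _)
    (mul_ne_zero (Complex.ofReal_ne_zero.2 h.ne') (Complex.exp_ne_zero _))

theorem stateKer_eq (K P : Matrix ι ι ℝ) (x y : ι → ℝ) : stateKer 1 K P x y =
    ((√Real.pi ^ Fintype.card ι)⁻¹ : ℝ) * Complex.exp (((-((y - x) ⬝ᵥ P *ᵥ (y - x)) / 4 -
      (x + (1 / 2 : ℝ) • (y - x)) ⬝ᵥ (x + (1 / 2 : ℝ) • (y - x)) +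
      (K *ᵥ (y - x)) ⬝ᵥ (K *ᵥ (y - x)) / 4 : ℝ) : ℂ) +
      Complex.I * (((x + (1 / 2 : ℝ) • (y - x)) ⬝ᵥ K *ᵥ (y - x) : ℝ) : ℂ)) := by
  rw [stateKer, gaussKer, det_one, abs_one, one_mul, mul_left_comm, ← Complex.exp_add, one_mulVec,
    one_mulVec]
  congr 2
  set z := x + (1 / 2 : ℝ) • (y - x)
  set b := K *ᵥ (y - x)
  have e : -∑ j, ((z j : ℂ) + Complex.I * ((-(1 / 2 : ℝ) • b) j : ℂ)) ^ 2 =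
      ((-(z ⬝ᵥ z) + b ⬝ᵥ b / 4 : ℝ) : ℂ) + Complex.I * ((z ⬝ᵥ b : ℝ) : ℂ) := by
    simp only [dotProduct]
    push_cast
    rw [Finset.sum_div, Finset.mul_sum, ← Finset.sum_neg_distrib, ← Finset.sum_neg_distrib,
      ← Finset.sum_add_distrib, ← Finset.sum_add_distrib]
    refine Finset.sum_congr rfl fun j _ => ?_
    simp only [Pi.smul_apply, smul_eq_mul]
    push_cast
    linear_combination -((b j : ℂ) ^ 2 / 4) * Complex.I_sq
  rw [e]
  push_cast
  ring

/-- The cross term in the exponent of `stateKer`. -/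
theorem stateKer_cross {K : Matrix ι ι ℝ} (P : Matrix ι ι ℝ) (hK : Kᵀ = -K) (hP : Pᵀ = P)
    (x y : ι → ℝ) :
    stateKer 1 K P x y * stateKer 1 K P 0 0 = stateKer 1 K P 0 y * stateKer 1 K P x 0 *
      Complex.exp (((-(x ⬝ᵥ y + (K *ᵥ x) ⬝ᵥ (K *ᵥ y) - x ⬝ᵥ P *ᵥ y) / 2 : ℝ) : ℂ) +
        Complex.I * ((x ⬝ᵥ K *ᵥ y : ℝ) : ℂ)) := by
  have hPs : y ⬝ᵥ P *ᵥ x = x ⬝ᵥ P *ᵥ y := by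
    rw [dotProduct_mulVec, ← mulVec_transpose, hP, dotProduct_comm]
  have hKs : ∀ x y, y ⬝ᵥ K *ᵥ x = -(x ⬝ᵥ K *ᵥ y) := fun x y => by
    rw [dotProduct_mulVec, ← mulVec_transpose, hK, neg_mulVec, neg_dotProduct, dotProduct_comm]
  have hK0 : ∀ x, x ⬝ᵥ K *ᵥ x = 0 := fun x => by linarith [hKs x x]
  rw [stateKer_eq, stateKer_eq, stateKer_eq, stateKer_eq, mul_mul_mul_comm, ← Complex.exp_add,
    mul_mul_mul_comm, ← Complex.exp_add,
    mul_assoc (_ * _) (Complex.exp _) (Complex.exp _), ← Complex.exp_add]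
  congr 2
  simp only [sub_zero, zero_sub, zero_add, mulVec_neg, mulVec_sub, mulVec_zero, dotProduct_add,
    dotProduct_sub, dotProduct_neg, dotProduct_zero, add_dotProduct,
    sub_dotProduct, neg_dotProduct, smul_dotProduct, dotProduct_smul, smul_eq_mul, smul_zero,
    hPs, hK0, hKs x y, dotProduct_comm y x, dotProduct_comm (K *ᵥ y) (K *ᵥ x)]
  push_cast
  ring

/-- For fixed v the characteristic function is, as a function of u, the Fourier transform of x ↦ φ(x
+ v) conj φ(x), so Fourier inversion recovers the kernel. -/
theorem HasGaussianChar.ae_kernel {φ : L2 ι} {K P : Matrix ι ι ℝ}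
    (h : HasGaussianChar φ (fromBlocks 1 K (-K) P) 0) (hK : Kᵀ = -K) :
    ∀ᵐ x, ∀ᵐ y, φ y * (starRingEnd ℂ) (φ x) = stateKer 1 K P x y := by
  have hm : Measurable φ := (Lp.stronglyMeasurable φ).measurable
  refine ae_ae_eq_of_shift (F := fun x y => φ y * (starRingEnd ℂ) (φ x)) (G := stateKer 1 K P) ?_
    (continuous_stateKer 1 K P).measurable fun v => ?_
  · exact (hm.comp measurable_snd).mul (Complex.continuous_conj.measurable.comp (hm.comp measurable_fst))
  · have := ae_eq_gaussKer (integrable_shift_mul_conj φ v) (a := 1) (k := K) (p := P) (M := 1)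
      (by simp) (by simp) v fun u => by
        have := h.2 (Sum.elim u v)
        rw [inner_weyl_eq_integral, Sum.elim_comp_inl, Sum.elim_comp_inr] at this
        rw [this]
        congr 1
        have e : Sum.elim u v ⬝ᵥ fromBlocks 1 K (-K) P *ᵥ Sum.elim u v =
            u ⬝ᵥ (1 : Matrix ι ι ℝ) *ᵥ u + 2 * (u ⬝ᵥ K *ᵥ v) + v ⬝ᵥ P *ᵥ v := by
          have e' : v ⬝ᵥ (-K) *ᵥ u = u ⬝ᵥ K *ᵥ v := by
            rw [← hK, dotProduct_mulVec, vecMul_transpose, dotProduct_comm]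
          rw [fromBlocks_mulVec, sumElim_dotProduct_sumElim, Sum.elim_comp_inl,
            Sum.elim_comp_inr, dotProduct_add, dotProduct_add, e']
          ring
        rw [e]
        simp
    filter_upwards [this] with x hx
    rw [hx, stateKer, add_sub_cancel_left]

theorem eq_of_ae_ae_eq {F G : (ι → ℝ) × (ι → ℝ) → ℂ} (hF : Continuous F) (hG : Continuous G)
    (h : ∀ᵐ x : ι → ℝ, ∀ᵐ y : ι → ℝ, F (x, y) = G (x, y)) (x y : ι → ℝ) : F (x, y) = G (x, y) := by
  have h1 : ∀ᵐ x : ι → ℝ, ∀ y, F (x, y) = G (x, y) := by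
    filter_upwards [h] with x hx
    exact congrFun ((Continuous.ae_eq_iff_eq volume (by fun_prop) (by fun_prop)).1 hx)
  have h2 : (fun x => F (x, y)) = fun x => G (x, y) :=
    (Continuous.ae_eq_iff_eq volume (by fun_prop) (by fun_prop)).1 (h1.mono fun x hx => hx y)
  exact congrFun h2 x

/-- A pure Gaussian state with normalized position block and antisymmetric correlations is the
vacuum. -/
theorem HasGaussianChar.eq_vac_of_reduced {φ : L2 ι} {K P : Matrix ι ι ℝ}
    (h : HasGaussianChar φ (fromBlocks 1 K (-K) P) 0) (hK : Kᵀ = -K) :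
    K = 0 ∧ P = 1 ∧ ∃ c : ℂ, φ = c • vac ι := by
  have hP : Pᵀ = P := by
    have := h.1
    rw [fromBlocks_transpose, fromBlocks_inj] at this
    exact this.2.2.2
  have hker := h.ae_kernel hK
  obtain ⟨x₀, hx₀⟩ := hker.exists
  set c₀ := (starRingEnd ℂ) (φ x₀) with hc₀
  have hc0 : c₀ ≠ 0 := by
    intro h0
    obtain ⟨y, hy⟩ := hx₀.exists
    rw [h0, mul_zero] at hy
    exact stateKer_ne_zero _ _ _ _ hy.symm
  let g : (ι → ℝ) → ℂ := fun y => c₀⁻¹ * stateKer 1 K P x₀ y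
  have hg : φ =ᵐ[volume] g := by
    filter_upwards [hx₀] with y hy
    simp only [g]
    rw [← hy]
    field_simp
  have hgc : Continuous g := by
    have : Continuous fun y => stateKer 1 K P x₀ y :=
      Continuous.comp (g := fun p : (ι → ℝ) × (ι → ℝ) => stateKer 1 K P p.1 p.2)
        (f := fun y => (x₀, y)) (continuous_stateKer 1 K P) (continuous_const.prodMk continuous_id)
    fun_prop
  -- Continuity of the representative g upgrades the almost everywhere identity, so that it can be
  -- evaluated at 0.
  have hgg : ∀ x y, g y * (starRingEnd ℂ) (g x) = stateKer 1 K P x y := by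
    refine eq_of_ae_ae_eq (F := fun p => g p.2 * (starRingEnd ℂ) (g p.1))
      (G := fun p => stateKer 1 K P p.1 p.2) ?_ (continuous_stateKer 1 K P) ?_
    · exact (hgc.comp continuous_snd).mul (Complex.continuous_conj.comp (hgc.comp continuous_fst))
    · filter_upwards [hker, hg] with x h1 h2
      filter_upwards [h1, hg] with y h3 h4
      rw [← h2, ← h4, h3]
  have hcross : ∀ x y, Complex.exp (((-(x ⬝ᵥ y + (K *ᵥ x) ⬝ᵥ (K *ᵥ y) - x ⬝ᵥ P *ᵥ y) / 2 : ℝ) : ℂ) +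
        Complex.I * ((x ⬝ᵥ K *ᵥ y : ℝ) : ℂ)) = 1 := fun x y => by
    have h1 := stateKer_cross P hK hP x y
    -- A rank-one kernel has vanishing 2 × 2 minors, so the exponential of the cross term is 1.
    -- Replacing x by t x then kills the bilinear exponent itself.
    have h2 : stateKer 1 K P x y * stateKer 1 K P 0 0 = stateKer 1 K P 0 y * stateKer 1 K P x 0 := by
      rw [← hgg, ← hgg, ← hgg, ← hgg]; ring
    rw [h2] at h1
    exact (mul_right_eq_self₀.1 h1.symm).resolve_right
      (mul_ne_zero (stateKer_ne_zero _ _ _ _) (stateKer_ne_zero _ _ _ _))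
  have hzero : ∀ x y, ((-(x ⬝ᵥ y + (K *ᵥ x) ⬝ᵥ (K *ᵥ y) - x ⬝ᵥ P *ᵥ y) / 2 : ℝ) : ℂ) +
        Complex.I * ((x ⬝ᵥ K *ᵥ y : ℝ) : ℂ) = 0 := fun x y => by
    refine eq_zero_of_forall_exp_eq_one fun t => ?_
    rw [← hcross (t • x) y]
    congr 1
    simp only [mulVec_smul, smul_dotProduct, smul_eq_mul]
    push_cast
    ring
  have hK0 : K = 0 := by
    refine Matrix.ext_of_mulVec_single fun j => ?_
    -- The imaginary part says x · K y = 0 for all x and y; taking x = K y makes it a square. The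
    -- real part is used below in the same way to get P = 1.
    have := congrArg Complex.im (hzero (K *ᵥ Pi.single j 1) (Pi.single j 1))
    simp only [Complex.add_im, Complex.ofReal_im, Complex.mul_im, Complex.I_re, Complex.I_im,
      Complex.ofReal_re, zero_mul, one_mul, zero_add, Complex.zero_im] at this
    rw [dotProduct_self_eq_zero.1 this, zero_mulVec]
  have hP1 : P = 1 := by
    refine Matrix.ext_of_mulVec_single fun j => ?_
    have := congrArg Complex.re (hzero (P *ᵥ Pi.single j 1 - Pi.single j 1) (Pi.single j 1))
    simp only [hK0, Complex.add_re, Complex.ofReal_re, Complex.mul_re, Complex.I_re, Complex.I_im,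
      Complex.ofReal_im, mul_zero, sub_zero, add_zero, Complex.zero_re,
      zero_mulVec, dotProduct_zero] at this
    have h2 : (P *ᵥ Pi.single j 1 - Pi.single j 1) ⬝ᵥ (P *ᵥ Pi.single j 1 - Pi.single j 1) = 0 := by
      rw [dotProduct_sub]
      linarith
    rw [one_mulVec]
    exact sub_eq_zero.1 (dotProduct_self_eq_zero.1 h2)
  refine ⟨hK0, hP1, c₀⁻¹ * vacFun ι x₀, Lp.ext ?_⟩
  filter_upwards [hg, Lp.coeFn_smul (c₀⁻¹ * vacFun ι x₀) (vac ι), coeFn_vac (ι := ι)] with y h1 h2 h3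
  rw [h1, h2, Pi.smul_apply, h3, smul_eq_mul, mul_assoc, vacFun_mul_vacFun]
  simp [g, stateKer, hK0, hP1]

theorem HasGaussianChar.eq_smul_vac {φ : L2 ι} (h : HasGaussianChar φ 1 0) :
    ∃ c : ℂ, φ = c • vac ι :=
  (HasGaussianChar.eq_vac_of_reduced (K := 0) (P := 1) (by simpa [fromBlocks_one] using h)
    (by simp)).2.2

/-- The covariance matrix of a pure Gaussian state is brought to the identity by a triangular
symplectic matrix. -/
theorem HasGaussianChar.exists_triMat_conj_eq_one {ψ : L2 ι} {V : Matrix (Phase ι) (Phase ι) ℝ}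
    (h : HasGaussianChar ψ V 0) : ∃ L C : Matrix ι ι ℝ, IsUnit L.det ∧ Cᵀ = C ∧
      triMat L C * V * (triMat L C)ᵀ = 1 := by
  obtain ⟨L, C, K, P, hL, hC, hK, hT⟩ := exists_triMat_reduction h.1 h.posDef_toBlocks₁₁
  refine ⟨L, C, hL, hC, ?_⟩
  have h2 := h.map_triUnitary hL hC
  rw [hT] at h2 ⊢
  obtain ⟨rfl, rfl, -⟩ := h2.eq_vac_of_reduced hK
  rw [neg_zero, fromBlocks_one]

/-- The covariance matrix of a pure Gaussian state is `S Sᵀ` with `S` symplectic. -/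
theorem HasGaussianChar.exists_eq_mul_transpose {ψ : L2 ι} {V : Matrix (Phase ι) (Phase ι) ℝ}
    (h : HasGaussianChar ψ V 0) : ∃ S ∈ symplecticGroup ι ℝ, V = S * Sᵀ := by
  obtain ⟨L, C, hL, hC, hT⟩ := h.exists_triMat_conj_eq_one
  have hm := triMat_mem_symplecticGroup hL hC
  have hu := isUnit_det_of_mem_symplecticGroup hm
  have huT : IsUnit (triMat L C)ᵀ.det := by rwa [det_transpose]
  refine ⟨_, inv_mem_symplecticGroup hm, ?_⟩
  have : (triMat L C)⁻¹ * (triMat L C * V * (triMat L C)ᵀ) * (triMat L C)ᵀ⁻¹ = V := by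
    rw [Matrix.mul_assoc _ V, nonsing_inv_mul_cancel_left _ _ hu,
      mul_nonsing_inv_cancel_right _ _ huT]
  rw [← this, hT, Matrix.mul_one, transpose_nonsing_inv]

/-! ### Tensor products of wave functions. -/

/-- Splitting of the configuration space of a composite system. -/
def splitEquiv (ι κ : Type) : (ι ⊕ κ → ℝ) ≃ᵐ (ι → ℝ) × (κ → ℝ) :=
  MeasurableEquiv.sumPiEquivProdPi fun _ => ℝ

theorem splitEquiv_symm_apply (p : (ι → ℝ) × (κ → ℝ)) :
    (splitEquiv ι κ).symm p = Sum.elim p.1 p.2 := by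
  rw [MeasurableEquiv.symm_apply_eq]; rfl

theorem measurePreserving_splitEquiv :
    MeasurePreserving (splitEquiv ι κ) volume volume :=
  volume_measurePreserving_sumPiEquivProdPi _

theorem ae_comp_inl {p : (ι → ℝ) → Prop} (h : ∀ᵐ x, p x) :
    ∀ᵐ z : ι ⊕ κ → ℝ, p (z ∘ Sum.inl) :=
  (Measure.quasiMeasurePreserving_fst.comp
    (measurePreserving_splitEquiv (ι := ι) (κ := κ)).quasiMeasurePreserving).ae h

theorem ae_comp_inr {p : (κ → ℝ) → Prop} (h : ∀ᵐ x, p x) :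
    ∀ᵐ z : ι ⊕ κ → ℝ, p (z ∘ Sum.inr) :=
  (Measure.quasiMeasurePreserving_snd.comp
    (measurePreserving_splitEquiv (ι := ι) (κ := κ)).quasiMeasurePreserving).ae h

theorem ae_ae_elim {p : (ι ⊕ κ → ℝ) → Prop} (h : ∀ᵐ z, p z) :
    ∀ᵐ x : ι → ℝ, ∀ᵐ y : κ → ℝ, p (Sum.elim x y) := by
  have := (measurePreserving_splitEquiv (ι := ι) (κ := κ)).symm.quasiMeasurePreserving.ae h
  have h2 := Measure.ae_ae_of_ae_prod this
  simpa only [splitEquiv_symm_apply] using h2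

theorem integral_sum_eq {E : Type*} [NormedAddCommGroup E] [NormedSpace ℝ E]
    (f : (ι ⊕ κ → ℝ) → E) :
    ∫ z, f z = ∫ p : (ι → ℝ) × (κ → ℝ), f (Sum.elim p.1 p.2) := by
  rw [← (measurePreserving_splitEquiv (ι := ι) (κ := κ)).symm.integral_comp
    (splitEquiv ι κ).symm.measurableEmbedding]
  simp only [splitEquiv_symm_apply]

theorem integrable_elim {E : Type*} [NormedAddCommGroup E] {f : (ι ⊕ κ → ℝ) → E}
    (hf : Integrable f) :
    Integrable fun p : (ι → ℝ) × (κ → ℝ) => f (Sum.elim p.1 p.2) := by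
  have := (measurePreserving_splitEquiv (ι := ι) (κ := κ)).symm.integrable_comp_of_integrable hf
  simpa only [Function.comp_def, splitEquiv_symm_apply] using this

theorem memLp_tensor (f : L2 ι) (g : L2 κ) :
    MemLp (fun z : ι ⊕ κ → ℝ => f (z ∘ Sum.inl) * g (z ∘ Sum.inr)) 2 volume := by
  have h1 : MemLp (fun p : (ι → ℝ) × (κ → ℝ) => f p.1 * g p.2) 2 volume := by
    have hm : AEStronglyMeasurable (fun p : (ι → ℝ) × (κ → ℝ) => f p.1 * g p.2) volume :=
      (Lp.aestronglyMeasurable f).comp_fst.mul (Lp.aestronglyMeasurable g).comp_snd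
    rw [memLp_two_iff_integrable_sq_norm hm]
    have hf := (memLp_two_iff_integrable_sq_norm (Lp.aestronglyMeasurable f)).1 (Lp.memLp f)
    have hg := (memLp_two_iff_integrable_sq_norm (Lp.aestronglyMeasurable g)).1 (Lp.memLp g)
    simp only [norm_mul, mul_pow]
    exact hf.mul_prod hg
  exact h1.comp_measurePreserving measurePreserving_splitEquiv

/-- The tensor product `f ⊗ g`. -/
noncomputable def tensor (f : L2 ι) (g : L2 κ) : L2 (ι ⊕ κ) := (memLp_tensor f g).toLp _

theorem isTensor_tensor (f : L2 ι) (g : L2 κ) : IsTensor (tensor f g) f g := MemLp.coeFn_toLp _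

theorem IsTensor.eq {h h' : L2 (ι ⊕ κ)} {f : L2 ι} {g : L2 κ} (h1 : IsTensor h f g)
    (h2 : IsTensor h' f g) : h = h' := Lp.ext (h1.trans h2.symm)

theorem IsTensor.smul {h : L2 (ι ⊕ κ)} {f : L2 ι} {g : L2 κ} (H : IsTensor h f g) (a b : ℂ) :
    IsTensor ((a * b) • h) (a • f) (b • g) := by
  unfold IsTensor at H ⊢
  filter_upwards [H, Lp.coeFn_smul (a * b) h, ae_comp_inl (κ := κ) (Lp.coeFn_smul a f),
    ae_comp_inr (ι := ι) (Lp.coeFn_smul b g)] with z h1 h2 h3 h4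
  rw [h2, h3, h4, Pi.smul_apply, Pi.smul_apply, Pi.smul_apply, h1, smul_eq_mul, smul_eq_mul,
    smul_eq_mul]
  ring

theorem dotProduct_sum (u v : ι ⊕ κ → ℝ) :
    u ⬝ᵥ v = (u ∘ Sum.inl) ⬝ᵥ (v ∘ Sum.inl) + (u ∘ Sum.inr) ⬝ᵥ (v ∘ Sum.inr) := by
  simp only [dotProduct, Fintype.sum_sum_type, Function.comp_apply]

theorem IsTensor.weyl {h : L2 (ι ⊕ κ)} {f : L2 ι} {g : L2 κ} (H : IsTensor h f g)
    (ξ : Phase (ι ⊕ κ) → ℝ) :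
    IsTensor (weyl ξ h) (weyl (ξ ∘ Sum.map Sum.inl Sum.inl) f)
      (weyl (ξ ∘ Sum.map Sum.inr Sum.inr) g) := by
  unfold IsTensor at H ⊢
  filter_upwards [coeFn_weyl ξ h, ae_comp_add_right H (ξ ∘ Sum.inr),
    ae_comp_inl (κ := κ) (coeFn_weyl (ξ ∘ Sum.map Sum.inl Sum.inl) f),
    ae_comp_inr (ι := ι) (coeFn_weyl (ξ ∘ Sum.map Sum.inr Sum.inr) g)] with z h1 h2 h3 h4
  rw [h1, h3, h4, weylFun, weylFun, weylFun, h2, dotProduct_sum (ξ ∘ Sum.inl) z,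
    dotProduct_sum (ξ ∘ Sum.inl) (ξ ∘ Sum.inr)]
  have e : ∀ a b c d : ℝ, Complex.exp (Complex.I * ((a + b + (c + d) / 2 : ℝ) : ℂ)) =
      Complex.exp (Complex.I * ((a + c / 2 : ℝ) : ℂ)) *
        Complex.exp (Complex.I * ((b + d / 2 : ℝ) : ℂ)) := fun a b c d => by
    rw [← Complex.exp_add]
    congr 1
    push_cast
    ring
  rw [e]
  exact mul_mul_mul_comm _ _ _ _

theorem isTensor_vac : IsTensor (vac (ι ⊕ κ)) (vac ι) (vac κ) := by
  unfold IsTensor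
  filter_upwards [coeFn_vac (ι := ι ⊕ κ), ae_comp_inl (κ := κ) (coeFn_vac (ι := ι)),
    ae_comp_inr (ι := ι) (coeFn_vac (ι := κ))] with z h1 h2 h3
  rw [h1, h2, h3, vacFun, vacFun, vacFun, ← Complex.ofReal_mul, dotProduct_sum z z,
    Fintype.card_sum, pow_add, mul_inv, Real.sqrt_mul (by positivity), neg_add, add_div,
    Real.exp_add]
  congr 1
  ring

theorem vacFun_ne_zero (x : ι → ℝ) : vacFun ι x ≠ 0 := by
  have := Real.sqrt_pos.2 Real.pi_pos
  have h : 0 < √((√Real.pi ^ Fintype.card ι)⁻¹) := Real.sqrt_pos.2 (by positivity)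
  exact Complex.ofReal_ne_zero.2 (mul_pos h (Real.exp_pos _)).ne'

/-- The vectors `exp(i u·q) Ω` with `Ω` the vacuum span a dense subspace. -/
theorem dense_span_weyl_vac :
    Dense (Submodule.span ℂ (Set.range fun ξ : Phase ι → ℝ => weyl ξ (vac ι)) : Set (L2 ι)) := by
  rw [Submodule.dense_iff_topologicalClosure_eq_top, Submodule.topologicalClosure_eq_top_iff,
    Submodule.eq_bot_iff]
  intro h hh
  -- Orthogonality to the pure phases already says that h times the vacuum wave function has zero
  -- Fourier transform, and the latter never vanishes.
  have h0 : ∀ u : ι → ℝ, ∫ x, Complex.exp (Complex.I * ((u ⬝ᵥ x : ℝ) : ℂ)) *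
      (h x * (starRingEnd ℂ) (vac ι x)) = 0 := fun u => by
    have := (Submodule.mem_orthogonal _ _).1 hh _ (Submodule.subset_span ⟨Sum.elim (-u) 0, rfl⟩)
    rw [L2.inner_def] at this
    rw [← this]
    refine integral_congr_ae ?_
    filter_upwards [coeFn_weyl (Sum.elim (-u) 0) (vac ι)] with x hx
    rw [hx, RCLike.inner_apply, weylFun, map_mul, ← Complex.exp_conj]
    simp
    ring
  have hint : Integrable fun x => h x * (starRingEnd ℂ) (vac ι x) := by
    simpa only [RCLike.inner_apply] using L2.integrable_inner (𝕜 := ℂ) (vac ι) h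
  have hz := ae_eq_zero_of_fourier_eq_zero hint h0
  refine Lp.ext ?_
  filter_upwards [hz, coeFn_vac (ι := ι), Lp.coeFn_zero ℂ 2 (volume : Measure (ι → ℝ))] with x h1 h2 h3
  rw [h3, Pi.zero_apply]
  rw [Pi.zero_apply, h2, conj_vacFun] at h1
  exact (mul_eq_zero.1 h1).resolve_right (vacFun_ne_zero x)

/-! ### Local Gaussian unitaries on phase space. -/

theorem dirSum_mulVec_left (S : Matrix (Phase ι) (Phase ι) ℝ) (T : Matrix (Phase κ) (Phase κ) ℝ)
    (ξ : Phase (ι ⊕ κ) → ℝ) :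
    (dirSum S T *ᵥ ξ) ∘ Sum.map Sum.inl Sum.inl = S *ᵥ (ξ ∘ Sum.map Sum.inl Sum.inl) := by
  ext k
  simp only [Function.comp_apply, mulVec, dotProduct, dirSum]
  rw [← (Equiv.sumSumSumComm ι κ ι κ).symm.sum_comp, Fintype.sum_sum_type]
  rcases k with k | k <;> simp [Fintype.sum_sum_type]

theorem dirSum_mulVec_right (S : Matrix (Phase ι) (Phase ι) ℝ) (T : Matrix (Phase κ) (Phase κ) ℝ)
    (ξ : Phase (ι ⊕ κ) → ℝ) :
    (dirSum S T *ᵥ ξ) ∘ Sum.map Sum.inr Sum.inr = T *ᵥ (ξ ∘ Sum.map Sum.inr Sum.inr) := by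
  ext k
  simp only [Function.comp_apply, mulVec, dotProduct, dirSum]
  rw [← (Equiv.sumSumSumComm ι κ ι κ).symm.sum_comp, Fintype.sum_sum_type]
  rcases k with k | k <;> simp [Fintype.sum_sum_type]

/-- A local Gaussian unitary acts on phase space by a direct sum of symplectic matrices. -/
theorem IsLocalGaussianUnitary.exists_dirSum {U : L2 (ι ⊕ κ) ≃ₗᵢ[ℂ] L2 (ι ⊕ κ)}
    (hU : IsLocalGaussianUnitary U) :
    ∃ S ∈ symplecticGroup ι ℝ, ∃ T ∈ symplecticGroup κ ℝ, ∃ d : Phase (ι ⊕ κ) → ℝ,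
      ∀ (ξ : Phase (ι ⊕ κ) → ℝ) (ψ : L2 (ι ⊕ κ)), weyl ξ (U ψ) =
        Complex.exp (Complex.I * ((ξ ⬝ᵥ d : ℝ) : ℂ)) • U (weyl ((dirSum S T)ᵀ *ᵥ ξ) ψ) := by
  obtain ⟨U₁, U₂, ⟨S, hS, d₁, h₁⟩, ⟨T, hT, d₂, h₂⟩, hten⟩ := hU
  refine ⟨S, hS, T, hT, Sum.elim d₁ d₂ ∘ Equiv.sumSumSumComm ι κ ι κ, fun ξ ψ => ?_⟩
  set d := Sum.elim d₁ d₂ ∘ Equiv.sumSumSumComm ι κ ι κ with hd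
  have hdot : ξ ⬝ᵥ d = (ξ ∘ Sum.map Sum.inl Sum.inl) ⬝ᵥ d₁ +
      (ξ ∘ Sum.map Sum.inr Sum.inr) ⬝ᵥ d₂ := by
    simp only [dotProduct]
    rw [← (Equiv.sumSumSumComm ι κ ι κ).symm.sum_comp, Fintype.sum_sum_type]
    congr 1 <;> refine Finset.sum_congr rfl fun k _ => ?_ <;> rcases k with k | k <;> rfl
  set c := Complex.exp (Complex.I * ((ξ ⬝ᵥ d : ℝ) : ℂ)) with hc
  let A : L2 (ι ⊕ κ) →L[ℂ] L2 (ι ⊕ κ) :=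
    (weylIsometry ξ).toContinuousLinearMap ∘L (U.toContinuousLinearEquiv : _ →L[ℂ] _)
  let B : L2 (ι ⊕ κ) →L[ℂ] L2 (ι ⊕ κ) := c • ((U.toContinuousLinearEquiv : _ →L[ℂ] _) ∘L
    (weylIsometry ((dirSum S T)ᵀ *ᵥ ξ)).toContinuousLinearMap)
  -- Both sides are bounded and linear in ψ. They are compared on Weyl translates of the vacuum,
  -- which are product vectors with dense span, so the covariance of the two factors suffices.
  suffices hAB : A = B by exact congrArg (fun F : L2 (ι ⊕ κ) →L[ℂ] L2 (ι ⊕ κ) => F ψ) hAB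
  refine ContinuousLinearMap.ext_on dense_span_weyl_vac ?_
  rintro _ ⟨η, rfl⟩
  change weyl ξ (U (weyl η (vac _))) = c • U (weyl ((dirSum S T)ᵀ *ᵥ ξ) (weyl η (vac _)))
  have t0 := (isTensor_vac (ι := ι) (κ := κ)).weyl η
  have t1 := (hten _ _ _ t0).weyl ξ
  have t2 := hten _ _ _ (t0.weyl ((dirSum S T)ᵀ *ᵥ ξ))
  rw [dirSum_transpose, dirSum_mulVec_left, dirSum_mulVec_right] at t2
  rw [h₁, h₂] at t1
  have t3 := t2.smul (Complex.exp (Complex.I * (((ξ ∘ Sum.map Sum.inl Sum.inl) ⬝ᵥ d₁ : ℝ) : ℂ)))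
    (Complex.exp (Complex.I * (((ξ ∘ Sum.map Sum.inr Sum.inr) ⬝ᵥ d₂ : ℝ) : ℂ)))
  rw [← Complex.exp_add, ← mul_add, ← Complex.ofReal_add, ← hdot, ← hc, ← dirSum_transpose] at t3
  exact t1.eq t3

theorem isUnit_det_fromBlocks {L : Matrix ι ι ℝ} {L' : Matrix κ κ ℝ} (hL : IsUnit L.det)
    (hL' : IsUnit L'.det) : IsUnit (fromBlocks L 0 0 L').det := by
  rw [det_fromBlocks_zero₂₁]
  exact hL.mul hL'

theorem IsTensor.triUnitary {h : L2 (ι ⊕ κ)} {f : L2 ι} {g : L2 κ} (H : IsTensor h f g)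
    {L C : Matrix ι ι ℝ} {L' C' : Matrix κ κ ℝ} (hL : IsUnit L.det) (hL' : IsUnit L'.det) :
    IsTensor (triUnitary (isUnit_det_fromBlocks hL hL') (fromBlocks C 0 0 C') h)
      (triUnitary hL C f) (triUnitary hL' C' g) := by
  unfold IsTensor at H ⊢
  simp only [triUnitary_apply]
  have hmv : ∀ (A : Matrix ι ι ℝ) (B : Matrix κ κ ℝ) (z : ι ⊕ κ → ℝ),
      fromBlocks A 0 0 B *ᵥ z = Sum.elim (A *ᵥ (z ∘ Sum.inl)) (B *ᵥ (z ∘ Sum.inr)) := fun A B z => by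
    rw [fromBlocks_mulVec]
    simp
  filter_upwards [coeFn_triOp (isUnit_det_fromBlocks hL hL') (fromBlocks C 0 0 C') h,
    ae_comp_mulVec (isUnit_det_fromBlocks hL hL') H,
    ae_comp_inl (κ := κ) (coeFn_triOp hL C f),
    ae_comp_inr (ι := ι) (coeFn_triOp hL' C' g)] with z h1 h2 h3 h4
  rw [h1, h3, h4, triFun, triFun, triFun, h2, hmv, hmv, Sum.elim_comp_inl, Sum.elim_comp_inr,
    det_fromBlocks_zero₂₁, abs_mul, Real.sqrt_mul (abs_nonneg _), dotProduct_sum z,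
    Sum.elim_comp_inl, Sum.elim_comp_inr, add_div, Complex.ofReal_add, mul_add, Complex.exp_add,
    Complex.ofReal_mul]
  ring

theorem isLocalGaussianUnitary_triUnitary {L C : Matrix ι ι ℝ} {L' C' : Matrix κ κ ℝ}
    (hL : IsUnit L.det) (hL' : IsUnit L'.det) (hC : Cᵀ = C) (hC' : C'ᵀ = C') :
    IsLocalGaussianUnitary (triUnitary (isUnit_det_fromBlocks hL hL') (fromBlocks C 0 0 C')) :=
  ⟨triUnitary hL C, triUnitary hL' C', isGaussianUnitary_triUnitary hL hC,
    isGaussianUnitary_triUnitary hL' hC', fun _ _ _ H => H.triUnitary hL hL'⟩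

/-! ### The reduced kernel and its purity. -/

theorem elim_add_elim_zero (x v : ι → ℝ) (y : κ → ℝ) :
    Sum.elim x y + Sum.elim v 0 = Sum.elim (x + v) y := by
  ext k
  rcases k with k | k <;> simp

theorem integrable_prod_shift (ψ : L2 (ι ⊕ κ)) (v : ι → ℝ) :
    Integrable fun p : (ι → ℝ) × (κ → ℝ) =>
      ψ (Sum.elim (p.1 + v) p.2) * (starRingEnd ℂ) (ψ (Sum.elim p.1 p.2)) := by
  have := integrable_elim (integrable_shift_mul_conj ψ (Sum.elim v 0))
  simpa only [elim_add_elim_zero] using this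

theorem integrable_reducedKernel_shift (ψ : L2 (ι ⊕ κ)) (v : ι → ℝ) :
    Integrable fun x => reducedKernel ψ (x + v) x :=
  (integrable_prod_shift ψ v).integral_prod_left

/-- The characteristic function of the reduced state. -/
theorem inner_weyl_eq_integral_reducedKernel (ψ : L2 (ι ⊕ κ)) (u v : ι → ℝ) :
    inner ℂ ψ (weyl (Sum.elim (Sum.elim u 0) (Sum.elim v 0)) ψ) =
      ∫ x, Complex.exp (Complex.I * ((u ⬝ᵥ x + u ⬝ᵥ v / 2 : ℝ) : ℂ)) *
        reducedKernel ψ (x + v) x := by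
  rw [inner_weyl_eq_integral, integral_sum_eq]
  have e : ∀ p : (ι → ℝ) × (κ → ℝ), Complex.exp (Complex.I *
      ((((Sum.elim (Sum.elim u (0 : κ → ℝ)) (Sum.elim v (0 : κ → ℝ))) ∘ Sum.inl) ⬝ᵥ (Sum.elim p.1 p.2) +
        ((Sum.elim (Sum.elim u (0 : κ → ℝ)) (Sum.elim v (0 : κ → ℝ))) ∘ Sum.inl) ⬝ᵥ
          ((Sum.elim (Sum.elim u (0 : κ → ℝ)) (Sum.elim v (0 : κ → ℝ))) ∘ Sum.inr) / 2 : ℝ) : ℂ)) *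
      (ψ (Sum.elim p.1 p.2 + (Sum.elim (Sum.elim u (0 : κ → ℝ)) (Sum.elim v (0 : κ → ℝ))) ∘ Sum.inr) *
        (starRingEnd ℂ) (ψ (Sum.elim p.1 p.2))) =
      Complex.exp (Complex.I * ((u ⬝ᵥ p.1 + u ⬝ᵥ v / 2 : ℝ) : ℂ)) *
        (ψ (Sum.elim (p.1 + v) p.2) * (starRingEnd ℂ) (ψ (Sum.elim p.1 p.2))) := fun p => by
    rw [Sum.elim_comp_inl, Sum.elim_comp_inr, elim_add_elim_zero, sumElim_dotProduct_sumElim,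
      sumElim_dotProduct_sumElim, zero_dotProduct, zero_dotProduct, add_zero, add_zero]
  simp only [e]
  have hc : Continuous fun p : (ι → ℝ) × (κ → ℝ) =>
      Complex.exp (Complex.I * ((u ⬝ᵥ p.1 + u ⬝ᵥ v / 2 : ℝ) : ℂ)) := by
    have := (continuous_dotProduct_right u).comp (continuous_fst (X := ι → ℝ) (Y := κ → ℝ))
    simp only [Function.comp_def] at this
    fun_prop
  rw [Measure.volume_eq_prod, integral_prod]
  · simp only [integral_const_mul]
    rfl
  · refine (integrable_prod_shift ψ v).bdd_mul (c := 1) hc.aestronglyMeasurable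
      (Filter.Eventually.of_forall fun p => ?_)
    rw [norm_exp_I_mul_ofReal]

theorem measurable_reducedKernel (ψ : L2 (ι ⊕ κ)) :
    Measurable (Function.uncurry fun x y => reducedKernel ψ y x) := by
  have hψ : Measurable ψ := (Lp.stronglyMeasurable ψ).measurable
  have he : Measurable fun p : (ι → ℝ) × (κ → ℝ) => ψ (Sum.elim p.1 p.2) := by
    have := hψ.comp (splitEquiv ι κ).symm.measurable
    simpa only [Function.comp_def, splitEquiv_symm_apply] using this
  have h1 : Measurable fun q : ((ι → ℝ) × (ι → ℝ)) × (κ → ℝ) => ψ (Sum.elim q.1.2 q.2) :=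
    he.comp (g := fun p : (ι → ℝ) × (κ → ℝ) => ψ (Sum.elim p.1 p.2))
      (f := fun q : ((ι → ℝ) × (ι → ℝ)) × (κ → ℝ) => (q.1.2, q.2)) (by fun_prop)
  have h2 : Measurable fun q : ((ι → ℝ) × (ι → ℝ)) × (κ → ℝ) => ψ (Sum.elim q.1.1 q.2) :=
    he.comp (g := fun p : (ι → ℝ) × (κ → ℝ) => ψ (Sum.elim p.1 p.2))
      (f := fun q : ((ι → ℝ) × (ι → ℝ)) × (κ → ℝ) => (q.1.1, q.2)) (by fun_prop)
  have h3 : Measurable fun q : ((ι → ℝ) × (ι → ℝ)) × (κ → ℝ) =>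
      ψ (Sum.elim q.1.2 q.2) * (starRingEnd ℂ) (ψ (Sum.elim q.1.1 q.2)) :=
    h1.mul (Complex.continuous_conj.measurable.comp h2)
  exact (h3.stronglyMeasurable.integral_prod_right' (ν := volume)).measurable

/-- Restricting the characteristic function to displacements of the first part gives that of the
reduced state, and Fourier inversion applies as for a pure kernel. -/
theorem HasGaussianChar.ae_reducedKernel {ψ : L2 (ι ⊕ κ)}
    {V : Matrix (Phase (ι ⊕ κ)) (Phase (ι ⊕ κ)) ℝ} (h : HasGaussianChar ψ V 0)
    {a k p M : Matrix ι ι ℝ}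
    (hV : V.submatrix (Sum.map Sum.inl Sum.inl) (Sum.map Sum.inl Sum.inl) = fromBlocks a k kᵀ p)
    (hM : IsUnit M.det) (ha : M * a * Mᵀ = 1) :
    ∀ᵐ x, ∀ᵐ y, reducedKernel ψ y x = stateKer M k p x y := by
  refine ae_ae_eq_of_shift (F := fun x y => reducedKernel ψ y x) (G := stateKer M k p)
    (measurable_reducedKernel ψ) (continuous_stateKer M k p).measurable fun v => ?_
  have := ae_eq_gaussKer (integrable_reducedKernel_shift ψ v) (a := a) (k := k) (p := p) hM ha v
    fun u => by
      have h1 := h.2 (Sum.elim (Sum.elim u 0) (Sum.elim v 0))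
      rw [inner_weyl_eq_integral_reducedKernel] at h1
      rw [h1]
      congr 1
      have e1 : ∀ ξ : Phase ι → ℝ, ∀ W : Matrix (Phase (ι ⊕ κ)) (Phase (ι ⊕ κ)) ℝ,
          (Sum.elim (Sum.elim (ξ ∘ Sum.inl) 0) (Sum.elim (ξ ∘ Sum.inr) 0)) ⬝ᵥ W *ᵥ
            (Sum.elim (Sum.elim (ξ ∘ Sum.inl) 0) (Sum.elim (ξ ∘ Sum.inr) 0)) =
          ξ ⬝ᵥ W.submatrix (Sum.map Sum.inl Sum.inl) (Sum.map Sum.inl Sum.inl) *ᵥ ξ :=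
        fun ξ W => by
          simp [dotProduct, mulVec, Fintype.sum_sum_type]
      have e2 := e1 (Sum.elim u v) V
      rw [Sum.elim_comp_inl, Sum.elim_comp_inr, hV] at e2
      have e' : v ⬝ᵥ kᵀ *ᵥ u = u ⬝ᵥ k *ᵥ v := by
        rw [dotProduct_mulVec, vecMul_transpose, dotProduct_comm]
      have e3 : Sum.elim u v ⬝ᵥ fromBlocks a k kᵀ p *ᵥ Sum.elim u v =
          u ⬝ᵥ a *ᵥ u + 2 * (u ⬝ᵥ k *ᵥ v) + v ⬝ᵥ p *ᵥ v := by
        rw [fromBlocks_mulVec, sumElim_dotProduct_sumElim, Sum.elim_comp_inl, Sum.elim_comp_inr,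
          dotProduct_add, dotProduct_add, e']
        ring
      rw [e2, e3]
      simp
  filter_upwards [this] with x hx
  rw [hx, stateKer, add_sub_cancel_left]

theorem norm_reducedKernel_comm (ψ : L2 (ι ⊕ κ)) (x y : ι → ℝ) :
    ‖reducedKernel ψ x y‖ = ‖reducedKernel ψ y x‖ := by
  rw [← RCLike.norm_conj, reducedKernel, reducedKernel, ← integral_conj]
  congr 2
  ext z
  rw [map_mul, Complex.conj_conj, mul_comm]

/-- Up to a constant the squared modulus is a Gaussian in the midpoint times a Gaussian in the
difference, so the double integral factors. -/
theorem norm_sq_stateKer {M : Matrix ι ι ℝ} (K P : Matrix ι ι ℝ) (x y : ι → ℝ) :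
    ‖stateKer M K P x y‖ ^ 2 = (|M.det| * (√Real.pi ^ Fintype.card ι)⁻¹) ^ 2 *
      (Real.exp (-2 * ((x + (1 / 2 : ℝ) • (y - x)) ⬝ᵥ (Mᵀ * M) *ᵥ (x + (1 / 2 : ℝ) • (y - x)))) *
      Real.exp (-(1 / 2) * ((y - x) ⬝ᵥ (P - Kᵀ * (Mᵀ * M) * K) *ᵥ (y - x)))) := by
  have hq : ∀ (A : Matrix ι ι ℝ) (z : ι → ℝ), z ⬝ᵥ (Aᵀ * A) *ᵥ z = (A *ᵥ z) ⬝ᵥ (A *ᵥ z) :=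
    fun A z => by rw [← mulVec_mulVec, dotProduct_mulVec, vecMul_transpose]
  have hK : Kᵀ * (Mᵀ * M) * K = (M * K)ᵀ * (M * K) := by
    rw [transpose_mul]; simp only [Matrix.mul_assoc]
  rw [stateKer, norm_mul, norm_gaussKer, Complex.norm_exp, Complex.ofReal_re, hK, sub_mulVec,
    dotProduct_sub, hq, hq, mul_left_comm, ← Real.exp_add, mul_pow, ← Real.exp_nat_mul,
    ← Real.exp_add, mulVec_mulVec]
  congr 2
  simp only [smul_dotProduct, dotProduct_smul, smul_eq_mul]
  push_cast
  ring

theorem integral_integral_shift {f g : (ι → ℝ) → ℝ} (hf : Integrable f) (hg : Integrable g)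
    (hfc : Continuous f) (hgc : Continuous g) :
    ∫ x : ι → ℝ, ∫ y : ι → ℝ, f (x + (1 / 2 : ℝ) • (y - x)) * g (y - x) =
      (∫ x, f x) * ∫ x, g x := by
  have h1 : ∀ x : ι → ℝ, ∫ y : ι → ℝ, f (x + (1 / 2 : ℝ) • (y - x)) * g (y - x) =
      ∫ v : ι → ℝ, f (x + (1 / 2 : ℝ) • v) * g v := fun x =>
    integral_sub_right_eq_self (fun v => f (x + (1 / 2 : ℝ) • v) * g v) x
  simp only [h1]
  have hint : Integrable (Function.uncurry fun (x v : ι → ℝ) => f (x + (1 / 2 : ℝ) • v) * g v)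
      (volume.prod volume) := by
    rw [integrable_prod_iff']
    · refine ⟨Filter.Eventually.of_forall fun v => ?_, ?_⟩
      · exact (hf.comp_add_right ((1 / 2 : ℝ) • v)).mul_const (g v)
      · have : ∀ v, ∫ x, ‖Function.uncurry (fun (x v : ι → ℝ) => f (x + (1 / 2 : ℝ) • v) * g v)
            (x, v)‖ = (∫ x, ‖f x‖) * ‖g v‖ := fun v => by
          simp only [Function.uncurry_apply_pair, norm_mul]
          rw [integral_mul_const, integral_add_right_eq_self (fun x => ‖f x‖)]
        simp only [this]
        exact hg.norm.const_mul _
    · have : Continuous (Function.uncurry fun (x v : ι → ℝ) => f (x + (1 / 2 : ℝ) • v) * g v) := by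
        unfold Function.uncurry
        fun_prop
      exact this.aestronglyMeasurable
  rw [integral_integral_swap hint, ← integral_const_mul]
  refine integral_congr_ae (Filter.Eventually.of_forall fun v => ?_)
  beta_reduce
  rw [integral_mul_const, integral_add_right_eq_self f]

/-- Purity of the reduced state of a Gaussian state: `1 / √det σ`. -/
theorem HasGaussianChar.reducedPurity_eq {ψ : L2 (ι ⊕ κ)}
    {V : Matrix (Phase (ι ⊕ κ)) (Phase (ι ⊕ κ)) ℝ} (h : HasGaussianChar ψ V 0)
    (hpos : (V.submatrix (Sum.map Sum.inl Sum.inl) (Sum.map Sum.inl Sum.inl) :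
      Matrix (Phase ι) (Phase ι) ℝ).PosDef) :
    reducedPurity ψ = (√(V.submatrix (Sum.map Sum.inl Sum.inl) (Sum.map Sum.inl Sum.inl) :
      Matrix (Phase ι) (Phase ι) ℝ).det)⁻¹ := by
  set σ : Matrix (Phase ι) (Phase ι) ℝ :=
    V.submatrix (Sum.map Sum.inl Sum.inl) (Sum.map Sum.inl Sum.inl) with hσ
  set a := σ.toBlocks₁₁
  set k := σ.toBlocks₁₂
  set p := σ.toBlocks₂₂
  have hσb : σ = fromBlocks a k kᵀ p := by
    have h21 : σ.toBlocks₂₁ = kᵀ := by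
      ext i j
      exact (congrFun (congrFun h.1 (Sum.map Sum.inl Sum.inl (Sum.inr i)))
        (Sum.map Sum.inl Sum.inl (Sum.inl j))).symm
    rw [← h21, fromBlocks_toBlocks]
  have hapos : a.PosDef := hpos.submatrix Sum.inl_injective
  obtain ⟨B, hB, haB⟩ := exists_eq_transpose_mul_self hapos
  have hBT : IsUnit Bᵀ.det := by rwa [det_transpose]
  set M := Bᵀ⁻¹ with hMdef
  have hM : IsUnit M.det := isUnit_nonsing_inv_det _ hBT
  have hMT : Mᵀ = B⁻¹ := by rw [hMdef, transpose_nonsing_inv, transpose_transpose]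
  have haM : M * a * Mᵀ = 1 := by
    rw [haB, nonsing_inv_mul_cancel_left _ _ hBT, hMT, mul_nonsing_inv _ hB]
  have hMM : a * (Mᵀ * M) = 1 := by
    rw [haB, hMT, Matrix.mul_assoc, mul_nonsing_inv_cancel_left _ _ hB, mul_nonsing_inv _ hBT]
  have hMM' : (Mᵀ * M) * a = 1 := mul_eq_one_comm.1 hMM
  have hMMpos : (Mᵀ * M).PosDef := by
    rw [← conjTranspose_eq_transpose_of_trivial]
    exact PosDef.conjTranspose_mul_self _ (mulVec_injective_of_isUnit
      ((Matrix.isUnit_iff_isUnit_det _).2 hM))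
  -- Since MᵀM = a⁻¹, this is the Schur complement of a in σ. It is positive definite as a
  -- compression of σ, and det σ = det a · det N.
  set N := p - kᵀ * (Mᵀ * M) * k with hN
  have hNpos : N.PosDef := by
    have hinj : Function.Injective (fromRows (-(Mᵀ * M * k)) (1 : Matrix ι ι ℝ)).mulVec := by
      intro x y hxy
      have hxy' : fromRows (-(Mᵀ * M * k)) (1 : Matrix ι ι ℝ) *ᵥ x =
        fromRows (-(Mᵀ * M * k)) (1 : Matrix ι ι ℝ) *ᵥ y := hxy
      rw [fromRows_mulVec, fromRows_mulVec, one_mulVec, one_mulVec] at hxy'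
      exact funext fun i => congrFun hxy' (Sum.inr i)
    have := hpos.conjTranspose_mul_mul_same hinj
    have e : σ * fromRows (-(Mᵀ * M * k)) (1 : Matrix ι ι ℝ) = fromRows 0 N := by
      rw [hσb, fromBlocks_mul_fromRows, Matrix.mul_neg, Matrix.mul_neg, ← Matrix.mul_assoc a,
        hMM, Matrix.one_mul, Matrix.mul_one, Matrix.mul_one, neg_add_cancel, ← Matrix.mul_assoc,
        neg_add_eq_sub]
    rwa [Matrix.mul_assoc, e, conjTranspose_fromRows_eq_fromCols_conjTranspose,
      fromCols_mul_fromRows, Matrix.mul_zero, zero_add, conjTranspose_one, Matrix.one_mul] at this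
  have hdet : σ.det = (M.det ^ 2)⁻¹ * N.det := by
    let _ : Invertible a := ⟨Mᵀ * M, hMM', hMM⟩
    have hda : M.det ^ 2 * a.det = 1 := by
      have := congrArg det hMM'
      rw [det_mul, det_mul, det_transpose, det_one] at this
      rw [← this]
      ring
    rw [hσb, det_fromBlocks₁₁, eq_inv_of_mul_eq_one_right hda,
      invOf_eq_right_inv hMM]
  have hker := h.ae_reducedKernel (hσ.symm.trans hσb) hM haM
  have hpur : reducedPurity ψ = ∫ x : ι → ℝ, ∫ y : ι → ℝ, ‖stateKer M k p x y‖ ^ 2 := by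
    refine integral_congr_ae ?_
    filter_upwards [hker] with x hx
    refine integral_congr_ae ?_
    filter_upwards [hx] with y hy
    rw [norm_reducedKernel_comm, hy]
  have hq : ∀ (c : ℝ) (A : Matrix ι ι ℝ), Continuous fun x : ι → ℝ =>
      Real.exp (-c * (x ⬝ᵥ A *ᵥ x)) := fun c A => by
    have := continuous_quadratic A
    fun_prop
  rw [hpur]
  simp only [norm_sq_stateKer, integral_const_mul]
  rw [integral_integral_shift (f := fun x => Real.exp (-2 * (x ⬝ᵥ (Mᵀ * M) *ᵥ x)))
    (g := fun v => Real.exp (-(1 / 2) * (v ⬝ᵥ N *ᵥ v)))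
    (integrable_exp_neg_mul_quadratic two_pos hMMpos)
    (integrable_exp_neg_mul_quadratic (by norm_num) hNpos) (hq _ _) (hq _ _),
    integral_exp_neg_mul_quadratic hMMpos, integral_exp_neg_mul_quadratic hNpos, hdet]
  have hNd : 0 < √N.det := Real.sqrt_pos.2 hNpos.det_pos
  have hMd : 0 < |M.det| := abs_pos.2 hM.ne_zero
  have hpi := Real.sqrt_pos.2 Real.pi_pos
  have e1 : √(Mᵀ * M).det = |M.det| := by
    rw [det_mul, det_transpose, ← sq, Real.sqrt_sq_eq_abs]
  have e2 : √((M.det ^ 2)⁻¹ * N.det) = |M.det|⁻¹ * √N.det := by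
    rw [Real.sqrt_mul (by positivity), Real.sqrt_inv, Real.sqrt_sq_eq_abs]
  -- The widths 2 and 1/2 compensate, (π/2)(2π) = π², so the powers of π cancel against the
  -- normalization.
  have e3 : √(Real.pi / 2) ^ Fintype.card ι * √(Real.pi / (1 / 2)) ^ Fintype.card ι =
      (√Real.pi ^ Fintype.card ι) ^ 2 := by
    rw [← mul_pow, ← Real.sqrt_mul (by positivity), ← pow_mul, mul_comm (Fintype.card ι), pow_mul,
      Real.sq_sqrt Real.pi_pos.le]
    congr 1
    rw [show Real.pi / 2 * (Real.pi / (1 / 2)) = Real.pi ^ 2 by ring, Real.sqrt_sq Real.pi_pos.le]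
  rw [e1, e2, div_mul_div_comm, e3]
  field_simp

/-! ### Uncertainty principle and global minimum. -/

theorem HasGaussianChar.posDef {ψ : L2 ι} {V : Matrix (Phase ι) (Phase ι) ℝ}
    (h : HasGaussianChar ψ V 0) : V.PosDef := by
  obtain ⟨S, hS, rfl⟩ := h.exists_eq_mul_transpose
  rw [← conjTranspose_eq_transpose_of_trivial]
  exact PosDef.mul_conjTranspose_self _ (vecMul_injective_of_isUnit
    ((Matrix.isUnit_iff_isUnit_det _).2 (isUnit_det_of_mem_symplecticGroup hS)))

theorem HasGaussianChar.mem_symplecticGroup {ψ : L2 ι} {V : Matrix (Phase ι) (Phase ι) ℝ}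
    (h : HasGaussianChar ψ V 0) : V ∈ symplecticGroup ι ℝ := by
  obtain ⟨S, hS, rfl⟩ := h.exists_eq_mul_transpose
  exact mul_mem hS (SymplecticGroup.transpose_mem hS)

theorem HasGaussianChar.posDef_left {ψ : L2 (ι ⊕ κ)}
    {V : Matrix (Phase (ι ⊕ κ)) (Phase (ι ⊕ κ)) ℝ} (h : HasGaussianChar ψ V 0) :
    (V.submatrix (Sum.map Sum.inl Sum.inl) (Sum.map Sum.inl Sum.inl) :
      Matrix (Phase ι) (Phase ι) ℝ).PosDef :=
  h.posDef.submatrix (Sum.inl_injective.sumMap Sum.inl_injective)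

theorem HasGaussianChar.posDef_right {ψ : L2 (ι ⊕ κ)}
    {V : Matrix (Phase (ι ⊕ κ)) (Phase (ι ⊕ κ)) ℝ} (h : HasGaussianChar ψ V 0) :
    (V.submatrix (Sum.map Sum.inr Sum.inr) (Sum.map Sum.inr Sum.inr) :
      Matrix (Phase κ) (Phase κ) ℝ).PosDef :=
  h.posDef.submatrix (Sum.inr_injective.sumMap Sum.inr_injective)

/-- The uncertainty principle: symplectic eigenvalues of a reduced state are at least one. -/
theorem HasGaussianChar.one_le_spectrum {ψ : L2 (ι ⊕ κ)}
    {V : Matrix (Phase (ι ⊕ κ)) (Phase (ι ⊕ κ)) ℝ} (h : HasGaussianChar ψ V 0) {ν : ι → ℝ}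
    (hν : IsSymplecticSpectrum
      (V.submatrix (Sum.map Sum.inl Sum.inl) (Sum.map Sum.inl Sum.inl)) ν) (j : ι) : 1 ≤ ν j := by
  obtain ⟨S, hS, rfl⟩ := h.exists_eq_mul_transpose
  obtain ⟨-, T, hT, hν⟩ := hν
  set e : Phase ι → Phase (ι ⊕ κ) := Sum.map Sum.inl Sum.inl
  have hJ : (J (ι ⊕ κ) ℝ).submatrix e e = J ι ℝ := by
    ext a b
    rcases a with a | a <;> rcases b with b | b <;> simp [J, e, Matrix.one_apply]
  -- The rows of S belonging to the first part are still symplectically normalized, and so are those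
  -- of T A; their Gram matrix is the Williamson form, so the bound for conjugate rows reads 2 ≤ 2
  -- ν_j.
  set A := S.submatrix e id
  have hA : A * J (ι ⊕ κ) ℝ * Aᵀ = J ι ℝ := by
    have := congrArg (fun M => M.submatrix e e) (SymplecticGroup.mem_iff.1 hS)
    simp only [hJ, submatrix_mul _ _ e id e Function.bijective_id] at this
    rw [submatrix_mul _ _ e id id Function.bijective_id, submatrix_id_id] at this
    exact this
  have hAA : (S * Sᵀ).submatrix e e = A * Aᵀ := submatrix_mul _ _ e id e Function.bijective_id
  have hR : (T * A) * J (ι ⊕ κ) ℝ * (T * A)ᵀ = J ι ℝ := by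
    rw [transpose_mul, ← SymplecticGroup.mem_iff.1 hT]
    conv_rhs => rw [← hA]
    simp only [Matrix.mul_assoc]
  have h2 := two_le_gram_of_symplectic_rows (T * A) hR j
  have h3 : (T * A) * (T * A)ᵀ = fromBlocks (diagonal ν) 0 0 (diagonal ν) := by
    rw [← hν, hAA, transpose_mul]
    simp only [Matrix.mul_assoc]
  rw [h3, fromBlocks_apply₁₁, fromBlocks_apply₂₂, diagonal_apply_eq] at h2
  linarith

theorem HasGaussianChar.energy_ne_top {φ : L2 ι} {M : Matrix (Phase ι) (Phase ι) ℝ}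
    {d : Phase ι → ℝ} (h : HasGaussianChar φ M d) : energy φ ≠ ⊤ := by
  rw [h.energy_eq]
  exact ENNReal.ofReal_ne_top

/-- The new covariance matrix is (TS)(TS)ᵀ, whose trace is at least twice the number of modes, and
the displacement contributes a nonnegative term. -/
theorem HasGaussianChar.le_energy_of_isGaussianUnitary {ψ : L2 ι}
    {V : Matrix (Phase ι) (Phase ι) ℝ} (h : HasGaussianChar ψ V 0) {U : L2 ι ≃ₗᵢ[ℂ] L2 ι}
    (hU : IsGaussianUnitary U) : ENNReal.ofReal (Fintype.card ι / 2) ≤ energy (U ψ) := by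
  obtain ⟨T, hT, d, hU⟩ := hU
  obtain ⟨S, hS, rfl⟩ := h.exists_eq_mul_transpose
  rw [(h.map hU).energy_eq]
  have h1 := trace_doubled_diagonal_ge (mul_mem hT hS) (ν := fun _ => 1) fun _ => zero_le_one
  rw [diagonal_one, fromBlocks_one, Matrix.mul_one, transpose_mul, Matrix.mul_assoc,
    ← Matrix.mul_assoc S, ← Matrix.mul_assoc T] at h1
  simp only [Finset.sum_const, Finset.card_univ, nsmul_eq_mul, mul_one] at h1
  have h2 : 0 ≤ d ⬝ᵥ d := Finset.sum_nonneg fun _ _ => mul_self_nonneg _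
  exact ENNReal.ofReal_le_ofReal (by linarith)

theorem HasGaussianChar.exists_isGaussianUnitary_energy_eq {ψ : L2 ι}
    {V : Matrix (Phase ι) (Phase ι) ℝ} (h : HasGaussianChar ψ V 0) :
    ∃ U, IsGaussianUnitary U ∧ energy (U ψ) = ENNReal.ofReal (Fintype.card ι / 2) := by
  obtain ⟨L, C, hL, hC, h1⟩ := h.exists_triMat_conj_eq_one
  refine ⟨triUnitary hL C, isGaussianUnitary_triUnitary hL hC, ?_⟩
  rw [(h.map_triUnitary hL hC).energy_eq, h1, trace_one, Fintype.card_sum, dotProduct_zero]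
  congr 1
  push_cast
  ring

theorem HasGaussianChar.globalMin_eq {ψ : L2 ι} {V : Matrix (Phase ι) (Phase ι) ℝ}
    (h : HasGaussianChar ψ V 0) : globalMin ψ = ENNReal.ofReal (Fintype.card ι / 2) := by
  obtain ⟨U, hU, hE⟩ := h.exists_isGaussianUnitary_energy_eq
  exact le_antisymm (hE ▸ iInf₂_le U hU) (le_iInf₂ fun _ hU => h.le_energy_of_isGaussianUnitary hU)

/-! ### Local minimum, entropy and the product case. -/

section Local

variable {ψ : L2 (ι ⊕ κ)} {V : Matrix (Phase (ι ⊕ κ)) (Phase (ι ⊕ κ)) ℝ} {ν : ι → ℝ} {μ : κ → ℝ}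

theorem HasGaussianChar.le_energy_of_isLocalGaussianUnitary (h : HasGaussianChar ψ V 0)
    (hν : IsSymplecticSpectrum
      (V.submatrix (Sum.map Sum.inl Sum.inl) (Sum.map Sum.inl Sum.inl)) ν)
    (hμ : IsSymplecticSpectrum
      (V.submatrix (Sum.map Sum.inr Sum.inr) (Sum.map Sum.inr Sum.inr)) μ)
    {U : L2 (ι ⊕ κ) ≃ₗᵢ[ℂ] L2 (ι ⊕ κ)} (hU : IsLocalGaussianUnitary U) :
    ENNReal.ofReal ((∑ j, ν j + ∑ j, μ j) / 2) ≤ energy (U ψ) := by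
  obtain ⟨S, hS, T, hT, d, hU⟩ := hU.exists_dirSum
  rw [(h.map hU).energy_eq, trace_dirSum_conj S T h.1]
  have h1 := hν.trace_ge hS
  have h2 := hμ.trace_ge hT
  have h3 : 0 ≤ d ⬝ᵥ d := Finset.sum_nonneg fun _ _ => mul_self_nonneg _
  exact ENNReal.ofReal_le_ofReal (by linarith)

/-- Local symplectic matrices bringing the trace of the covariance matrix to its minimum. -/
theorem HasGaussianChar.exists_local_trace_eq (h : HasGaussianChar ψ V 0)
    (hν : IsSymplecticSpectrum
      (V.submatrix (Sum.map Sum.inl Sum.inl) (Sum.map Sum.inl Sum.inl)) ν)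
    (hμ : IsSymplecticSpectrum
      (V.submatrix (Sum.map Sum.inr Sum.inr) (Sum.map Sum.inr Sum.inr)) μ) :
    ∃ (L C : Matrix ι ι ℝ) (L' C' : Matrix κ κ ℝ), IsUnit L.det ∧ Cᵀ = C ∧ IsUnit L'.det ∧
      C'ᵀ = C' ∧ (fromBlocks C 0 0 C')ᵀ = fromBlocks C 0 0 C' ∧
      (triMat (fromBlocks L 0 0 L') (fromBlocks C 0 0 C') * V *
        (triMat (fromBlocks L 0 0 L') (fromBlocks C 0 0 C'))ᵀ).trace =
        2 * (∑ j, ν j + ∑ j, μ j) := by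
  obtain ⟨L, C, hL, hC, h1⟩ := hν.exists_triMat_trace_eq
  obtain ⟨L', C', hL', hC', h2⟩ := hμ.exists_triMat_trace_eq
  refine ⟨L, C, L', C', hL, hC, hL', hC', ?_, ?_⟩
  · rw [fromBlocks_transpose, hC, hC', transpose_zero, transpose_zero]
  · rw [triMat_fromBlocks hL hL', trace_dirSum_conj _ _ h.1, h1, h2, mul_add]

theorem HasGaussianChar.exists_isLocalGaussianUnitary_energy_eq (h : HasGaussianChar ψ V 0)
    (hν : IsSymplecticSpectrum
      (V.submatrix (Sum.map Sum.inl Sum.inl) (Sum.map Sum.inl Sum.inl)) ν)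
    (hμ : IsSymplecticSpectrum
      (V.submatrix (Sum.map Sum.inr Sum.inr) (Sum.map Sum.inr Sum.inr)) μ) :
    ∃ U, IsLocalGaussianUnitary U ∧
      energy (U ψ) = ENNReal.ofReal ((∑ j, ν j + ∑ j, μ j) / 2) := by
  obtain ⟨L, C, L', C', hL, hC, hL', hC', hCC, htr⟩ := h.exists_local_trace_eq hν hμ
  refine ⟨_, isLocalGaussianUnitary_triUnitary hL hL' hC hC', ?_⟩
  rw [(h.map_triUnitary (isUnit_det_fromBlocks hL hL') hCC).energy_eq, htr, dotProduct_zero]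
  congr 1
  ring

theorem HasGaussianChar.localMin_eq (h : HasGaussianChar ψ V 0)
    (hν : IsSymplecticSpectrum
      (V.submatrix (Sum.map Sum.inl Sum.inl) (Sum.map Sum.inl Sum.inl)) ν)
    (hμ : IsSymplecticSpectrum
      (V.submatrix (Sum.map Sum.inr Sum.inr) (Sum.map Sum.inr Sum.inr)) μ) :
    localMin ψ = ENNReal.ofReal ((∑ j, ν j + ∑ j, μ j) / 2) := by
  obtain ⟨U, hU, hE⟩ := h.exists_isLocalGaussianUnitary_energy_eq hν hμ
  exact le_antisymm (hE ▸ iInf₂_le U hU)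
    (le_iInf₂ fun _ hU => h.le_energy_of_isLocalGaussianUnitary hν hμ hU)

/-- The initial energy cancels, leaving the difference of the two minima (∑ ν + ∑ μ)/2 − N/2; the
relation between the two spectra removes μ. -/
theorem HasGaussianChar.ergotropicGap_eq (h : HasGaussianChar ψ V 0)
    (hν : IsSymplecticSpectrum
      (V.submatrix (Sum.map Sum.inl Sum.inl) (Sum.map Sum.inl Sum.inl)) ν)
    (hμ : IsSymplecticSpectrum
      (V.submatrix (Sum.map Sum.inr Sum.inr) (Sum.map Sum.inr Sum.inr)) μ) :
    ergotropicGap ψ = ∑ j, (ν j - 1) := by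
  have hs := sum_spectrum_sub_one_eq h.1 h.mem_symplecticGroup hν hμ
  have h1 : 0 ≤ ∑ j, ν j + ∑ j, μ j :=
    add_nonneg (Finset.sum_nonneg fun j _ => (hν.1 j).le) (Finset.sum_nonneg fun j _ => (hμ.1 j).le)
  rw [ergotropicGap, globalErgotropy, localErgotropy, h.globalMin_eq, h.localMin_eq hν hμ,
    ENNReal.toReal_ofReal (by positivity), ENNReal.toReal_ofReal (by linarith), Fintype.card_sum]
  simp only [Finset.sum_sub_distrib, Finset.sum_const, Finset.card_univ, nsmul_eq_mul,
    mul_one] at hs ⊢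
  push_cast
  linarith

theorem HasGaussianChar.reducedPurity_eq_prod (h : HasGaussianChar ψ V 0)
    (hν : IsSymplecticSpectrum
      (V.submatrix (Sum.map Sum.inl Sum.inl) (Sum.map Sum.inl Sum.inl)) ν) :
    reducedPurity ψ = (∏ j, ν j)⁻¹ := by
  rw [h.reducedPurity_eq h.posDef_left, hν.det_eq,
    Real.sqrt_sq (Finset.prod_nonneg fun j _ => (hν.1 j).le)]

theorem HasGaussianChar.renyiTwo_eq (h : HasGaussianChar ψ V 0)
    (hν : IsSymplecticSpectrum
      (V.submatrix (Sum.map Sum.inl Sum.inl) (Sum.map Sum.inl Sum.inl)) ν) :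
    renyiTwo ψ = ∑ j, Real.log (ν j) := by
  rw [renyiTwo, h.reducedPurity_eq_prod hν, Real.log_inv, neg_neg,
    Real.log_prod fun j _ => (hν.1 j).ne']

/-- The reduced kernel of f ⊗ g is ‖g‖² f(x) conj f(x'). -/
theorem IsTensor.reducedPurity_eq {f : L2 ι} {g : L2 κ} (H : IsTensor ψ f g) :
    reducedPurity ψ = (‖f‖ ^ 2 * ‖g‖ ^ 2) ^ 2 := by
  have hk := ae_ae_elim H
  simp only [Sum.elim_comp_inl, Sum.elim_comp_inr] at hk
  have hker : ∀ᵐ x, ∀ᵐ x', ‖reducedKernel ψ x x'‖ ^ 2 =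
      ‖f x‖ ^ 2 * ‖f x'‖ ^ 2 * (‖g‖ ^ 2) ^ 2 := by
    filter_upwards [hk] with x hx
    filter_upwards [hk] with x' hx'
    have : reducedKernel ψ x x' = f x * (starRingEnd ℂ) (f x') * ((‖g‖ ^ 2 : ℝ) : ℂ) := by
      rw [norm_sq_eq_integral, ← integral_complex_ofReal, ← integral_const_mul]
      refine integral_congr_ae ?_
      filter_upwards [hx, hx'] with y hy hy'
      rw [hy, hy', map_mul, Complex.ofReal_pow, ← Complex.mul_conj']
      ring
    rw [this, norm_mul, norm_mul, RCLike.norm_conj, Complex.norm_real, Real.norm_eq_abs, abs_sq,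
      mul_pow, mul_pow]
  calc reducedPurity ψ = ∫ x, ∫ x', ‖f x‖ ^ 2 * ‖f x'‖ ^ 2 * (‖g‖ ^ 2) ^ 2 := by
        refine integral_congr_ae ?_
        filter_upwards [hker] with x hx
        exact integral_congr_ae hx
    _ = (‖f‖ ^ 2 * ‖g‖ ^ 2) ^ 2 := by
        simp only [integral_mul_const, integral_const_mul, ← norm_sq_eq_integral]
        ring

theorem IsTensor.norm_sq_eq {f : L2 ι} {g : L2 κ} (H : IsTensor ψ f g) :
    ‖ψ‖ ^ 2 = ‖f‖ ^ 2 * ‖g‖ ^ 2 := by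
  have hk : (fun z => ‖ψ z‖ ^ 2) =ᵐ[volume]
      fun z => ‖f (z ∘ Sum.inl)‖ ^ 2 * ‖g (z ∘ Sum.inr)‖ ^ 2 := by
    filter_upwards [H] with z hz
    rw [hz, norm_mul, mul_pow]
  rw [norm_sq_eq_integral, integral_congr_ae hk, integral_sum_eq, norm_sq_eq_integral f,
    norm_sq_eq_integral g]
  exact integral_prod_mul (fun x => ‖f x‖ ^ 2) (fun y => ‖g y‖ ^ 2)

/-- A product unit vector has purity 1, so the nonnegative numbers log ν_j sum to zero. -/
theorem HasGaussianChar.spectrum_eq_one_of_isProduct (h : HasGaussianChar ψ V 0)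
    (hν : IsSymplecticSpectrum
      (V.submatrix (Sum.map Sum.inl Sum.inl) (Sum.map Sum.inl Sum.inl)) ν)
    (hψ : IsProduct ψ) (j : ι) : ν j = 1 := by
  obtain ⟨f, g, H⟩ := hψ
  have hr := h.renyiTwo_eq hν
  rw [renyiTwo, H.reducedPurity_eq, ← H.norm_sq_eq, (isPureGaussian_iff.2 ⟨V, h⟩).1, one_pow,
    one_pow, Real.log_one, neg_zero, eq_comm, Finset.sum_eq_zero_iff_of_nonneg
      fun i _ => Real.log_nonneg (h.one_le_spectrum hν i)] at hr
  exact Real.eq_one_of_pos_of_log_eq_zero (hν.1 j) (hr j (Finset.mem_univ j))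

theorem HasGaussianChar.isProduct_of_spectrum_eq_one (h : HasGaussianChar ψ V 0)
    (hν : IsSymplecticSpectrum
      (V.submatrix (Sum.map Sum.inl Sum.inl) (Sum.map Sum.inl Sum.inl)) ν)
    (hμ : IsSymplecticSpectrum
      (V.submatrix (Sum.map Sum.inr Sum.inr) (Sum.map Sum.inr Sum.inr)) μ)
    (h1 : ∀ j, ν j = 1) : IsProduct ψ := by
  obtain ⟨L, C, L', C', hL, hC, hL', hC', hCC, htr⟩ := h.exists_local_trace_eq hν hμ
  have hu := isUnit_det_fromBlocks hL hL'
  have hs := sum_spectrum_sub_one_eq h.1 h.mem_symplecticGroup hν hμ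
  have hU := h.map_triUnitary hu hCC
  obtain ⟨S, hS, hSV⟩ := hU.exists_eq_mul_transpose
  -- When all ν_j are 1 the other spectrum sums to its number of modes, so the local minimizer
  -- reaches the least trace possible for S Sᵀ and its covariance matrix is 1.
  have hone : S * Sᵀ = 1 := by
    apply mul_transpose_eq_one_of_trace_eq hS
    rw [← hSV, htr]
    simp only [h1, Finset.sum_sub_distrib, Finset.sum_const, Finset.card_univ, nsmul_eq_mul,
      mul_one, sub_self] at hs ⊢
    rw [Fintype.card_sum]
    push_cast
    linarith
  rw [hSV, hone] at hU
  obtain ⟨c, hc⟩ := hU.eq_smul_vac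
  set f := (triUnitary hL C).symm (vac ι) with hf
  set g := (triUnitary hL' C').symm (vac κ) with hg
  have ht := isTensor_tensor f g
  have ht' := ht.triUnitary (C := C) (C' := C') hL hL'
  rw [hf, hg, LinearIsometryEquiv.apply_symm_apply, LinearIsometryEquiv.apply_symm_apply] at ht'
  have hv := ht'.eq isTensor_vac
  have hψ : ψ = (c * 1) • tensor f g := by
    apply (triUnitary hu (fromBlocks C 0 0 C')).injective
    rw [hc, map_smul, mul_one, ← hv]
  exact ⟨c • f, (1 : ℂ) • g, hψ ▸ ht.smul c 1⟩

end Local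

/-! ### The scalar inequality and states with prescribed spectrum. -/

theorem sum_log_le_sum_sub_one {ν : ι → ℝ} (hν : ∀ j, 0 < ν j) :
    ∑ j, Real.log (ν j) ≤ ∑ j, (ν j - 1) :=
  Finset.sum_le_sum fun j _ => Real.log_le_sub_one_of_pos (hν j)

theorem sum_log_eq_sum_sub_one_iff {ν : ι → ℝ} (hν : ∀ j, 0 < ν j) :
    ∑ j, Real.log (ν j) = ∑ j, (ν j - 1) ↔ ∀ j, ν j = 1 := by
  rw [Finset.sum_eq_sum_iff_of_le fun j _ => Real.log_le_sub_one_of_pos (hν j)]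
  refine ⟨fun h j => ?_, fun h j _ => by simp [h j]⟩
  by_contra hne
  exact (Real.log_lt_sub_one_of_pos (hν j) hne).ne (h j (Finset.mem_univ j))

/-- The position matrix of a two-mode squeezer between the modes paired by `X`, with `D = cosh r`
and `E = sinh r`. -/
noncomputable def squeezer (D E : Matrix ι ι ℝ) (X : Matrix ι κ ℝ) : Matrix (ι ⊕ κ) (ι ⊕ κ) ℝ :=
  fromBlocks D (E * X) (Xᵀ * E) (1 + Xᵀ * (D - 1) * X)

/-- Reversing the sign of the squeezing parameter inverts the squeezer, by cosh² − sinh² = 1. The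
term 1 − XᵀX in the lower block keeps the unpaired modes fixed. -/
theorem squeezer_mul_squeezer_neg {D E : Matrix ι ι ℝ} {X : Matrix ι κ ℝ} (hX : X * Xᵀ = 1)
    (hDE : D * E = E * D) (hD : D * D = 1 + E * E) : squeezer D E X * squeezer D (-E) X = 1 := by
  have hX' : ∀ {n : Type} (Z : Matrix ι n ℝ), X * (Xᵀ * Z) = Z := fun Z => by
    rw [← Matrix.mul_assoc, hX, Matrix.one_mul]
  have hDX : ∀ {n : Type} (Z : Matrix ι n ℝ), D * (D * Z) = Z + E * (E * Z) := fun Z => by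
    rw [← Matrix.mul_assoc, hD, Matrix.add_mul, Matrix.one_mul, Matrix.mul_assoc]
  have hDEX : ∀ {n : Type} (Z : Matrix ι n ℝ), D * (E * Z) = E * (D * Z) := fun Z => by
    rw [← Matrix.mul_assoc, hDE, Matrix.mul_assoc]
  rw [squeezer, squeezer, fromBlocks_multiply, ← fromBlocks_one]
  simp only [Matrix.mul_assoc, Matrix.mul_add, Matrix.add_mul, Matrix.sub_mul, Matrix.mul_sub,
    Matrix.neg_mul, Matrix.mul_neg, Matrix.one_mul, Matrix.mul_one, hX', hDX, hDEX, hDE, hD]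
  congr 1 <;> abel

/-- Every `ν ≥ 1` is the local symplectic spectrum of a pure Gaussian state, as soon as the modes
`ι` embed isometrically into the modes `κ`. -/
theorem exists_hasGaussianChar_spectrum {X : Matrix ι κ ℝ} (hX : X * Xᵀ = 1) {ν : ι → ℝ}
    (hν : ∀ j, 1 ≤ ν j) :
    ∃ (ψ : L2 (ι ⊕ κ)) (V : Matrix (Phase (ι ⊕ κ)) (Phase (ι ⊕ κ)) ℝ), HasGaussianChar ψ V 0 ∧
      IsSymplecticSpectrum
        (V.submatrix (Sum.map Sum.inl Sum.inl) (Sum.map Sum.inl Sum.inl)) ν := by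
  -- These are cosh r_j and sinh r_j for cosh 2r_j = ν_j, so that D² + E² is the diagonal matrix of
  -- the ν_j.
  set D : Matrix ι ι ℝ := diagonal fun j => √((ν j + 1) / 2) with hD
  set E : Matrix ι ι ℝ := diagonal fun j => √((ν j - 1) / 2) with hE
  have hDD : D * D = diagonal fun j => (ν j + 1) / 2 := by
    rw [hD, diagonal_mul_diagonal]
    congr 1
    ext j
    exact Real.mul_self_sqrt (by linarith [hν j])
  have hEE : E * E = diagonal fun j => (ν j - 1) / 2 := by
    rw [hE, diagonal_mul_diagonal]
    congr 1
    ext j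
    exact Real.mul_self_sqrt (by linarith [hν j])
  have hDE : D * E = E * D := by
    rw [hD, hE, diagonal_mul_diagonal, diagonal_mul_diagonal]
    simp only [mul_comm]
  have hsq : D * D = 1 + E * E := by
    rw [hDD, hEE, ← diagonal_one, diagonal_add]
    congr 1
    ext j
    ring
  have hsum : D * D + E * E = diagonal ν := by
    rw [hDD, hEE, diagonal_add]
    congr 1
    ext j
    ring
  have hDT : Dᵀ = D := diagonal_transpose _
  have hET : Eᵀ = E := diagonal_transpose _
  set L := squeezer D (-E) X with hLdef
  have hinv : squeezer D E X * L = 1 := squeezer_mul_squeezer_neg hX hDE hsq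
  have hinv' : L * squeezer D E X = 1 := mul_eq_one_comm.1 hinv
  have hL : IsUnit L.det := isUnit_det_of_left_inverse hinv
  have hgram : ∀ F : Matrix ι ι ℝ, Fᵀ = F → F * F = E * E →
      (squeezer D F X * (squeezer D F X)ᵀ).toBlocks₁₁ = diagonal ν ∧
      ((squeezer D F X)ᵀ * squeezer D F X).toBlocks₁₁ = diagonal ν := fun F hF hFE => by
    rw [squeezer, fromBlocks_transpose, fromBlocks_multiply, fromBlocks_multiply,
      toBlocks_fromBlocks₁₁, toBlocks_fromBlocks₁₁, transpose_mul, transpose_mul, hDT, hF,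
      transpose_transpose, Matrix.mul_assoc, ← Matrix.mul_assoc X, hX, Matrix.one_mul, hFE, hsum]
    exact ⟨rfl, rfl⟩
  refine ⟨_, _, hasGaussianChar_vac.map_triUnitary hL transpose_zero, ?_⟩
  refine ⟨fun j => zero_lt_one.trans_le (hν j), 1, one_mem _, ?_⟩
  rw [Matrix.one_mul, transpose_one, Matrix.mul_one, Matrix.mul_one, triMat,
    inv_eq_right_inv hinv', Matrix.zero_mul, fromBlocks_transpose, fromBlocks_multiply,
    ← (hgram E hET rfl).1]
  -- The position and momentum covariances are L⁻¹L⁻ᵀ and LᵀL. They squeeze oppositely, but their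
  -- first blocks involve only E², so the reduced covariance is already in Williamson form.
  have h22 : (Lᵀ * L).toBlocks₁₁ = (squeezer D E X * (squeezer D E X)ᵀ).toBlocks₁₁ := by
    rw [(hgram E hET rfl).1, (hgram (-E) (by rw [transpose_neg, hET]) (neg_mul_neg _ _)).2]
  ext a b
  rcases a with a | a <;> rcases b with b | b
  · simp [toBlocks₁₁]
  · simp
  · simp
  · have := congrFun (congrFun h22 a) b
    simpa [toBlocks₁₁] using this

theorem IsPureGaussian.exists_hasGaussianChar_reducedCov {ψ : L2 (ι ⊕ κ)} (h : IsPureGaussian ψ) :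
    ∃ V, HasGaussianChar ψ V 0 ∧
      reducedCov ψ = V.submatrix (Sum.map Sum.inl Sum.inl) (Sum.map Sum.inl Sum.inl) := by
  obtain ⟨V, hV⟩ := isPureGaussian_iff.1 h
  exact ⟨V, hV, by rw [reducedCov, hV.covMatrix_eq]⟩

theorem exists_isPureGaussian_renyiTwo_ergotropicGap {m₁ m₂ : ℕ} (h : m₁ ≤ m₂) {ν : Fin m₁ → ℝ}
    (hν : ∀ j, 1 ≤ ν j) : ∃ ψ : L2 (Fin m₁ ⊕ Fin m₂), IsPureGaussian ψ ∧
      renyiTwo ψ = ∑ j, Real.log (ν j) ∧ ergotropicGap ψ = ∑ j, (ν j - 1) := by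
  have hX : (Matrix.of fun (i : Fin m₁) (j : Fin m₂) => if Fin.castLE h i = j then (1 : ℝ) else 0) *
      (Matrix.of fun (i : Fin m₁) (j : Fin m₂) => if Fin.castLE h i = j then (1 : ℝ) else 0)ᵀ =
        1 := by
    ext i j
    simp [Matrix.mul_apply, Matrix.one_apply, eq_comm]
  obtain ⟨ψ, V, hψ, hs⟩ := exists_hasGaussianChar_spectrum hX hν
  obtain ⟨μ, hμ⟩ := exists_isSymplecticSpectrum hψ.posDef_right
  exact ⟨ψ, isPureGaussian_iff.2 ⟨V, hψ⟩, hψ.renyiTwo_eq hs, hψ.ergotropicGap_eq hs hμ⟩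

theorem exists_isPureGaussian_two_squeezed {m₁ m₂ : ℕ} (h : m₁ ≤ m₂) (h2 : 2 ≤ m₁) {C : ℝ}
    (hC : 1 ≤ C) : ∃ ψ : L2 (Fin m₁ ⊕ Fin m₂), IsPureGaussian ψ ∧ renyiTwo ψ = Real.log C ∧
      ergotropicGap ψ = 2 * (√C - 1) := by
  obtain ⟨n, rfl⟩ := Nat.exists_eq_add_of_le' h2
  have hs : 1 ≤ √C := Real.one_le_sqrt.2 hC
  obtain ⟨ψ, h1, h3, h4⟩ := exists_isPureGaussian_renyiTwo_ergotropicGap h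
    -- Two equal eigenvalues with product C, the remaining modes being unentangled.
    (ν := Fin.cons √C (Fin.cons √C fun _ => 1)) fun j => by
      refine Fin.cases hs (fun j => ?_) j
      exact Fin.cases hs (fun _ => le_rfl) j
  refine ⟨ψ, h1, ?_, ?_⟩
  · rw [h3, Fin.sum_univ_succ, Fin.sum_univ_succ]
    simp only [Fin.cons_zero, Fin.cons_succ, Real.log_one, Finset.sum_const_zero, add_zero]
    rw [Real.log_sqrt (by linarith)]
    ring
  · rw [h4, Fin.sum_univ_succ, Fin.sum_univ_succ]
    simp only [Fin.cons_zero, Fin.cons_succ, sub_self, Finset.sum_const_zero, add_zero]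
    ring

theorem exists_isPureGaussian_one_squeezed {m₁ m₂ : ℕ} (h : m₁ ≤ m₂) (h1 : 1 ≤ m₁) {C : ℝ}
    (hC : 1 ≤ C) : ∃ ψ : L2 (Fin m₁ ⊕ Fin m₂), IsPureGaussian ψ ∧ renyiTwo ψ = Real.log C ∧
      ergotropicGap ψ = C - 1 := by
  obtain ⟨n, rfl⟩ := Nat.exists_eq_add_of_le' h1
  obtain ⟨ψ, h1, h3, h4⟩ := exists_isPureGaussian_renyiTwo_ergotropicGap h
    (ν := Fin.cons C fun _ => 1) fun j => Fin.cases hC (fun _ => le_rfl) j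
  refine ⟨ψ, h1, ?_, ?_⟩
  · rw [h3, Fin.sum_univ_succ]
    simp
  · rw [h4, Fin.sum_univ_succ]
    simp

end GaussianErgotropy

/-! ### The main theorem. -/

theorem mainTheorem3 (m₁ m₂ : ℕ) (h₁ : 1 ≤ m₁) (h₁₂ : m₁ ≤ m₂) :
    (∀ ψ : L2 (Fin m₁ ⊕ Fin m₂), IsPureGaussian ψ →
      -- the energies are finite and the minima in the ergotropies are attained
      (energy ψ ≠ ⊤ ∧
        (∃ U, IsGaussianUnitary U ∧ energy (U ψ) = globalMin ψ) ∧
        (∃ U, IsLocalGaussianUnitary U ∧ energy (U ψ) = localMin ψ)) ∧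
      -- both quantities in terms of the symplectic eigenvalues of the first subsystem
      (∃ ν : Fin m₁ → ℝ, IsSymplecticSpectrum (reducedCov ψ) ν ∧ (∀ j, 1 ≤ ν j) ∧
        renyiTwo ψ = ∑ j, Real.log (ν j) ∧ ergotropicGap ψ = ∑ j, (ν j - 1)) ∧
      renyiTwo ψ ≤ ergotropicGap ψ ∧
      (renyiTwo ψ = ergotropicGap ψ ↔ IsProduct ψ)) ∧
    -- functional independence
    (2 ≤ m₁ →
      (∀ C : ℝ, 1 < C → ∃ ψ φ : L2 (Fin m₁ ⊕ Fin m₂), IsPureGaussian ψ ∧ IsPureGaussian φ ∧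
        renyiTwo ψ = Real.log C ∧ renyiTwo φ = Real.log C ∧
        ergotropicGap ψ = 2 * (√C - 1) ∧ ergotropicGap φ = C - 1 ∧
        ergotropicGap ψ ≠ ergotropicGap φ) ∧
      (¬ ∃ F : ℝ → ℝ, ∀ ψ : L2 (Fin m₁ ⊕ Fin m₂), IsPureGaussian ψ →
        ergotropicGap ψ = F (renyiTwo ψ)) ∧
      (¬ ∃ G : ℝ → ℝ, ∀ ψ : L2 (Fin m₁ ⊕ Fin m₂), IsPureGaussian ψ →
        renyiTwo ψ = G (ergotropicGap ψ))) := by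
  refine ⟨fun ψ hψ => ?_, fun h₂ => ?_⟩
  · obtain ⟨V, hV, hcov⟩ := hψ.exists_hasGaussianChar_reducedCov
    obtain ⟨ν, hν⟩ := exists_isSymplecticSpectrum hV.posDef_left
    obtain ⟨μ, hμ⟩ := exists_isSymplecticSpectrum hV.posDef_right
    have hS := hV.renyiTwo_eq hν
    have hδ := hV.ergotropicGap_eq hν hμ
    refine ⟨⟨hV.energy_ne_top, ?_, ?_⟩, ⟨ν, hcov ▸ hν, hV.one_le_spectrum hν, hS, hδ⟩, ?_, ?_⟩
    · rw [hV.globalMin_eq]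
      exact hV.exists_isGaussianUnitary_energy_eq
    · rw [hV.localMin_eq hν hμ]
      exact hV.exists_isLocalGaussianUnitary_energy_eq hν hμ
    · rw [hS, hδ]
      exact sum_log_le_sum_sub_one hν.1
    · rw [hS, hδ, sum_log_eq_sum_sub_one_iff hν.1]
      exact ⟨hV.isProduct_of_spectrum_eq_one hν hμ, hV.spectrum_eq_one_of_isProduct hν⟩
  · have hsqrt : √(4 : ℝ) = 2 := by
      rw [show (4 : ℝ) = 2 ^ 2 by norm_num, Real.sqrt_sq two_pos.le]
    -- The spectrum (2, 2, 1, …) has entropy log 4 and gap 2. It is played against (4, 1, …), with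
    -- the same entropy and gap 3, and against (3, 1, …), with the same gap and entropy log 3.
    obtain ⟨α, hα, hαS, hαδ⟩ :=
      exists_isPureGaussian_two_squeezed h₁₂ h₂ (C := 4) (by norm_num)
    rw [hsqrt] at hαδ
    refine ⟨fun C hC => ?_, ?_, ?_⟩
    · obtain ⟨ψ, hψ, hψS, hψδ⟩ := exists_isPureGaussian_two_squeezed h₁₂ h₂ hC.le
      obtain ⟨φ, hφ, hφS, hφδ⟩ := exists_isPureGaussian_one_squeezed h₁₂ h₁ hC.le
      refine ⟨ψ, φ, hψ, hφ, hψS, hφS, hψδ, hφδ, ?_⟩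
      rw [hψδ, hφδ]
      have h1 : √C ^ 2 = C := Real.sq_sqrt (by linarith)
      have h2 : 1 < √C := Real.lt_sqrt_of_sq_lt (by linarith)
      -- The difference of the two gaps is (√C − 1)², which is positive.
      intro h
      nlinarith
    · rintro ⟨F, hF⟩
      obtain ⟨β, hβ, hβS, hβδ⟩ :=
        exists_isPureGaussian_one_squeezed h₁₂ h₁ (C := 4) (by norm_num)
      have e1 := hF α hα
      have e2 := hF β hβ
      rw [hαS, hαδ] at e1
      rw [hβS, hβδ, ← e1] at e2
      norm_num at e2
    · rintro ⟨G, hG⟩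
      obtain ⟨β, hβ, hβS, hβδ⟩ :=
        exists_isPureGaussian_one_squeezed h₁₂ h₁ (C := 3) (by norm_num)
      have e1 := hG α hα
      have e2 := hG β hβ
      rw [hαS, hαδ] at e1
      rw [hβS, hβδ, show (3 : ℝ) - 1 = 2 * (2 - 1) by norm_num, ← e1] at e2
      have := Real.log_lt_log (x := 3) (y := 4) (by norm_num) (by norm_num)
      exact this.ne e2
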